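/- Let $\mathbb{F}_q$ be a finite field of odd characteristic $p$, let $k$ be a global function field with constants $\mathbb{F}_q$ (a finite extension of $\mathbb{F}_q(X)$), let $\infty$ be a place of $k$, and let $A\subset k$ be the ring of functions that are regular outside $\infty$. Let $E/k$ be an elliptic curve that is non-isotrivial, i.e. its $j$-invariant is not constant (not algebraic over $\mathbb{F}_q$). Let $K/k$ be an imaginary quadratic extension, i.e. $[K:k]=2$ and $\infty$ does not split in $K$, and let $\mathcal{O}_K$ be the integral closure of $A$ in $K$. Let $\mathfrak{p}\subset A$ be a nonzero prime ideal. For $n\ge 1$ let $\mathcal{O}_n=A+\mathfrak{p}^n\mathcal{O}_K$ be the order of conductor $\mathfrak{p}^n$ and let $K[\mathfrak{p}^n]\subset K^{\mathrm{sep}}$ be its ring class field, i.e. the largest abelian extension of $K$ that is unramified at the primes of $\mathcal{O}_K$ not dividing $\mathfrak{p}$ and in which the Artin symbol of $\alpha\mathcal{O}_K$ is trivial for every $\alpha\in\mathcal{O}_n$ coprime to $\mathfrak{p}$ (so that $\mathrm{Gal}(K[\mathfrak{p}^n]/K)\cong\mathrm{Pic}(\mathcal{O}_n)$). Put $K[\mathfrak{p}^\infty]=\bigcup_{n\ge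 1}K[\mathfrak{p}^n]$. Then the torsion subgroup $E_{\mathrm{tors}}(K[\mathfrak{p}^\infty])$ of $E(K[\mathfrak{p}^\infty])$ is finite. -/

import Mathlib

open scoped nonZeroDivisors RatFunc

noncomputable section

namespace RingClassTower

section Artin

variable (R : Type*) [CommRing R] {K L : Type*} [Field K] [Field L] [Algebra R K]
  [Algebra K L] [Algebra R L] [IsScalarTower R K L]

/-- The restriction of `σ ∈ Gal(L/K)` to the integral closure of `R` in `L`. -/
def restrictIntegers (σ : L ≃ₐ[K] L) :
    integralClosure R L →ₐ[R] integralClosure R L :=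
  ((σ.restrictScalars R).mapIntegralClosure : integralClosure R L ≃ₐ[R] integralClosure R L)

/-- Let `R` be a Dedekind domain with fraction field `K`, and `L/K` a finite abelian extension.
The homomorphism `φ` from the nonzero ideals of `R` to `Gal(L/K)` is an Artin map away from `𝔪`
if it sends each nonzero prime `𝔮` not dividing `𝔪` to a Frobenius element at every prime of `L`
above `𝔮`, i.e. `φ 𝔮 x ≡ x ^ #(R/𝔮)` modulo each such prime. When `L/K` is unramified away from
`𝔪` this determines `φ` on all ideals coprime to `𝔪`: it is the Artin symbol `(·, L/K)`. -/
def IsArtinMap (𝔪 : Ideal R) (φ : (Ideal R)⁰ →* (L ≃ₐ[K] L)) : Prop :=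
  ∀ 𝔮 : (Ideal R)⁰, (𝔮 : Ideal R).IsPrime → ¬ 𝔪 ≤ 𝔮 →
    ∀ Q : Ideal (integralClosure R L), Q.IsPrime → Q.under R = 𝔮 →
      (restrictIntegers R (φ 𝔮)).IsArithFrobAt Q

variable (K L) in
/-- The extension `L/K` is unramified at every nonzero prime of `R` that does not divide `𝔪`. -/
def IsUnramifiedAwayFrom (𝔪 : Ideal R) : Prop :=
  ∀ (Q : Ideal (integralClosure R L)) [Q.IsPrime], Q.under R ≠ ⊥ → ¬ 𝔪 ≤ Q.under R →
    Algebra.IsUnramifiedAt R Q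

end Artin

section Setting

variable {k : Type*} [Field k]

/-- The ring of functions in the global function field `k` that are regular outside the place
`V∞`. The places of `k` are its nontrivial valuation rings (these automatically contain the
constants, as the constant field is finite). -/
def regularOutside (Vinf : ValuationSubring k) : Subring k where
  carrier := {x | ∀ V : ValuationSubring k, V ≠ ⊤ → V ≠ Vinf → x ∈ V}
  mul_mem' hx hy V h h' := V.mul_mem _ _ (hx V h h') (hy V h h')
  one_mem' V _ _ := V.one_mem
  add_mem' hx hy V h h' := V.add_mem _ _ (hx V h h') (hy V h h')
  zero_mem' V _ _ := V.zero_mem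
  neg_mem' hx V h h' := V.neg_mem _ (hx V h h')

/-- The place `V` of `k` does not split in `K`: exactly one place of `K` lies above it. -/
def IsNonsplit (K : Type*) [Field K] [Algebra k K] (V : ValuationSubring k) : Prop :=
  ∃! W : ValuationSubring K, W.comap (algebraMap k K) = V

variable (A : Subring k) (K : Type*) [Field K] [Algebra k K]

/-- `𝓞_K`, the integral closure of `A` in `K`. -/
abbrev maxOrder : Subalgebra A K := integralClosure A K

variable {A}

/-- The ideal `𝔭 𝓞_K`. -/
def extend (𝔭 : Ideal A) : Ideal (maxOrder A K) := 𝔭.map (algebraMap A (maxOrder A K))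

/-- The order `𝓞_n = A + 𝔭ⁿ 𝓞_K` of conductor `𝔭ⁿ`, as a subalgebra of `𝓞_K`: the preimage of
the image of `A` in `𝓞_K / 𝔭ⁿ 𝓞_K`. -/
def order (𝔭 : Ideal A) (n : ℕ) : Subalgebra A (maxOrder A K) :=
  (⊥ : Subalgebra A (maxOrder A K ⧸ extend K 𝔭 ^ n)).comap
    (Ideal.Quotient.mkₐ A (extend K 𝔭 ^ n))

theorem mem_order_iff (𝔭 : Ideal A) (n : ℕ) (x : maxOrder A K) :
    x ∈ order K 𝔭 n ↔
      ∃ a : A, ∃ y ∈ extend K 𝔭 ^ n, x = algebraMap A (maxOrder A K) a + y := by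
  rw [order, Subalgebra.mem_comap, Algebra.mem_bot]
  constructor
  · rintro ⟨a, ha⟩
    refine ⟨a, x - algebraMap A (maxOrder A K) a, ?_, by ring⟩
    rw [← Ideal.Quotient.eq]
    exact ha.symm
  · rintro ⟨a, y, hy, rfl⟩
    refine ⟨a, ?_⟩
    have : Ideal.Quotient.mk (extend K 𝔭 ^ n) y = 0 := Ideal.Quotient.eq_zero_iff_mem.mpr hy
    simp only [Ideal.Quotient.mkₐ_eq_mk, map_add, this, add_zero]
    rfl

variable {K} in
/-- The nonzero principal ideal `α 𝓞_K`, as an element of the monoid of nonzero ideals. -/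
def principal (α : maxOrder A K) (hα : α ≠ 0) : (Ideal (maxOrder A K))⁰ :=
  ⟨Ideal.span {α}, mem_nonZeroDivisors_of_ne_zero fun h =>
    hα (Ideal.span_singleton_eq_bot.mp h)⟩

/-- `L/K` is a finite abelian extension, unramified at the nonzero primes of `𝓞_K` not dividing
`𝔭`, whose Artin symbol `(·, L/K)` is trivial on the principal ideals `α 𝓞_K` with
`α ∈ 𝓞_n` coprime to `𝔭`; in other words the Artin map factors through the class group
`Pic(𝓞_n)`, viewed as the ideals of `𝓞_K` coprime to `𝔭` modulo the group generated by these
principal ideals. -/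
structure IsRingClassExtension (𝔭 : Ideal A) (n : ℕ) (L : Type*) [Field L] [Algebra K L] :
    Prop where
  finite : FiniteDimensional K L
  abelian : IsAbelianGalois K L
  unramified : IsUnramifiedAwayFrom (maxOrder A K) L (extend K 𝔭)
  artin : ∃ φ : (Ideal (maxOrder A K))⁰ →* (L ≃ₐ[K] L),
    IsArtinMap (maxOrder A K) (extend K 𝔭) φ ∧
      ∀ (α : maxOrder A K) (hα : α ≠ 0), α ∈ order K 𝔭 n →
        IsCoprime (Ideal.span {α}) (extend K 𝔭) → φ (principal α hα) = 1

/-- The ring class field `K[𝔭ⁿ]` of `𝓞_n`, inside the separable closure of `K`: the largest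
abelian extension of `K` whose Artin map factors through `Pic(𝓞_n)`. It is the class field of the
idele class subgroup generated by `K_∞ˣ` and the unit ideles of `𝓞_n`, so
`Gal(K[𝔭ⁿ]/K) ≅ Pic(𝓞_n)`; the symbols being trivial on the principal ideals of all `α`,
without a condition at the place `∞`, this place splits completely. -/
def ringClassField (𝔭 : Ideal A) (n : ℕ) : IntermediateField K (SeparableClosure K) :=
  ⨆ (L : IntermediateField K (SeparableClosure K)) (_ : IsRingClassExtension K 𝔭 n L), L

/-- `K[𝔭^∞]`, the union of the increasing tower of ring class fields `K[𝔭ⁿ]`, `n ≥ 1`. -/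
def ringClassTower (𝔭 : Ideal A) : IntermediateField K (SeparableClosure K) :=
  ⨆ (n : ℕ) (_ : 1 ≤ n), ringClassField K 𝔭 n

end Setting

end RingClassTower

end

/-! The tower carries a discrete valuation with finite residue field, and over such a field of odd
characteristic `p` an elliptic curve has finite torsion.

The valuation. Let Q be a prime of `𝓞_K` away from `𝔭` with Q^H = (a), where a lies in `A` but not
in `𝔭`. Since a belongs to every order `𝓞_n`, the Artin symbol of Q in each ring class extension has
order dividing H, whatever the level (`IsRingClassExtension.hasFrobeniusOrder`). So Q is unramified
with bounded residue degrees in the whole tower, and a place above Q has finite quotients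
(`exists_valuation_finite_approx`).

The prime. If a maximal ideal M of `A`, away from `𝔭`, does not split in `K`, then `M 𝓞_K` is a
power of one prime Q, and some power of M is principal because the class group of `A` is finite; so
Q is as required. To find M, write K = k(√t) with t in `A` and k separable over F_q(t). Suppose t is
a square modulo every M prime to t and to a fixed π in `𝔭`. For w in tπA, t is then a square modulo
1 + w, and the norm of t on A/(1 + w) can be read off from the leading term of the norm of 1 + w to
F_q[t] (`Polynomial.isSquare_leadingCoeff_norm`). This constrains at infinity the norms of all such
w, hence of all of kˣ, hence of the uniformizers at ∞, and makes t a square times a principal unit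
there (`IsLocalRing.exists_even_isSquare_residue`). Then ∞ would split in `K`
(`ne_one_add_of_isNonsplit`).

Torsion. Near the origin z = x/y is additive to first order, so these points are stable under
multiples and contain no torsion of order prime to `p`. As only finitely many points are killed by
`p` (`finite_setOf_nsmul_eq_zero`), a smaller neighbourhood of the origin is torsion-free. The other
torsion points have bounded coordinates, and two of them with close coordinates differ by a point of
the neighbourhood, hence agree. The finiteness of the quotients of the valuation ring now bounds
their number (`finite_torsion_of_isCharNeTwoNF`).

Points of order `p`. Such a point P gives a function g = A + By with divisor p(P) - p(0). Since dg/g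
is then a constant multiple of the invariant differential, A is an eigenvector of (2y d/dx)² = 4f
d²/dx² + 2f' d/dx among polynomials of degree below p/2. There are finitely many eigenvalues, and
each determines A up to a scalar and then the abscissa of P. -/

/-! ### Ultrametric estimates for a cubic near infinity -/

section ValuedCubic

variable {T Γ : Type*} [Field T] [LinearOrderedCommGroupWithZero Γ] (v : Valuation T Γ)

theorem Valuation.map_mul_le_mul {x y : T} {g h : Γ} (hx : v x ≤ g) (hy : v y ≤ h) :
    v (x * y) ≤ g * h := by
  rw [map_mul]; exact mul_le_mul' hx hy

theorem Valuation.map_pow_le_pow {x : T} {g : Γ} (hx : v x ≤ g) (n : ℕ) :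
    v (x ^ n) ≤ g ^ n := by
  rw [map_pow]; exact pow_le_pow_left₀ zero_le hx n

/-- The coefficients of `x³ + ax² + bx + c` are bounded as if its roots had size at most `ρ`. -/
structure CubicBound (a b c : T) (ρ : Γ) : Prop where
  a_le : v a ≤ ρ
  b_le : v b ≤ ρ ^ 2
  c_le : v c ≤ ρ ^ 3

variable {v} {a b c : T} {ρ : Γ}

theorem CubicBound.map_eq_of_lt (h : CubicBound v a b c ρ) {x : T} (hx : ρ < v x) :
    v (x ^ 3 + a * x ^ 2 + b * x + c) = v x ^ 3 := by
  have hx0 : 0 < v x := lt_of_le_of_lt zero_le hx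
  have h1 : v (a * x ^ 2) < v (x ^ 3) := by
    rw [map_mul, map_pow, map_pow, pow_succ' (v x) 2]
    exact mul_lt_mul_of_pos_right (h.a_le.trans_lt hx) (pow_pos hx0 2)
  have h2 : v (b * x) < v (x ^ 3) := by
    rw [map_mul, map_pow, pow_succ (v x) 2]
    exact mul_lt_mul_of_pos_right (h.b_le.trans_lt (pow_lt_pow_left₀ hx zero_le two_ne_zero)) hx0
  have h3 : v c < v (x ^ 3) := by
    rw [map_pow]
    exact h.c_le.trans_lt (pow_lt_pow_left₀ hx zero_le three_ne_zero)
  rw [add_assoc, add_assoc, v.map_add_eq_of_lt_left (v.map_add_lt h1 (v.map_add_lt h2 h3)), map_pow]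

theorem CubicBound.map_le_of_le (h : CubicBound v a b c ρ) {x : T} (hx : v x ≤ ρ) :
    v (x ^ 3 + a * x ^ 2 + b * x + c) ≤ ρ ^ 3 := by
  refine v.map_add_le (v.map_add_le (v.map_add_le (v.map_pow_le_pow hx 3) ?_) ?_) h.c_le
  · exact (v.map_mul_le_mul h.a_le (v.map_pow_le_pow hx 2)).trans (pow_succ' ρ 2).ge
  · exact (v.map_mul_le_mul h.b_le hx).trans (pow_succ ρ 2).ge

/-- In the coordinates `z = x/y`, `w = 1/y` at infinity, `w` is a function of `z` of order three. -/
theorem CubicBound.map_sub_le (h : CubicBound v a b c ρ) {ε : Γ} (hε : ρ * ε ^ 2 < 1)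
    {z₁ z₂ w₁ w₂ : T} (hz₁ : v z₁ ≤ ε) (hz₂ : v z₂ ≤ ε) (hw₁ : v w₁ ≤ ε ^ 3) (hw₂ : v w₂ ≤ ε ^ 3)
    (e₁ : w₁ = z₁ ^ 3 + a * z₁ ^ 2 * w₁ + b * z₁ * w₁ ^ 2 + c * w₁ ^ 3)
    (e₂ : w₂ = z₂ ^ 3 + a * z₂ ^ 2 * w₂ + b * z₂ * w₂ ^ 2 + c * w₂ ^ 3) :
    v (w₁ - w₂) ≤ ε ^ 2 * v (z₁ - z₂) := by
  set U := a * z₁ ^ 2 + b * z₁ * (w₁ + w₂) + c * (w₁ ^ 2 + w₁ * w₂ + w₂ ^ 2) with hU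
  set V := z₁ ^ 2 + z₁ * z₂ + z₂ ^ 2 + a * w₂ * (z₁ + z₂) + b * w₂ ^ 2 with hV
  -- Difference of the two equations, with the multiples of w₁ - w₂ collected on the left. Every
  -- term of U is at most ρε² < 1 in size, so 1 - U is a unit, and every term of V is at most ε².
  have key : (w₁ - w₂) * (1 - U) = V * (z₁ - z₂) := by
    rw [hU, hV]; linear_combination e₁ - e₂
  have p2 : (ρ * ε ^ 2) ^ 2 ≤ ρ * ε ^ 2 := pow_le_of_le_one zero_le hε.le two_ne_zero
  have p3 : (ρ * ε ^ 2) ^ 3 ≤ ρ * ε ^ 2 := pow_le_of_le_one zero_le hε.le three_ne_zero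
  have hUlt : v U < 1 := by
    refine lt_of_le_of_lt ?_ hε
    refine v.map_add_le (v.map_add_le (v.map_mul_le_mul h.a_le (v.map_pow_le_pow hz₁ 2)) ?_) ?_
    · refine le_trans ?_ p2
      refine (v.map_mul_le_mul (v.map_mul_le_mul h.b_le hz₁) (v.map_add_le hw₁ hw₂)).trans_eq ?_
      simp only [pow_succ, pow_zero, one_mul]; ac_rfl
    · refine le_trans ?_ p3
      have : v (w₁ ^ 2 + w₁ * w₂ + w₂ ^ 2) ≤ ε ^ 6 := by
        refine v.map_add_le (v.map_add_le ?_ ?_) ?_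
        · exact (v.map_pow_le_pow hw₁ 2).trans_eq (by simp only [pow_succ, pow_zero, one_mul]; ac_rfl)
        · exact (v.map_mul_le_mul hw₁ hw₂).trans_eq (by simp only [pow_succ, pow_zero, one_mul]; ac_rfl)
        · exact (v.map_pow_le_pow hw₂ 2).trans_eq (by simp only [pow_succ, pow_zero, one_mul]; ac_rfl)
      exact (v.map_mul_le_mul h.c_le this).trans_eq (by simp only [pow_succ, pow_zero, one_mul]; ac_rfl)
  have hVle : v V ≤ ε ^ 2 := by
    have l1 : (ρ * ε ^ 2) * ε ^ 2 ≤ ε ^ 2 := mul_le_of_le_one_left' hε.le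
    have l2 : (ρ * ε ^ 2) ^ 2 * ε ^ 2 ≤ ε ^ 2 := mul_le_of_le_one_left' (p2.trans hε.le)
    refine v.map_add_le (v.map_add_le (v.map_add_le (v.map_add_le ?_ ?_) ?_) ?_) ?_
    · exact v.map_pow_le_pow hz₁ 2
    · exact (v.map_mul_le_mul hz₁ hz₂).trans_eq (by simp only [pow_succ, pow_zero, one_mul])
    · exact v.map_pow_le_pow hz₂ 2
    · refine le_trans ?_ l1
      exact (v.map_mul_le_mul (v.map_mul_le_mul h.a_le hw₂) (v.map_add_le hz₁ hz₂)).trans_eq (by simp only [pow_succ, pow_zero, one_mul]; ac_rfl)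
    · refine le_trans ?_ l2
      exact (v.map_mul_le_mul h.b_le (v.map_pow_le_pow hw₂ 2)).trans_eq (by simp only [pow_succ, pow_zero, one_mul]; ac_rfl)
  have h1 : v (1 - U) = 1 := by
    rw [v.map_sub_eq_of_lt_left (by rwa [map_one]), map_one]
  calc v (w₁ - w₂) = v ((w₁ - w₂) * (1 - U)) := by rw [map_mul, h1, mul_one]
    _ = v V * v (z₁ - z₂) := by rw [key, map_mul]
    _ ≤ ε ^ 2 * v (z₁ - z₂) := mul_le_mul_left hVle _

/-- If the line `y = ℓx + m` cuts the curve `y² = x³ + ax² + bx + c` in three points, of which two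
are close to infinity, then so is the third, and the parameters `x/y` nearly add up to zero. -/
theorem CubicBound.collinear (h : CubicBound v a b c ρ) {ε : Γ} (hε : ρ * ε ^ 2 < 1) (hε0 : ε ≠ 0)
    {ℓ m x₁ x₂ x₃ : T} (hm : 1 ≤ ε ^ 3 * v m) (hℓ : v ℓ ≤ ε ^ 2 * v m)
    (s₁ : x₁ + x₂ + x₃ = ℓ ^ 2 - a) (s₂ : x₁ * x₂ + x₁ * x₃ + x₂ * x₃ = b - 2 * ℓ * m)
    (s₃ : x₁ * x₂ * x₃ = m ^ 2 - c)
    (hz₁ : v (x₁ / (ℓ * x₁ + m)) ≤ ε) (hz₂ : v (x₂ / (ℓ * x₂ + m)) ≤ ε) :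
    ρ < v x₃ ∧ v (x₁ / (ℓ * x₁ + m) + x₂ / (ℓ * x₂ + m) + x₃ / (ℓ * x₃ + m)) < ε := by
  have hεp : 0 < ε := zero_lt_iff.mpr hε0
  have hm0 : v m ≠ 0 := fun h0 ↦ by rw [h0, mul_zero] at hm; exact absurd hm (not_le.mpr one_pos)
  have hmp : 0 < v m := zero_lt_iff.mpr hm0
  have p2 : (ρ * ε ^ 2) ^ 2 < 1 := pow_lt_one₀ zero_le hε two_ne_zero
  have p3 : (ρ * ε ^ 2) ^ 3 < 1 := pow_lt_one₀ zero_le hε three_ne_zero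
  -- Vieta: the product of the three ordinates is the homogenized cubic at (-m : ℓ) up to sign,
  -- since the square of the line vanishes there. The term m³ dominates.
  have hprod : (ℓ * x₁ + m) * (ℓ * x₂ + m) * (ℓ * x₃ + m) =
      m ^ 3 + (-(a * ℓ * m ^ 2) + b * ℓ ^ 2 * m - c * ℓ ^ 3) := by
    linear_combination ℓ ^ 3 * s₃ + ℓ ^ 2 * m * s₂ + ℓ * m ^ 2 * s₁
  have hvprod : v ((ℓ * x₁ + m) * (ℓ * x₂ + m) * (ℓ * x₃ + m)) = v m ^ 3 := by
    have hm3 : 0 < v m ^ 3 := pow_pos hmp 3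
    rw [hprod, v.map_add_eq_of_lt_left, map_pow]
    rw [map_pow]
    refine v.map_sub_lt (v.map_add_lt ?_ ?_) ?_
    · rw [Valuation.map_neg]
      calc v (a * ℓ * m ^ 2) ≤ ρ * (ε ^ 2 * v m) * v m ^ 2 :=
            v.map_mul_le_mul (v.map_mul_le_mul h.a_le hℓ) (v.map_pow_le_pow le_rfl 2)
        _ = (ρ * ε ^ 2) * v m ^ 3 := by simp only [pow_succ, pow_zero, one_mul]; ac_rfl
        _ < 1 * v m ^ 3 := mul_lt_mul_of_pos_right hε hm3
        _ = v m ^ 3 := one_mul _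
    · calc v (b * ℓ ^ 2 * m) ≤ ρ ^ 2 * (ε ^ 2 * v m) ^ 2 * v m :=
            v.map_mul_le_mul (v.map_mul_le_mul h.b_le (v.map_pow_le_pow hℓ 2)) le_rfl
        _ = (ρ * ε ^ 2) ^ 2 * v m ^ 3 := by simp only [pow_succ, pow_zero, one_mul]; ac_rfl
        _ < 1 * v m ^ 3 := mul_lt_mul_of_pos_right p2 hm3
        _ = v m ^ 3 := one_mul _
    · calc v (c * ℓ ^ 3) ≤ ρ ^ 3 * (ε ^ 2 * v m) ^ 3 :=
            v.map_mul_le_mul h.c_le (v.map_pow_le_pow hℓ 3)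
        _ = (ρ * ε ^ 2) ^ 3 * v m ^ 3 := by simp only [pow_succ, pow_zero, one_mul]; ac_rfl
        _ < 1 * v m ^ 3 := mul_lt_mul_of_pos_right p3 hm3
        _ = v m ^ 3 := one_mul _
  have hne : (ℓ * x₁ + m) * (ℓ * x₂ + m) * (ℓ * x₃ + m) ≠ 0 := by
    rw [← v.ne_zero_iff, hvprod]; exact pow_ne_zero 3 hm0
  have y₃0 : ℓ * x₃ + m ≠ 0 := right_ne_zero_of_mul hne
  have y₂0 : ℓ * x₂ + m ≠ 0 := right_ne_zero_of_mul (left_ne_zero_of_mul hne)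
  have y₁0 : ℓ * x₁ + m ≠ 0 := left_ne_zero_of_mul (left_ne_zero_of_mul hne)
  -- After clearing denominators the ℓ²m² terms cancel, which leaves a numerator of size at most
  -- ρ|m|² over a denominator of size |m|³.
  have hsum : (x₁ / (ℓ * x₁ + m) + x₂ / (ℓ * x₂ + m) + x₃ / (ℓ * x₃ + m)) *
      ((ℓ * x₁ + m) * (ℓ * x₂ + m) * (ℓ * x₃ + m)) =
      -(a * m ^ 2) + (2 * b * ℓ * m - 3 * c * ℓ ^ 2) := by
    have e1 : (x₁ / (ℓ * x₁ + m) + x₂ / (ℓ * x₂ + m) + x₃ / (ℓ * x₃ + m)) *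
      ((ℓ * x₁ + m) * (ℓ * x₂ + m) * (ℓ * x₃ + m)) = x₁ * ((ℓ * x₂ + m) * (ℓ * x₃ + m)) +
      x₂ * ((ℓ * x₁ + m) * (ℓ * x₃ + m)) + x₃ * ((ℓ * x₁ + m) * (ℓ * x₂ + m)) := by
      have e0 : ∀ i j k y₁ y₂ y₃ : T, y₁ ≠ 0 → y₂ ≠ 0 → y₃ ≠ 0 →
          (i / y₁ + j / y₂ + k / y₃) * (y₁ * y₂ * y₃) =
            i * (y₂ * y₃) + j * (y₁ * y₃) + k * (y₁ * y₂) := by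
        intro i j k y₁ y₂ y₃ _ _ _; field_simp
      exact e0 _ _ _ _ _ _ y₁0 y₂0 y₃0
    rw [e1]
    linear_combination 3 * ℓ ^ 2 * s₃ + 2 * ℓ * m * s₂ + m ^ 2 * s₁
  have int2 : v (2 : T) ≤ 1 := by
    simpa [one_add_one_eq_two] using v.map_add_le (v.map_one.le) (v.map_one.le)
  have int3 : v (3 : T) ≤ 1 := by
    have := v.map_add_le int2 v.map_one.le
    rwa [show (2 : T) + 1 = 3 by norm_num] at this
  have hsumlt : v (x₁ / (ℓ * x₁ + m) + x₂ / (ℓ * x₂ + m) + x₃ / (ℓ * x₃ + m)) < ε := by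
    have hnum : v (-(a * m ^ 2) + (2 * b * ℓ * m - 3 * c * ℓ ^ 2)) ≤ ρ * v m ^ 2 := by
      refine v.map_add_le ?_ (v.map_sub_le ?_ ?_)
      · rw [Valuation.map_neg]
        exact v.map_mul_le_mul h.a_le (v.map_pow_le_pow le_rfl 2)
      · calc v (2 * b * ℓ * m) ≤ 1 * ρ ^ 2 * (ε ^ 2 * v m) * v m :=
              v.map_mul_le_mul (v.map_mul_le_mul (v.map_mul_le_mul int2 h.b_le) hℓ) le_rfl
          _ = (ρ * ε ^ 2) * (ρ * v m ^ 2) := by simp only [pow_succ, pow_zero, one_mul]; ac_rfl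
          _ ≤ ρ * v m ^ 2 := mul_le_of_le_one_left' hε.le
      · calc v (3 * c * ℓ ^ 2) ≤ 1 * ρ ^ 3 * (ε ^ 2 * v m) ^ 2 :=
              v.map_mul_le_mul (v.map_mul_le_mul int3 h.c_le) (v.map_pow_le_pow hℓ 2)
          _ = (ρ * ε ^ 2) ^ 2 * (ρ * v m ^ 2) := by
              simp only [pow_succ, pow_zero, one_mul]; ac_rfl
          _ ≤ ρ * v m ^ 2 := mul_le_of_le_one_left' p2.le
    rw [← hsum, map_mul, hvprod] at hnum
    refine lt_of_mul_lt_mul_right (a := v m ^ 3) ?_ zero_le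
    refine hnum.trans_lt ?_
    calc ρ * v m ^ 2 = ρ * v m ^ 2 * 1 := (mul_one _).symm
      _ ≤ ρ * v m ^ 2 * (ε ^ 3 * v m) := mul_le_mul_right hm _
      _ = (ρ * ε ^ 2) * (ε * v m ^ 3) := by simp only [pow_succ, pow_zero, one_mul]; ac_rfl
      _ < 1 * (ε * v m ^ 3) := mul_lt_mul_of_pos_right hε (mul_pos hεp (pow_pos hmp 3))
      _ = ε * v m ^ 3 := one_mul _
  -- If |x₃| ≤ ρ, then |y₃|² ≤ ρ³ by the equation of the curve. But z₃ has size at most ε because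
  -- the sum does, so the line gives |1/y₃| ≤ ε³. Together these say 1 ≤ (ρε²)³.
  refine ⟨lt_of_not_ge fun hx₃ ↦ ?_, hsumlt⟩
  have hz₃ : v (x₃ / (ℓ * x₃ + m)) ≤ ε := by
    have : x₃ / (ℓ * x₃ + m) = (x₁ / (ℓ * x₁ + m) + x₂ / (ℓ * x₂ + m) + x₃ / (ℓ * x₃ + m)) -
      (x₁ / (ℓ * x₁ + m) + x₂ / (ℓ * x₂ + m)) := by ring
    rw [this]
    exact v.map_sub_le hsumlt.le (v.map_add_le hz₁ hz₂)
  have hw₃ : v (ℓ * x₃ + m)⁻¹ ≤ ε ^ 3 := by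
    have e : m * (ℓ * x₃ + m)⁻¹ = 1 - ℓ * (x₃ / (ℓ * x₃ + m)) := by
      field_simp; ring
    have : v m * v (ℓ * x₃ + m)⁻¹ ≤ v m * ε ^ 3 := by
      rw [← map_mul, e]
      refine v.map_sub_le ?_ ?_
      · rw [map_one, mul_comm]; exact hm
      · exact (v.map_mul_le_mul hℓ hz₃).trans_eq (by
          simp only [pow_succ, pow_zero, one_mul]; ac_rfl)
    exact le_of_mul_le_mul_left this hmp
  have hy₃ : (ℓ * x₃ + m) ^ 2 = x₃ ^ 3 + a * x₃ ^ 2 + b * x₃ + c := by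
    linear_combination (-(x₃ ^ 2)) * s₁ + x₃ * s₂ - s₃
  have h1 : v (ℓ * x₃ + m) ^ 2 ≤ ρ ^ 3 := by
    rw [← map_pow, hy₃]; exact h.map_le_of_le hx₃
  rw [map_inv₀] at hw₃
  have h2 : 1 ≤ ε ^ 3 * v (ℓ * x₃ + m) := by
    rwa [inv_le_iff_one_le_mul₀ (zero_lt_iff.mpr ((v.ne_zero_iff).mpr y₃0))] at hw₃
  have h3 : (1 : Γ) ≤ (ρ * ε ^ 2) ^ 3 := by
    calc (1 : Γ) ≤ (ε ^ 3 * v (ℓ * x₃ + m)) ^ 2 := one_le_pow₀ h2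
      _ = v (ℓ * x₃ + m) ^ 2 * ε ^ 6 := by simp only [pow_succ, pow_zero, one_mul]; ac_rfl
      _ ≤ ρ ^ 3 * ε ^ 6 := mul_le_mul_left h1 _
      _ = (ρ * ε ^ 2) ^ 3 := by simp only [pow_succ, pow_zero, one_mul]; ac_rfl
  exact absurd h3 (not_le.mpr p3)

end ValuedCubic

/-! ### Neighbourhoods of the origin on an elliptic curve -/

namespace WeierstrassCurve.Affine

variable {T Γ : Type*} [Field T] [LinearOrderedCommGroupWithZero Γ] {v : Valuation T Γ}
  {W : WeierstrassCurve.Affine T} [W.IsCharNeTwoNF] {ρ : Γ}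

theorem equation_iff_of_isCharNeTwoNF (x y : T) :
    W.Equation x y ↔ y ^ 2 = x ^ 3 + W.a₂ * x ^ 2 + W.a₄ * x + W.a₆ := by
  rw [equation_iff]; simp

theorem negY_of_isCharNeTwoNF (x y : T) : W.negY x y = -y := by simp [negY]

section coordinates

variable (hW : CubicBound v W.a₂ W.a₄ W.a₆ ρ) {x y : T} (h : W.Equation x y) (hx : ρ < v x)
include hW h hx

theorem map_sq_eq_of_lt : v y ^ 2 = v x ^ 3 := by
  rw [← map_pow, (equation_iff_of_isCharNeTwoNF x y).mp h, hW.map_eq_of_lt hx]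

theorem ne_zero_of_lt : x ≠ 0 ∧ y ≠ 0 := by
  have hx0 : x ≠ 0 := (v.ne_zero_iff).mp (zero_le.trans_lt hx).ne'
  refine ⟨hx0, fun hy ↦ ?_⟩
  have := map_sq_eq_of_lt hW h hx
  rw [hy, map_zero, zero_pow two_ne_zero, eq_comm, pow_eq_zero_iff three_ne_zero, v.zero_iff] at this
  exact hx0 this

theorem map_div_sq_mul : v (x / y) ^ 2 * v x = 1 := by
  obtain ⟨hx0, hy0⟩ := ne_zero_of_lt hW h hx
  have hx' : v x ≠ 0 := v.ne_zero_iff.mpr hx0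
  rw [map_div₀, div_pow, map_sq_eq_of_lt hW h hx, div_mul_eq_mul_div, ← pow_succ,
    div_self (pow_ne_zero 3 hx')]

theorem map_inv_eq_div_pow : v y⁻¹ = v (x / y) ^ 3 := by
  obtain ⟨hx0, hy0⟩ := ne_zero_of_lt hW h hx
  have hx' : v x ≠ 0 := v.ne_zero_iff.mpr hx0
  have hy' : v y ≠ 0 := v.ne_zero_iff.mpr hy0
  rw [map_div₀, div_pow, ← map_sq_eq_of_lt hW h hx, map_inv₀, pow_succ (v y) 2, div_mul_eq_div_div,
    div_self (pow_ne_zero 2 hy'), one_div]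

theorem mul_map_div_sq_lt_one : ρ * v (x / y) ^ 2 < 1 := by
  obtain ⟨hx0, hy0⟩ := ne_zero_of_lt hW h hx
  have : 0 < v (x / y) := zero_lt_iff.mpr (v.ne_zero_iff.mpr (div_ne_zero hx0 hy0))
  rw [← map_div_sq_mul hW h hx, mul_comm]
  exact mul_lt_mul_of_pos_left hx (pow_pos this 2)

/-- The equation of the curve divided by y³, that is, in the coordinates z = x/y and w = 1/y to
which `CubicBound.map_sub_le` applies. -/
theorem inv_eq_of_lt : y⁻¹ = (x / y) ^ 3 + W.a₂ * (x / y) ^ 2 * y⁻¹ + W.a₄ * (x / y) * y⁻¹ ^ 2 +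
    W.a₆ * y⁻¹ ^ 3 := by
  obtain ⟨hx0, hy0⟩ := ne_zero_of_lt hW h hx
  have := (equation_iff_of_isCharNeTwoNF x y).mp h
  field_simp
  linear_combination this

end coordinates

section line

variable [DecidableEq T] {x₁ x₂ y₁ y₂ : T} (h₁ : W.Equation x₁ y₁) (h₂ : W.Equation x₂ y₂)
  (hxy : ¬(x₁ = x₂ ∧ y₁ = W.negY x₂ y₂))
include h₁ h₂ hxy

/-- Vieta for the cubic in x obtained by substituting the line into the equation of the curve; this
is the input of `CubicBound.collinear`. -/
theorem slope_symmetric :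
    x₁ + x₂ + W.addX x₁ x₂ (W.slope x₁ x₂ y₁ y₂) = W.slope x₁ x₂ y₁ y₂ ^ 2 - W.a₂ ∧
    x₁ * x₂ + x₁ * W.addX x₁ x₂ (W.slope x₁ x₂ y₁ y₂) + x₂ * W.addX x₁ x₂ (W.slope x₁ x₂ y₁ y₂) =
      W.a₄ - 2 * W.slope x₁ x₂ y₁ y₂ * (y₁ - W.slope x₁ x₂ y₁ y₂ * x₁) ∧
    x₁ * x₂ * W.addX x₁ x₂ (W.slope x₁ x₂ y₁ y₂) =
      (y₁ - W.slope x₁ x₂ y₁ y₂ * x₁) ^ 2 - W.a₆ := by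
  have key := addPolynomial_slope h₁ h₂ hxy
  rw [addPolynomial_eq, neg_inj, Cubic.prod_X_sub_C_eq, Cubic.toPoly_injective] at key
  have hc := congr_arg Cubic.c key
  have hd := congr_arg Cubic.d key
  simp only [a₁_of_isCharNeTwoNF, a₃_of_isCharNeTwoNF] at hc hd
  refine ⟨by simp, ?_, ?_⟩
  · rw [← hc]; ring
  · linear_combination hd

omit [W.IsCharNeTwoNF] in
theorem slope_mul_add_right :
    W.slope x₁ x₂ y₁ y₂ * x₂ + (y₁ - W.slope x₁ x₂ y₁ y₂ * x₁) = y₂ := by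
  by_cases hx : x₁ = x₂
  · have := Y_eq_of_Y_ne h₁ h₂ hx fun h ↦ hxy ⟨hx, h⟩
    rw [hx, this]; ring
  · rw [slope_of_X_ne hx]
    have : x₁ - x₂ ≠ 0 := sub_ne_zero.mpr hx
    field_simp
    ring

/-- The line through two points close to infinity is close to the line at infinity. -/
theorem slope_bounds (hW : CubicBound v W.a₂ W.a₄ W.a₆ ρ) (h2 : v 2 = 1) {ε : Γ}
    (hε : ρ * ε ^ 2 < 1) (hx₁ : ρ < v x₁) (hx₂ : ρ < v x₂)
    (hz₁ : v (x₁ / y₁) ≤ ε) (hz₂ : v (x₂ / y₂) ≤ ε) :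
    1 ≤ ε ^ 3 * v (y₁ - W.slope x₁ x₂ y₁ y₂ * x₁) ∧
      v (W.slope x₁ x₂ y₁ y₂) ≤ ε ^ 2 * v (y₁ - W.slope x₁ x₂ y₁ y₂ * x₁) := by
  obtain ⟨hx₁0, hy₁0⟩ := ne_zero_of_lt hW h₁ hx₁
  obtain ⟨hx₂0, hy₂0⟩ := ne_zero_of_lt hW h₂ hx₂
  have hw₁ : v y₁⁻¹ ≤ ε ^ 3 := by
    rw [map_inv_eq_div_pow hW h₁ hx₁]; exact pow_le_pow_left₀ zero_le hz₁ 3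
  have hw₂ : v y₂⁻¹ ≤ ε ^ 3 := by
    rw [map_inv_eq_div_pow hW h₂ hx₂]; exact pow_le_pow_left₀ zero_le hz₂ 3
  by_cases hx : x₁ = x₂
  · have hyn : y₁ ≠ W.negY x₂ y₂ := fun h ↦ hxy ⟨hx, h⟩
    have hy := Y_eq_of_Y_ne h₁ h₂ hx hyn
    have h20 : (2 : T) ≠ 0 := fun h0 ↦ by rw [h0, map_zero] at h2; exact zero_ne_one h2
    have hs : W.slope x₁ x₂ y₁ y₂ = (3 * x₁ ^ 2 + 2 * W.a₂ * x₁ + W.a₄) / (2 * y₁) := by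
      rw [slope_of_Y_ne hx hyn, negY_of_isCharNeTwoNF]; simp [two_mul]
    set ℓ := W.slope x₁ x₂ y₁ y₂
    -- Tangent case: x₁³ dominates on the right, so the intercept has the size of y₁.
    have hm : (y₁ - ℓ * x₁) * (2 * y₁) = -(x₁ ^ 3) + (W.a₄ * x₁ + 2 * W.a₆) := by
      have : ℓ * (2 * y₁) = 3 * x₁ ^ 2 + 2 * W.a₂ * x₁ + W.a₄ := by
        rw [hs]; field_simp
      linear_combination 2 * (equation_iff_of_isCharNeTwoNF x₁ y₁).mp h₁ - x₁ * this
    have hx₁p : 0 < v x₁ := zero_le.trans_lt hx₁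
    have hvm : v (y₁ - ℓ * x₁) * v y₁ = v x₁ ^ 3 := by
      have := congr_arg v hm
      rw [map_mul, map_mul, h2, one_mul] at this
      rw [this, v.map_add_eq_of_lt_left, Valuation.map_neg, map_pow]
      rw [Valuation.map_neg, map_pow]
      refine v.map_add_lt ?_ ?_
      · rw [map_mul, pow_succ]
        exact mul_lt_mul_of_pos_right
          (hW.b_le.trans_lt (pow_lt_pow_left₀ hx₁ zero_le two_ne_zero)) hx₁p
      · rw [map_mul, h2, one_mul]
        exact hW.c_le.trans_lt (pow_lt_pow_left₀ hx₁ zero_le three_ne_zero)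
    have hy₁p : 0 < v y₁ := zero_lt_iff.mpr (v.ne_zero_iff.mpr hy₁0)
    have hvm' : v (y₁ - ℓ * x₁) = v y₁ := by
      rw [← map_sq_eq_of_lt hW h₁ hx₁, sq] at hvm
      exact mul_right_cancel₀ hy₁p.ne' hvm
    have hvℓ : v ℓ * v y₁ ≤ v x₁ ^ 2 := by
      have : ℓ * (2 * y₁) = 3 * x₁ ^ 2 + 2 * W.a₂ * x₁ + W.a₄ := by
        rw [hs]; field_simp
      have := congr_arg v this
      rw [map_mul, map_mul, h2, one_mul] at this
      rw [this]
      have int3 : v (3 : T) ≤ 1 := by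
        have := v.map_add_le h2.le v.map_one.le
        rwa [show (2 : T) + 1 = 3 by norm_num] at this
      refine v.map_add_le (v.map_add_le ?_ ?_) ?_
      · exact (v.map_mul_le_mul int3 (v.map_pow_le_pow le_rfl 2)).trans_eq (one_mul _)
      · refine (v.map_mul_le_mul (v.map_mul_le_mul h2.le (hW.a_le.trans hx₁.le)) le_rfl).trans_eq ?_
        rw [one_mul, sq]
      · exact hW.b_le.trans (pow_le_pow_left₀ zero_le hx₁.le 2)
    rw [hvm']
    constructor
    · rwa [map_inv₀, inv_le_iff_one_le_mul₀ hy₁p] at hw₁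
    · refine le_of_mul_le_mul_right (a := v y₁) (hvℓ.trans ?_) hy₁p
      have : v x₁ ^ 2 = v (x₁ / y₁) ^ 2 * v y₁ * v y₁ := by
        rw [map_div₀, div_pow, mul_assoc, ← sq, div_mul_cancel₀ _ (pow_ne_zero 2 hy₁p.ne')]
      rw [this]
      exact mul_le_mul_left (mul_le_mul_left (pow_le_pow_left₀ zero_le hz₁ 2) _) _
  · have key := hW.map_sub_le hε hz₁ hz₂ hw₁ hw₂ (inv_eq_of_lt hW h₁ hx₁) (inv_eq_of_lt hW h₂ hx₂)
    have hy₂ := slope_mul_add_right h₁ h₂ hxy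
    set ℓ := W.slope x₁ x₂ y₁ y₂
    set m := y₁ - ℓ * x₁ with hm
    -- In the coordinates (z, w) the line y = ℓx + m reads 1 = ℓz + mw, so the bound `key` on the
    -- chord in these coordinates is a bound on ℓ/m.
    have e₁ : 1 = ℓ * (x₁ / y₁) + m * y₁⁻¹ := by rw [hm]; field_simp; ring
    have e₂ : 1 = ℓ * (x₂ / y₂) + m * y₂⁻¹ := by field_simp; exact hy₂.symm
    have hz : x₁ / y₁ ≠ x₂ / y₂ := by
      intro hz
      rw [hz, sub_self, map_zero, mul_zero] at key
      have hw : y₁⁻¹ = y₂⁻¹ := sub_eq_zero.mp (v.zero_iff.mp (le_zero_iff.mp key))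
      rw [inv_inj] at hw
      rw [hw, div_left_inj' hy₂0] at hz
      exact hx hz
    have hz0 : x₁ / y₁ - x₂ / y₂ ≠ 0 := sub_ne_zero.mpr hz
    have hzp : 0 < v (x₁ / y₁ - x₂ / y₂) := zero_lt_iff.mpr (v.ne_zero_iff.mpr hz0)
    have e₃ : ℓ * (x₁ / y₁ - x₂ / y₂) = -(m * (y₁⁻¹ - y₂⁻¹)) := by
      linear_combination e₂ - e₁
    have hℓ : v ℓ ≤ ε ^ 2 * v m := by
      refine le_of_mul_le_mul_right (a := v (x₁ / y₁ - x₂ / y₂)) ?_ hzp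
      rw [← map_mul, e₃, Valuation.map_neg, map_mul, mul_comm (ε ^ 2), mul_assoc]
      exact mul_le_mul_right key _
    refine ⟨?_, hℓ⟩
    rw [← v.map_one, e₁]
    refine v.map_add_le ?_ ?_
    · refine (v.map_mul_le_mul hℓ hz₁).trans_eq ?_
      simp only [pow_succ, pow_zero, one_mul]; ac_rfl
    · rw [mul_comm]
      exact v.map_mul_le_mul hw₁ le_rfl

end line

namespace Point

/-- The parameter `x/y` at the origin. -/
def parameter : W.Point → T
  | 0 => 0
  | some x y _ => x / y

variable (W v ρ) in
/-- The points `(x, y)` with `v x > ρ`, together with the origin. -/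
def nearZero : Set W.Point := {P | ∀ x y h, P = some x y h → ρ < v x}

omit [W.IsCharNeTwoNF] in
theorem zero_mem_nearZero : (0 : W.Point) ∈ nearZero v W ρ :=
  fun _ _ h e ↦ absurd e.symm (some_ne_zero h)

omit [W.IsCharNeTwoNF] in
theorem some_mem_nearZero {x y : T} {h : W.Nonsingular x y} :
    some x y h ∈ nearZero v W ρ ↔ ρ < v x := by
  refine ⟨fun H ↦ H x y h rfl, fun H x' y' h' e ↦ ?_⟩
  simp only [some.injEq] at e
  rwa [← e.1]

theorem parameter_neg (P : W.Point) : parameter (-P) = -parameter P := by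
  rcases P with _ | ⟨x, y, h⟩
  · exact (_root_.neg_zero (G := T)).symm
  · rw [neg_some]; simp [parameter, div_neg]

variable (hW : CubicBound v W.a₂ W.a₄ W.a₆ ρ)
include hW

theorem parameter_ne_zero {P : W.Point} (hP : P ∈ nearZero v W ρ) (hP0 : P ≠ 0) :
    parameter P ≠ 0 := by
  rcases P with _ | ⟨x, y, h⟩
  · exact absurd rfl hP0
  · obtain ⟨hx, hy⟩ := ne_zero_of_lt hW h.1 (some_mem_nearZero.mp hP)
    exact div_ne_zero hx hy

variable [DecidableEq T]

/-- Near the origin, the parameter is additive to first order. -/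
theorem add_mem_nearZero (h2 : v 2 = 1) {P Q : W.Point} (hP : P ∈ nearZero v W ρ)
    (hQ : Q ∈ nearZero v W ρ) (hP0 : P ≠ 0) :
    P + Q ∈ nearZero v W ρ ∧ v (parameter (P + Q) - (parameter P + parameter Q)) <
      max (v (parameter P)) (v (parameter Q)) := by
  have hp : 0 < max (v (parameter P)) (v (parameter Q)) := lt_max_of_lt_left
    (zero_lt_iff.mpr (v.ne_zero_iff.mpr (parameter_ne_zero hW hP hP0)))
  by_cases hPQ : P = -Q
  · subst hPQ
    rw [neg_add_cancel, parameter_neg, neg_add_cancel]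
    refine ⟨zero_mem_nearZero, ?_⟩
    rw [show parameter (0 : W.Point) = 0 from rfl, sub_zero, v.map_zero]
    rwa [parameter_neg] at hp
  rcases P with _ | ⟨x₁, y₁, h₁⟩
  · exact absurd rfl hP0
  rcases Q with _ | ⟨x₂, y₂, h₂⟩
  · rw [show (zero : W.Point) = 0 from rfl, add_zero]
    refine ⟨hP, ?_⟩
    change 0 < max _ (v (0 : T)) at hp
    change v (_ - (_ + (0 : T))) < max _ (v (0 : T))
    simpa using hp
  have hxy : ¬(x₁ = x₂ ∧ y₁ = W.negY x₂ y₂) := by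
    rintro ⟨rfl, rfl⟩
    exact hPQ (by rw [neg_some])
  rw [some_mem_nearZero] at hP hQ
  rw [add_some hxy, some_mem_nearZero]
  set ε := max (v (parameter (some x₁ y₁ h₁))) (v (parameter (some x₂ y₂ h₂)))
  have hz₁ : v (x₁ / y₁) ≤ ε := le_max_left _ _
  have hz₂ : v (x₂ / y₂) ≤ ε := le_max_right _ _
  have hε : ρ * ε ^ 2 < 1 := by
    rcases max_choice (v (parameter (some x₁ y₁ h₁))) (v (parameter (some x₂ y₂ h₂))) with h | h
    · simp only [ε, h]; exact mul_map_div_sq_lt_one hW h₁.1 hP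
    · simp only [ε, h]; exact mul_map_div_sq_lt_one hW h₂.1 hQ
  obtain ⟨hm, hℓ⟩ := slope_bounds h₁.1 h₂.1 hxy hW h2 hε hP hQ hz₁ hz₂
  obtain ⟨s₁, s₂, s₃⟩ := slope_symmetric h₁.1 h₂.1 hxy
  have hy₂ := slope_mul_add_right h₁.1 h₂.1 hxy
  have hy₁ : W.slope x₁ x₂ y₁ y₂ * x₁ + (y₁ - W.slope x₁ x₂ y₁ y₂ * x₁) = y₁ := by ring
  have key := hW.collinear hε hp.ne' hm hℓ s₁ s₂ s₃ (by rwa [hy₁]) (by rwa [hy₂])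
  refine ⟨key.1, ?_⟩
  -- The third point on the line is -(P + Q), whose parameter is minus that of P + Q.
  rw [← Valuation.map_neg]
  convert key.2 using 2
  rw [hy₁, hy₂]
  simp only [parameter, addY, negY_of_isCharNeTwoNF, negAddY, div_neg]
  ring_nf

/-- Induction with first-order additivity. The errors do not accumulate, by the ultrametric
inequality, and nP never has a larger parameter than P, so each new error stays below the size of
the parameter of P. -/
theorem nsmul_mem_nearZero (h2 : v 2 = 1) {P : W.Point} (hP : P ∈ nearZero v W ρ) (hP0 : P ≠ 0)
    (n : ℕ) : n • P ∈ nearZero v W ρ ∧ v (parameter (n • P) - n * parameter P) < v (parameter P) := by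
  have hp := zero_lt_iff.mpr (v.ne_zero_iff.mpr (parameter_ne_zero hW hP hP0))
  induction n with
  | zero => simpa [show parameter (0 : W.Point) = 0 from rfl, zero_mem_nearZero] using hp
  | succ n ih =>
    obtain ⟨hmem, hlt⟩ := ih
    have hn : v (n : T) ≤ 1 := by
      have : ∀ n : ℕ, v (n : T) ≤ 1 := fun n ↦ by
        induction n with
        | zero => simp
        | succ n ih => push_cast; exact v.map_add_le ih v.map_one.le
      exact this n
    have hle : v (parameter (n • P)) ≤ v (parameter P) := by
      rw [← sub_add_cancel (parameter (n • P)) (n * parameter P)]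
      exact v.map_add_le hlt.le ((v.map_mul_le_mul hn le_rfl).trans_eq (one_mul _))
    obtain ⟨h1, h2⟩ := add_mem_nearZero hW h2 hP hmem hP0
    rw [succ_nsmul', ]
    refine ⟨h1, ?_⟩
    rw [max_eq_left hle] at h2
    have e : parameter (P + n • P) - ((n + 1 : ℕ) : T) * parameter P =
        (parameter (P + n • P) - (parameter P + parameter (n • P))) +
        (parameter (n • P) - n * parameter P) := by push_cast; ring
    rw [e]
    exact v.map_add_lt h2 hlt

/-- There is no torsion near the origin of order prime to the residue characteristic. -/
theorem nsmul_ne_zero_of_mem_nearZero (h2 : v 2 = 1) {P : W.Point} (hP : P ∈ nearZero v W ρ)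
    (hP0 : P ≠ 0) {n : ℕ} (hn : v (n : T) = 1) : n • P ≠ 0 := by
  intro h0
  have := (nsmul_mem_nearZero hW h2 hP hP0 n).2
  rw [h0, show parameter (0 : W.Point) = 0 from rfl, zero_sub, Valuation.map_neg, map_mul, hn,
    one_mul] at this
  exact lt_irrefl _ this

end Point

end WeierstrassCurve.Affine

/-! ### The differential equation attached to a point of order p -/

namespace Polynomial

variable {F : Type*} [Field F] (p : ℕ) [Fact p.Prime] [CharP F p]

omit [Fact p.Prime] in
theorem derivative_X_sub_C_pow_char (x : F) : derivative ((X - C x) ^ p) = 0 := by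
  simp [derivative_pow]

variable {f A B : F[X]}

omit [Fact p.Prime] in
-- Descent: f divides B because it is prime to f', and B = fG turns the equation into the same one
-- for G with j + 2 in place of j. The quantity 2 deg B + 3j is unchanged, so j stays below p and
-- invertible while the degree drops by 3.
theorem eq_zero_of_two_mul_derivative_mul_add (hf : IsCoprime f (derivative f))
    (hf3 : f.natDegree = 3) (j : ℕ) (hj : 0 < j) (hB : 2 * B.natDegree + 3 * j ≤ p)
    (h : 2 * derivative B * f + C (j : F) * B * derivative f = 0) : B = 0 := by
  induction hn : B.natDegree using Nat.strong_induction_on generalizing B j with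
  | _ n ih =>
  by_contra hB0
  have hf0 : f ≠ 0 := by rintro rfl; simp at hf3
  have hj0 : (j : F) ≠ 0 := fun h0 ↦ by
    have := Nat.le_of_dvd hj ((CharP.cast_eq_zero_iff F p j).mp h0)
    omega
  have hdvd : f ∣ B := by
    have h1 : f ∣ C (j : F) * B := hf.dvd_of_dvd_mul_right
      ⟨-(2 * derivative B), by linear_combination h⟩
    exact (IsUnit.dvd_mul_left (isUnit_C.mpr hj0.isUnit)).mp h1
  obtain ⟨G, rfl⟩ := hdvd
  have hG0 : G ≠ 0 := right_ne_zero_of_mul hB0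
  have hdeg : (f * G).natDegree = 3 + G.natDegree := by rw [natDegree_mul hf0 hG0, hf3]
  refine hG0 (ih _ (by omega) (j + 2) (by omega) (by omega) ?_ rfl)
  refine mul_left_cancel₀ hf0 ?_
  rw [derivative_mul] at h
  push_cast
  rw [C_add, show C (2 : F) = 2 from map_ofNat C 2]
  linear_combination h

/-- The polynomials `A` and `B` in a function `A + By` with divisor `p(P) - p(0)` on the curve
`y² = f(x)` satisfy a linear differential equation. -/
theorem exists_derivative_eq_of_sub_eq_pow (hp2 : p ≠ 2) (hf : IsCoprime f (derivative f))
    (hf3 : f.natDegree = 3) (hAB : IsCoprime A B) {κ x : F} (hκ : κ ≠ 0)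
    (h : A ^ 2 - B ^ 2 * f = C κ * (X - C x) ^ p) :
    ∃ c ≠ 0, 2 * A.natDegree + 1 ≤ p ∧ A ≠ 0 ∧ 2 * derivative A = C c * B ∧
      4 * f * derivative (derivative A) + 2 * derivative f * derivative A = C (c ^ 2) * A := by
  have hpo : Odd p := (Fact.out : p.Prime).odd_of_ne_two hp2
  have hdeg : (A ^ 2 - B ^ 2 * f).natDegree = p := by
    rw [h, natDegree_C_mul hκ, natDegree_pow, natDegree_X_sub_C, mul_one]
  have hf0 : f ≠ 0 := by rintro rfl; simp at hf3
  -- Parity: p is odd and A² has even degree, so B²f must be the term of larger degree, and 2 deg B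
  -- + 3 = p.
  have hB0 : B ≠ 0 := by
    rintro rfl
    rw [zero_pow two_ne_zero, zero_mul, sub_zero, natDegree_pow] at hdeg
    rw [← hdeg] at hpo
    exact (Nat.not_odd_iff_even.mpr (even_two_mul _)) hpo
  have hBf : (B ^ 2 * f).natDegree = 2 * B.natDegree + 3 := by
    rw [natDegree_mul (pow_ne_zero 2 hB0) hf0, natDegree_pow, hf3]
  have hA2 : (A ^ 2).natDegree = 2 * A.natDegree := natDegree_pow A 2
  have hlt : (A ^ 2).natDegree < (B ^ 2 * f).natDegree := by
    by_contra hle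
    have hlt : (B ^ 2 * f).natDegree < (A ^ 2).natDegree := by
      rw [hBf, hA2] at hle ⊢; omega
    rw [natDegree_sub_eq_left_of_natDegree_lt hlt, hA2] at hdeg
    rw [← hdeg] at hpo
    exact (Nat.not_odd_iff_even.mpr (even_two_mul _)) hpo
  rw [natDegree_sub_eq_right_of_natDegree_lt hlt, hBf] at hdeg
  rw [hA2, hBf] at hlt
  have hd := congr_arg derivative h
  rw [derivative_C_mul, derivative_X_sub_C_pow_char, mul_zero] at hd
  simp only [derivative_sub, derivative_mul, derivative_pow, Nat.cast_ofNat, Nat.add_one_sub_one,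
    pow_one, map_ofNat] at hd
  -- Differentiating the norm equation kills the p-th power and leaves 2AA' = B(2B'f + Bf'), with A
  -- prime to B.
  have hdvd : B ∣ 2 * derivative A := by
    refine hAB.symm.dvd_of_dvd_mul_left ⟨2 * derivative B * f + B * derivative f, ?_⟩
    linear_combination hd
  obtain ⟨q, hq⟩ := hdvd
  -- From 2 deg A < 2 deg B + 3 one gets deg A ≤ deg B + 1, so A' has degree at most deg B and the
  -- quotient is a constant c.
  have hqC : q.natDegree = 0 := by
    by_contra hq0
    have hq0' : q ≠ 0 := by rintro rfl; exact hq0 natDegree_zero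
    have h1 : (2 * derivative A).natDegree = B.natDegree + q.natDegree := by
      rw [hq, natDegree_mul hB0 hq0']
    have h2 : (2 * derivative A).natDegree ≤ A.natDegree - 1 := by
      rw [show (2 : F[X]) = C 2 from (map_ofNat C 2).symm]
      exact (natDegree_C_mul_le _ _).trans (natDegree_derivative_le A)
    omega
  rw [eq_C_of_natDegree_eq_zero hqC] at hq
  set c := q.coeff 0
  have hA' : 2 * derivative B * f + B * derivative f = C c * A := by
    refine mul_left_cancel₀ hB0 ?_
    linear_combination -hd + A * hq
  have hc : c ≠ 0 := by
    intro hc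
    rw [hc, C_0, zero_mul] at hA'
    exact hB0 (eq_zero_of_two_mul_derivative_mul_add p hf hf3 1 one_pos hdeg.le
      (by rw [Nat.cast_one, C_1, one_mul]; exact hA'))
  refine ⟨c, hc, by omega, ?_, by rw [hq, mul_comm], ?_⟩
  · rintro rfl
    rw [derivative_zero, mul_zero, eq_comm, mul_eq_zero, C_eq_zero] at hq
    exact hq.elim hB0 hc
  -- The two first-order relations 2A' = cB and 2B'f + Bf' = cA say that A + By is an eigenvector of
  -- the invariant derivation 2y d/dx. Eliminating B gives the second-order equation for A.
  · have hq' := congr_arg derivative hq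
    simp only [derivative_mul, derivative_C, mul_zero, add_zero, derivative_ofNat, zero_mul,
      zero_add] at hq'
    rw [C_pow]
    linear_combination C c * hA' + 2 * f * hq' + derivative f * hq

/-- The second order differential operator `A ↦ 4fA'' + 2f'A'`. -/
noncomputable def halfLaplacian (f : F[X]) : F[X] →ₗ[F] F[X] :=
  4 • (LinearMap.mulLeft F f ∘ₗ derivative ∘ₗ derivative) +
    2 • (LinearMap.mulLeft F (derivative f) ∘ₗ derivative)

theorem halfLaplacian_apply (f A : F[X]) : halfLaplacian f A =
    4 * f * derivative (derivative A) + 2 * derivative f * derivative A := by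
  simp [halfLaplacian, mul_assoc]

/-- The operator raises degrees by one, with factor 4n(n - 1) + 6n on the leading coefficient. An
eigenvector of degree n ≥ 1 therefore needs p to divide 2n(2n + 1). -/
theorem coeff_halfLaplacian (a b c : F) {A : F[X]} {n : ℕ} (hn : 1 ≤ n) (hA : A.natDegree ≤ n) :
    (halfLaplacian (X ^ 3 + C a * X ^ 2 + C b * X + C c) A).coeff (n + 1) =
      2 * n * (2 * n + 1) * A.coeff n := by
  have h1 : A.coeff (n + 1) = 0 := coeff_eq_zero_of_natDegree_lt (by omega)
  have h2 : A.coeff (n + 2) = 0 := coeff_eq_zero_of_natDegree_lt (by omega)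
  have h3 : A.coeff (n + 3) = 0 := coeff_eq_zero_of_natDegree_lt (by omega)
  rw [halfLaplacian_apply]
  have e : (4 * (X ^ 3 + C a * X ^ 2 + C b * X + C c) * derivative (derivative A) +
      2 * derivative (X ^ 3 + C a * X ^ 2 + C b * X + C c) * derivative A : F[X]) =
    C 6 * (derivative A * X ^ 2) + C (4 * a) * (derivative A * X) + C (2 * b) * derivative A +
    (C 4 * (derivative (derivative A) * X ^ 3) + C (4 * a) * (derivative (derivative A) * X ^ 2) +
    C (4 * b) * (derivative (derivative A) * X) + C (4 * c) * derivative (derivative A)) := by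
    simp only [derivative_add, derivative_mul, derivative_X_pow, derivative_C, derivative_X,
      C_mul, map_ofNat, Nat.cast_ofNat]
    ring
  rw [e]
  obtain _ | _ | m := n
  · omega
  · simp only [coeff_add, coeff_C_mul, coeff_mul_X_pow', coeff_mul_X, coeff_derivative, h1, h2, h3]
    norm_num
  · simp only [coeff_add, coeff_C_mul, coeff_mul_X_pow', coeff_mul_X, coeff_derivative, h1, h2, h3]
    have i1 : 2 ≤ m + 1 + 1 + 1 := by omega
    have i2 : 3 ≤ m + 1 + 1 + 1 := by omega
    have j1 : m + 1 + 1 + 1 - 2 = m + 1 := by omega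
    have j2 : m + 1 + 1 + 1 - 3 = m := by omega
    rw [if_pos i1, if_pos i2, if_pos i1, j1, j2]
    simp only [h1]
    push_cast
    ring

/-- Eigenvectors for distinct eigenvalues are independent, and the polynomials of degree at most n
form a finite-dimensional space. This space need not be stable under the operator. -/
theorem finite_eigenvalues_halfLaplacian (f : F[X]) (n : ℕ) :
    {μ : F | ∃ A : F[X], A ≠ 0 ∧ A.natDegree ≤ n ∧ halfLaplacian f A = C μ * A}.Finite := by
  choose A hA0 hAn hA using fun μ : {μ : F | ∃ A : F[X], A ≠ 0 ∧ A.natDegree ≤ n ∧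
    halfLaplacian f A = C μ * A} ↦ μ.2
  have hli : LinearIndependent F A := Module.End.eigenvectors_linearIndependent' (halfLaplacian f)
    Subtype.val Subtype.val_injective A fun μ ↦
      Module.End.hasEigenvector_iff.mpr ⟨Module.End.mem_eigenspace_iff.mpr
        (by rw [hA, smul_eq_C_mul]), hA0 μ⟩
  have hmem : ∀ μ, A μ ∈ degreeLT F (n + 1) := fun μ ↦
    mem_degreeLT.mpr ((degree_le_of_natDegree_le (hAn μ)).trans_lt
      (by exact_mod_cast Nat.lt_succ_self n))
  have hli' : LinearIndependent F fun μ ↦ (⟨A μ, hmem μ⟩ : degreeLT F (n + 1)) :=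
    LinearIndependent.of_comp (degreeLT F (n + 1)).subtype hli
  exact hli'.finite_of_isNoetherian

end Polynomial

/-! ### Finiteness of the p-torsion in characteristic p -/

namespace WeierstrassCurve.Affine

open Polynomial CoordinateRing
open scoped Polynomial.Bivariate

variable {F : Type*} [Field F] {W : WeierstrassCurve.Affine F}

/-- The homomorphism from points to the class group of the coordinate ring sends a point to the
class of its ideal. -/
theorem exists_XYIdeal_pow_eq_span [DecidableEq F] {x y : F} (h : W.Nonsingular x y) {n : ℕ}
    (hn : n • Point.some x y h = 0) :
    ∃ g ≠ 0, XYIdeal W x (C y) ^ n = Ideal.span {g} := by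
  have h2 : ClassGroup.mk W.FunctionField (XYIdeal' h ^ n) = 1 := by
    rw [map_pow]
    have h1 := congr_arg Point.toClass hn
    rw [map_nsmul, map_zero] at h1
    exact h1
  refine (ClassGroup.mk_eq_one_of_coe_ideal ?_).mp h2
  rw [Units.val_pow_eq_pow_val, XYIdeal'_eq, FractionalIdeal.coeIdeal_pow]

theorem isPrime_XYIdeal {x y : F} (h : W.Equation x y) : (XYIdeal W x (C y)).IsPrime := by
  rw [← Ideal.Quotient.isDomain_iff_prime]
  exact (quotientXYIdealEquiv h).toMulEquiv.isDomain _

theorem XClass_eq_algebraMap (x : F) : XClass W x = algebraMap F[X] W.CoordinateRing (X - C x) :=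
  rfl

theorem exists_eq_add_mul_mk_Y (g : W.CoordinateRing) :
    ∃ A B : F[X], g = algebraMap F[X] W.CoordinateRing A + algebraMap F[X] W.CoordinateRing B * CoordinateRing.mk W Y := by
  obtain ⟨A, B, rfl⟩ := exists_smul_basis_eq g
  exact ⟨A, B, by rw [Algebra.smul_def, Algebra.smul_def, mul_one]⟩

theorem algebraMap_dvd_iff {q A B : F[X]} :
    algebraMap F[X] W.CoordinateRing q ∣ algebraMap F[X] W.CoordinateRing A + algebraMap F[X] W.CoordinateRing B * CoordinateRing.mk W Y ↔
      q ∣ A ∧ q ∣ B := by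
  constructor
  · rintro ⟨g, hg⟩
    obtain ⟨A', B', rfl⟩ := exists_eq_add_mul_mk_Y g
    have : (A - q * A') • (1 : W.CoordinateRing) + (B - q * B') • CoordinateRing.mk W Y = 0 := by
      simp only [Algebra.smul_def, map_sub, map_mul]
      linear_combination hg
    obtain ⟨h1, h2⟩ := smul_basis_eq_zero this
    exact ⟨⟨A', sub_eq_zero.mp h1⟩, ⟨B', sub_eq_zero.mp h2⟩⟩
  · rintro ⟨⟨A', rfl⟩, ⟨B', rfl⟩⟩
    exact ⟨algebraMap F[X] W.CoordinateRing A' + algebraMap F[X] W.CoordinateRing B' * CoordinateRing.mk W Y, by simp only [map_mul]; ring⟩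

section short

variable (W) in
/-- The cubic polynomial `f` in the equation `y² = f(x)`. -/
noncomputable def cubic : F[X] := X ^ 3 + C W.a₂ * X ^ 2 + C W.a₄ * X + C W.a₆

theorem natDegree_cubic : W.cubic.natDegree = 3 := by
  rw [cubic]; compute_degree!

variable [W.IsCharNeTwoNF]

theorem mk_Y_mul_self : CoordinateRing.mk W Y * CoordinateRing.mk W Y = algebraMap F[X] W.CoordinateRing W.cubic := by
  change CoordinateRing.mk W Y * CoordinateRing.mk W Y = CoordinateRing.mk W (C W.cubic)
  rw [← map_mul]
  refine AdjoinRoot.mk_eq_mk.mpr ⟨1, ?_⟩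
  rw [polynomial, cubic]
  simp only [a₁_of_isCharNeTwoNF, a₃_of_isCharNeTwoNF]
  simp only [C_0, C_add, C_mul, C_pow, zero_mul, add_zero]
  ring1

theorem norm_add_mul_mk_Y (A B : F[X]) :
    Algebra.norm F[X] (algebraMap F[X] W.CoordinateRing A + algebraMap F[X] W.CoordinateRing B * CoordinateRing.mk W Y) =
      A ^ 2 - B ^ 2 * W.cubic := by
  have := norm_smul_basis (W' := W) A B
  rw [Algebra.smul_def, Algebra.smul_def, mul_one] at this
  rw [this, cubic]
  simp

theorem add_mul_sub_eq_norm (A B : F[X]) :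
    (algebraMap F[X] W.CoordinateRing A + algebraMap F[X] W.CoordinateRing B * CoordinateRing.mk W Y) *
      (algebraMap F[X] W.CoordinateRing A - algebraMap F[X] W.CoordinateRing B * CoordinateRing.mk W Y) =
      algebraMap F[X] W.CoordinateRing (A ^ 2 - B ^ 2 * W.cubic) := by
  rw [map_sub, map_mul, map_pow, map_pow, ← mk_Y_mul_self]
  ring

/-- The discriminant of a cubic is a combination of the cubic and its derivative. -/
theorem discr_cubic_identity {R : Type*} [CommRing R] (a b c x : R) :
    (3 * (6 * b - 2 * a ^ 2) * x + 2 * a * (6 * b - 2 * a ^ 2) - 3 * (9 * c - a * b)) *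
      (x ^ 3 + a * x ^ 2 + b * x + c) -
    ((6 * b - 2 * a ^ 2) * x ^ 2 + (a * (6 * b - 2 * a ^ 2) - (9 * c - a * b)) * x +
      4 * b ^ 2 - a ^ 2 * b - 3 * a * c) * (3 * x ^ 2 + 2 * a * x + b) =
    a ^ 2 * b ^ 2 - 4 * b ^ 3 - 4 * a ^ 3 * c - 27 * c ^ 2 + 18 * a * b * c := by
  ring

variable (W) in
theorem Δ_of_short : W.Δ = 16 * (W.a₂ ^ 2 * W.a₄ ^ 2 - 4 * W.a₄ ^ 3 - 4 * W.a₂ ^ 3 * W.a₆ -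
    27 * W.a₆ ^ 2 + 18 * W.a₂ * W.a₄ * W.a₆) := by
  rw [Δ, b₂_of_isCharNeTwoNF, b₄_of_isCharNeTwoNF, b₆_of_isCharNeTwoNF, b₈_of_isCharNeTwoNF]
  ring

variable [W.IsElliptic]

theorem isCoprime_cubic_derivative : IsCoprime W.cubic (derivative W.cubic) := by
  have hΔ : W.Δ ≠ 0 := W.isUnit_Δ.ne_zero
  rw [Δ_of_short] at hΔ
  set D := W.a₂ ^ 2 * W.a₄ ^ 2 - 4 * W.a₄ ^ 3 - 4 * W.a₂ ^ 3 * W.a₆ - 27 * W.a₆ ^ 2 +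
    18 * W.a₂ * W.a₄ * W.a₆ with hD
  have hD0 : D ≠ 0 := right_ne_zero_of_mul hΔ
  have key := discr_cubic_identity (C W.a₂) (C W.a₄) (C W.a₆) X
  have hd : derivative W.cubic = 3 * X ^ 2 + 2 * C W.a₂ * X + C W.a₄ := by
    rw [cubic]
    simp only [derivative_add, derivative_mul, derivative_X_pow, derivative_C, derivative_X,
      map_ofNat, Nat.cast_ofNat]
    ring
  have hCD : C W.a₂ ^ 2 * C W.a₄ ^ 2 - 4 * C W.a₄ ^ 3 - 4 * C W.a₂ ^ 3 * C W.a₆ -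
      27 * C W.a₆ ^ 2 + 18 * C W.a₂ * C W.a₄ * C W.a₆ = C D := by
    rw [hD]; simp only [map_add, map_sub, map_mul, map_pow, map_ofNat]
  rw [hCD] at key
  have hinv : C D⁻¹ * C D = 1 := by rw [← C_mul, inv_mul_cancel₀ hD0, C_1]
  rw [hd]
  rw [mul_comm] at hinv
  rw [cubic]
  exact ⟨_, _, (by linear_combination C D⁻¹ * key + hinv :
    (C D⁻¹ * (3 * (6 * C W.a₄ - 2 * C W.a₂ ^ 2) * X + 2 * C W.a₂ * (6 * C W.a₄ - 2 * C W.a₂ ^ 2) -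
      3 * (9 * C W.a₆ - C W.a₂ * C W.a₄))) * _ +
    (-C D⁻¹ * ((6 * C W.a₄ - 2 * C W.a₂ ^ 2) * X ^ 2 + (C W.a₂ * (6 * C W.a₄ - 2 * C W.a₂ ^ 2) -
      (9 * C W.a₆ - C W.a₂ * C W.a₄)) * X + 4 * C W.a₄ ^ 2 - C W.a₂ ^ 2 * C W.a₄ -
      3 * C W.a₂ * C W.a₆)) * _ = 1)⟩

variable [DecidableEq F] (p : ℕ) [Fact p.Prime] [CharP F p]

omit [W.IsElliptic] [CharP F p] in
-- Otherwise the p-th power of the ideal of P lies in the prime ideal of -P, so that y and -y agree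
-- modulo that ideal and y = 0. Then P has order two, which is incompatible with pP = 0 for odd p.
theorem not_XClass_dvd_of_pow_eq_span (hp2 : p ≠ 2) (h2 : (2 : F) ≠ 0) {x y : F}
    (h : W.Nonsingular x y) (hP : p • Point.some x y h = 0) {g : W.CoordinateRing}
    (hg : XYIdeal W x (C y) ^ p = Ideal.span {g}) : ¬XClass W x ∣ g := by
  intro hdvd
  have hy : y ≠ 0 := by
    rintro rfl
    have hneg : -Point.some x 0 h = Point.some x 0 h := by
      rw [Point.neg_some]; simp [negY]
    obtain ⟨k, hk⟩ := (Fact.out : p.Prime).odd_of_ne_two hp2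
    have h20 : 2 • Point.some x 0 h = 0 := by
      rw [two_nsmul]; nth_rw 1 [← hneg]; exact neg_add_cancel _
    rw [hk, add_nsmul, mul_nsmul, h20, nsmul_zero, one_nsmul, zero_add] at hP
    exact Point.some_ne_zero h hP
  have hprime := isPrime_XYIdeal (W := W) ((equation_neg x y).mpr h.1)
  rw [negY_of_isCharNeTwoNF] at hprime
  have hle : XYIdeal W x (C y) ≤ XYIdeal W x (C (-y)) := by
    refine hprime.le_of_pow_le (n := p) ?_
    rw [hg, Ideal.span_singleton_le_iff_mem]
    obtain ⟨k, rfl⟩ := hdvd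
    exact Ideal.mul_mem_right _ _ (Ideal.subset_span (Set.mem_insert _ _))
  have m1 : YClass W (C y) ∈ XYIdeal W x (C (-y)) :=
    hle (Ideal.subset_span (Set.mem_insert_of_mem _ rfl))
  have m2 : YClass W (C (-y)) ∈ XYIdeal W x (C (-y)) :=
    Ideal.subset_span (Set.mem_insert_of_mem _ rfl)
  have m3 := sub_mem m2 m1
  rw [YClass, YClass, ← map_sub,
    show (Y - C (C (-y)) - (Y - C (C y)) : F[X][Y]) = C (C (2 * y)) by simp only [two_mul, C_add, C_neg]; ring] at m3
  refine hprime.ne_top (Ideal.eq_top_of_isUnit_mem _ m3 ?_)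
  exact ((isUnit_C.mpr (isUnit_C.mpr (mul_ne_zero h2 hy).isUnit))).map (CoordinateRing.mk W)

omit [W.IsElliptic] [CharP F p] in
/-- A `p`-torsion point is the zero of a function `A + By` of norm a multiple of `(X - x)ᵖ`. -/
theorem exists_norm_eq_of_nsmul_eq_zero (hp2 : p ≠ 2) (h2 : (2 : F) ≠ 0) {x y : F}
    (h : W.Nonsingular x y) (hP : p • Point.some x y h = 0) :
    ∃ (A B : F[X]) (κ : F), κ ≠ 0 ∧ IsCoprime A B ∧
      A ^ 2 - B ^ 2 * W.cubic = C κ * (X - C x) ^ p := by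
  have hPn : p • Point.some x (W.negY x y) ((nonsingular_neg x y).mpr h) = 0 := by
    rw [← Point.neg_some h, smul_neg, hP, neg_zero]
  obtain ⟨g, hg0, hg⟩ := exists_XYIdeal_pow_eq_span h hP
  obtain ⟨g', hg0', hg'⟩ := exists_XYIdeal_pow_eq_span _ hPn
  have hd := not_XClass_dvd_of_pow_eq_span p hp2 h2 h hP hg
  have hd' := not_XClass_dvd_of_pow_eq_span p hp2 h2 _ hPn hg'
  -- The ideals of P and -P multiply to (X - x), so the two functions multiply to its p-th power up
  -- to a unit.
  have hass : Associated (g' * g) (XClass W x ^ p) := by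
    rw [← Ideal.span_singleton_eq_span_singleton, ← Ideal.span_singleton_mul_span_singleton, ← hg,
      ← hg', ← mul_pow, XYIdeal_neg_mul h, XIdeal, Ideal.span_singleton_pow]
  obtain ⟨A, B, rfl⟩ := exists_eq_add_mul_mk_Y g
  obtain ⟨A', B', rfl⟩ := exists_eq_add_mul_mk_Y g'
  rw [XClass_eq_algebraMap, algebraMap_dvd_iff] at hd hd'
  have hnorm := hass.map (Algebra.norm F[X])
  rw [map_mul, norm_add_mul_mk_Y, norm_add_mul_mk_Y, map_pow, XClass_eq_algebraMap,
    Algebra.norm_algebraMap_of_basis (CoordinateRing.basis W), Fintype.card_fin, ← pow_mul] at hnorm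
  -- either norm is a power of `X - x`, with exponent at most `p`
  have aux : ∀ {A B A' B' : F[X]}, ¬(X - C x ∣ A ∧ X - C x ∣ B) →
      algebraMap F[X] W.CoordinateRing A + algebraMap F[X] W.CoordinateRing B * CoordinateRing.mk W Y ≠ 0 →
      Associated ((algebraMap F[X] W.CoordinateRing A' + algebraMap F[X] W.CoordinateRing B' * CoordinateRing.mk W Y) *
        (algebraMap F[X] W.CoordinateRing A + algebraMap F[X] W.CoordinateRing B * CoordinateRing.mk W Y)) (XClass W x ^ p) →
      A ^ 2 - B ^ 2 * W.cubic ∣ (X - C x) ^ (2 * p) →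
      ∃ j ≤ p, Associated (A ^ 2 - B ^ 2 * W.cubic) ((X - C x) ^ j) := by
    intro A B A' B' hd hg0 hass hdvd
    obtain ⟨j, -, hj⟩ := (dvd_prime_pow (prime_X_sub_C x) _).mp hdvd
    refine ⟨j, ?_, hj⟩
    by_contra hjp
    refine hd ?_
    have h1 : algebraMap F[X] W.CoordinateRing (X - C x) ∣
        algebraMap F[X] W.CoordinateRing A + algebraMap F[X] W.CoordinateRing (-B) * CoordinateRing.mk W Y := by
      -- The norm is g times its conjugate, while g times g' is only the p-th power of X - x. One
      -- factor too many must divide the conjugate A - By, hence both A and B.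
      have h3 : (X - C x) ^ (p + 1) ∣ A ^ 2 - B ^ 2 * W.cubic :=
        (pow_dvd_pow _ (by omega)).trans hj.symm.dvd
      have h4 : algebraMap F[X] W.CoordinateRing _ ∣ algebraMap F[X] W.CoordinateRing _ :=
        map_dvd (algebraMap F[X] W.CoordinateRing) h3
      rw [← add_mul_sub_eq_norm, map_pow, pow_succ', ← XClass_eq_algebraMap] at h4
      have h5 : (algebraMap F[X] W.CoordinateRing A + algebraMap F[X] W.CoordinateRing B * CoordinateRing.mk W Y) *
          (XClass W x * (algebraMap F[X] W.CoordinateRing A' + algebraMap F[X] W.CoordinateRing B' * CoordinateRing.mk W Y)) ∣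
          (algebraMap F[X] W.CoordinateRing A + algebraMap F[X] W.CoordinateRing B * CoordinateRing.mk W Y) *
          (algebraMap F[X] W.CoordinateRing A - algebraMap F[X] W.CoordinateRing B * CoordinateRing.mk W Y) := by
        refine dvd_trans (Associated.dvd ?_) h4
        rw [mul_left_comm, mul_comm (algebraMap F[X] W.CoordinateRing A + _)]
        exact hass.mul_left _
      have h6 := (dvd_of_mul_right_dvd (mul_dvd_mul_iff_left hg0 |>.mp h5))
      rwa [XClass_eq_algebraMap, sub_eq_add_neg (algebraMap _ _ A), ← neg_mul, ← map_neg] at h6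
    rw [algebraMap_dvd_iff, dvd_neg] at h1
    exact h1
  obtain ⟨j, hj, hAj⟩ := aux hd hg0 hass ((dvd_mul_left _ _).trans hnorm.dvd)
  obtain ⟨j', hj', hAj'⟩ := aux hd' hg0' (by rwa [mul_comm]) ((dvd_mul_right _ _).trans hnorm.dvd)
  -- The norms of g and g' multiply to the norm of (X - x)^p, and neither exponent exceeds p; so
  -- both equal p.
  have hjj : j' + j = 2 * p := by
    have := (hAj'.mul_mul hAj).symm.trans hnorm
    rw [← pow_add] at this
    have := natDegree_eq_of_degree_eq (degree_eq_degree_of_associated this)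
    simpa [natDegree_pow] using this
  have hjp : j = p := by omega
  subst hjp
  obtain ⟨u, hu⟩ := hAj.symm
  obtain ⟨κ, hκ, hκu⟩ := isUnit_iff.mp u.isUnit
  refine ⟨A, B, κ, hκ.ne_zero, ?_, by rw [← hu, ← hκu, mul_comm]⟩
  refine isCoprime_of_prime_dvd ?_ fun q hq hqA hqB ↦ hd ?_
  · rintro ⟨rfl, rfl⟩; simp at hg0
  · have h1 : q ∣ (X - C x) ^ j := hAj.dvd_iff_dvd_right.mp (dvd_sub
      (hqA.trans (dvd_pow_self A two_ne_zero)) ((hqB.trans (dvd_pow_self B two_ne_zero)).mul_right _))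
    have h2 : Associated q (X - C x) :=
      (hq.dvd_prime_iff_associated (prime_X_sub_C x)).mp (hq.dvd_of_dvd_pow h1)
    exact ⟨h2.symm.dvd.trans hqA, h2.symm.dvd.trans hqB⟩

omit [W.IsCharNeTwoNF] [W.IsElliptic] [DecidableEq F] [Fact p.Prime] in
-- Let n be the degree. The image μA has no coefficient in degree n + 1, so p divides 2n(2n + 1) if
-- n > 0, and 2n + 1 ≤ p leaves only 2n + 1 = p. Constants are killed by the operator, which
-- excludes n = 0.
theorem two_mul_natDegree_add_one_eq {A : F[X]} {μ : F} (hμ : μ ≠ 0)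
    (hA0 : A ≠ 0) (hA : 2 * A.natDegree + 1 ≤ p) (h : halfLaplacian W.cubic A = C μ * A) :
    2 * A.natDegree + 1 = p := by
  obtain hn | hn := Nat.eq_zero_or_pos A.natDegree
  · rw [eq_C_of_natDegree_eq_zero hn, halfLaplacian_apply] at h
    simp only [derivative_C, map_zero, mul_zero, add_zero] at h
    rw [eq_C_of_natDegree_eq_zero hn] at hA0
    exact absurd h.symm (mul_ne_zero (C_ne_zero.mpr hμ) hA0)
  · have h1 := coeff_halfLaplacian W.a₂ W.a₄ W.a₆ hn le_rfl
    rw [← cubic, h, coeff_C_mul, coeff_eq_zero_of_natDegree_lt (Nat.lt_succ_self _), mul_zero] at h1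
    have h3 : ((2 * A.natDegree : ℕ) : F) * ((2 * A.natDegree + 1 : ℕ) : F) = 0 := by
      push_cast
      exact ((mul_eq_zero.mp h1.symm).resolve_right (leadingCoeff_ne_zero.mpr hA0))
    rcases mul_eq_zero.mp h3 with h3 | h3 <;> rw [CharP.cast_eq_zero_iff F p] at h3 <;>
      have := Nat.le_of_dvd (by omega) h3 <;> omega

omit [W.IsCharNeTwoNF] [W.IsElliptic] [DecidableEq F] [Fact p.Prime] in
-- Both have degree (p - 1)/2. Cancelling the leading terms gives an eigenvector of smaller degree,
-- which must vanish.
theorem eigenvectors_proportional {A₁ A₂ : F[X]} {μ : F} (hμ : μ ≠ 0)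
    (hA₁ : A₁ ≠ 0) (hA₂ : A₂ ≠ 0) (hn₁ : 2 * A₁.natDegree + 1 ≤ p)
    (hn₂ : 2 * A₂.natDegree + 1 ≤ p) (h₁ : halfLaplacian W.cubic A₁ = C μ * A₁)
    (h₂ : halfLaplacian W.cubic A₂ = C μ * A₂) : ∃ m ≠ 0, A₂ = C m * A₁ := by
  have e₁ := two_mul_natDegree_add_one_eq p hμ hA₁ hn₁ h₁
  have e₂ := two_mul_natDegree_add_one_eq p hμ hA₂ hn₂ h₂
  have l₁ := leadingCoeff_ne_zero.mpr hA₁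
  refine ⟨A₂.leadingCoeff / A₁.leadingCoeff, div_ne_zero (leadingCoeff_ne_zero.mpr hA₂) l₁, ?_⟩
  set m := A₂.leadingCoeff / A₁.leadingCoeff with hm
  by_contra hne
  have hD0 : A₂ - C m * A₁ ≠ 0 := sub_ne_zero.mpr hne
  have hDn : (A₂ - C m * A₁).natDegree ≤ A₂.natDegree :=
    (natDegree_sub_le _ _).trans (max_le le_rfl ((natDegree_C_mul_le _ _).trans (by omega)))
  have hD := two_mul_natDegree_add_one_eq (W := W) p hμ hD0 (by omega) (by
    rw [map_sub, h₂, ← smul_eq_C_mul m, map_smul, h₁, smul_eq_C_mul, smul_eq_C_mul]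
    ring)
  refine leadingCoeff_ne_zero.mpr hD0 ?_
  rw [leadingCoeff, show (A₂ - C m * A₁).natDegree = A₂.natDegree by omega, coeff_sub, coeff_C_mul,
    show A₁.coeff A₂.natDegree = A₁.leadingCoeff by rw [leadingCoeff]; congr 1; omega,
    coeff_natDegree, hm, div_mul_cancel₀ _ l₁, sub_self]

omit [Fact p.Prime] [CharP F p] [W.IsElliptic] [W.IsCharNeTwoNF] [DecidableEq F] in
theorem finite_setOf_eq_some (x : F) : {P : W.Point | ∃ y h, P = .some x y h}.Finite := by
  by_cases hx : ∃ y, W.Nonsingular x y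
  · obtain ⟨y₀, h₀⟩ := hx
    refine Set.Finite.subset (Set.toFinite {Point.some x y₀ h₀, -Point.some x y₀ h₀}) ?_
    rintro _ ⟨y, h, rfl⟩
    rcases Y_eq_of_X_eq h.1 h₀.1 rfl with rfl | rfl
    · exact Or.inl rfl
    · exact Or.inr (by rw [Point.neg_some]; exact Set.mem_singleton _)
  · convert Set.finite_empty
    ext P
    simp only [Set.mem_ofPred_eq, Set.mem_empty_iff_false, iff_false]
    rintro ⟨y, h, -⟩
    exact hx ⟨y, h⟩

/-- In characteristic `p`, there are finitely many points of order `p`. -/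
theorem finite_setOf_nsmul_eq_zero (hp2 : p ≠ 2) : {P : W.Point | p • P = 0}.Finite := by
  have h2 : (2 : F) ≠ 0 := by
    have : ((2 : ℕ) : F) ≠ 0 := fun h ↦ hp2
      ((Nat.prime_dvd_prime_iff_eq Fact.out Nat.prime_two).mp ((CharP.cast_eq_zero_iff F p 2).mp h))
    exact_mod_cast this
  set S : Set F := {x | ∃ y h, p • (Point.some x y h : W.Point) = 0}
  have key : ∀ x : S, ∃ (A B : F[X]) (κ c : F), κ ≠ 0 ∧ c ≠ 0 ∧ 2 * A.natDegree + 1 ≤ p ∧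
      A ≠ 0 ∧ 2 * derivative A = C c * B ∧ halfLaplacian W.cubic A = C (c ^ 2) * A ∧
      A ^ 2 - B ^ 2 * W.cubic = C κ * (X - C (x : F)) ^ p := by
    rintro ⟨x, y, h, hP⟩
    obtain ⟨A, B, κ, hκ, hAB, hN⟩ := exists_norm_eq_of_nsmul_eq_zero p hp2 h2 h hP
    obtain ⟨c, hc, hn, hA0, hA, hL⟩ := exists_derivative_eq_of_sub_eq_pow p hp2
      isCoprime_cubic_derivative natDegree_cubic hAB hκ hN
    exact ⟨A, B, κ, c, hκ, hc, hn, hA0, hA, by rw [halfLaplacian_apply, hL], hN⟩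
  choose A B κ c hκ hc hn hA0 hA hL hN using key
  have hS : S.Finite := by
    have hfin := finite_eigenvalues_halfLaplacian W.cubic p
    have hmaps : ∀ x : S, c x ^ 2 ∈ {μ : F | ∃ A : F[X], A ≠ 0 ∧ A.natDegree ≤ p ∧
        halfLaplacian W.cubic A = C μ * A} := fun x ↦
      ⟨A x, hA0 x, by have := hn x; omega, hL x⟩
    have := hfin.to_subtype
    -- The abscissa is determined by the eigenvalue c²: proportional A's with equal c² have B²'s in
    -- the squared ratio, so the norms κ(X - x)^p are proportional and have the same root.
    refine @Set.toFinite _ S (Finite.of_injective (fun x : S ↦ Subtype.mk _ (hmaps x))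
      fun x₁ x₂ h ↦ ?_)
    have hμ : c x₁ ^ 2 = c x₂ ^ 2 := congr_arg Subtype.val h
    obtain ⟨m, hm, hAA⟩ := eigenvectors_proportional (W := W) p (pow_ne_zero 2 (hc x₁)) (hA0 x₁)
      (hA0 x₂) (hn x₁) (hn x₂) (hL x₁) (by rw [hμ]; exact hL x₂)
    have hB1 : C (c x₂) * B x₂ = C m * (C (c x₁) * B x₁) := by
      rw [← hA, ← hA, hAA, derivative_C_mul]; ring
    have hB2 : B x₂ ^ 2 = C m ^ 2 * B x₁ ^ 2 := by
      refine mul_left_cancel₀ (pow_ne_zero 2 (C_ne_zero.mpr (hc x₂))) ?_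
      have e : C (c x₁) ^ 2 = C (c x₂) ^ 2 := by rw [← C_pow, hμ, C_pow]
      linear_combination (C (c x₂) * B x₂ + C m * (C (c x₁) * B x₁)) * hB1 +
        C m ^ 2 * B x₁ ^ 2 * e
    have hN2 : C (κ x₂) * (X - C (x₂ : F)) ^ p = C m ^ 2 * (C (κ x₁) * (X - C (x₁ : F)) ^ p) := by
      rw [← hN, ← hN, hB2, hAA]; ring
    have hev := congr_arg (eval (x₂ : F)) hN2
    simp only [eval_mul, eval_C, eval_pow, eval_sub, eval_X, sub_self,
      zero_pow (Fact.out : p.Prime).ne_zero, mul_zero] at hev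
    have h3 := (mul_eq_zero.mp hev.symm).resolve_left (pow_ne_zero 2 hm)
    have h4 := (mul_eq_zero.mp h3).resolve_left (hκ x₁)
    exact Subtype.ext (sub_eq_zero.mp (pow_eq_zero_iff (Fact.out : p.Prime).ne_zero |>.mp h4)).symm
  refine ((Set.finite_singleton 0).union (hS.biUnion fun x _ ↦ finite_setOf_eq_some x)).subset ?_
  rintro (_ | ⟨x, y, h⟩) hP
  · exact Or.inl rfl
  · exact Or.inr (Set.mem_biUnion (x := x) ⟨y, h, hP⟩ ⟨y, h, rfl⟩)

end short

end WeierstrassCurve.Affine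

/-! ### Completing the square, and differences of nearby points -/

namespace Valuation

variable {T Γ : Type*} [Field T] [LinearOrderedCommGroupWithZero Γ] (v : Valuation T Γ)

theorem map_natCast_le_one (n : ℕ) : v (n : T) ≤ 1 := by
  induction n with
  | zero => simp
  | succ n ih => push_cast; exact v.map_add_le ih v.map_one.le

theorem map_ofNat_mul_le (n : ℕ) [n.AtLeastTwo] {x : T} {g : Γ} (hx : v x ≤ g) :
    v (OfNat.ofNat n * x) ≤ g := by
  have h : v (OfNat.ofNat n : T) ≤ 1 := by
    rw [← Nat.cast_ofNat]; exact v.map_natCast_le_one _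
  exact (v.map_mul_le_mul h hx).trans_eq (one_mul g)

/-- Such an integer is a root of unity in the prime field, by Fermat. -/
theorem map_natCast_eq_one (p : ℕ) [Fact p.Prime] [CharP T p] {n : ℕ} (hn : ¬p ∣ n) :
    v (n : T) = 1 := by
  have h1 : ((n : ZMod p) : ZMod p) ≠ 0 := by rwa [Ne, ZMod.natCast_eq_zero_iff]
  have h2 := congr_arg (ZMod.castHom (dvd_refl p) T) (ZMod.pow_card_sub_one_eq_one h1)
  rw [map_pow, map_natCast, map_one] at h2
  have h3 := congr_arg v h2
  rw [map_pow, map_one] at h3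
  exact (pow_eq_one_iff_of_nonneg zero_le
    (Nat.sub_ne_zero_of_lt (Fact.out : p.Prime).one_lt)).mp h3

end Valuation

namespace WeierstrassCurve.Affine

variable {T : Type*} [Field T]

section Shear

variable (W : WeierstrassCurve.Affine T) (s t : T)

/-- The curve obtained from the change of coordinates `y ↦ y + sx + t`. -/
noncomputable abbrev shear : WeierstrassCurve.Affine T :=
  (⟨1, 0, s, t⟩ : VariableChange T) • (W : WeierstrassCurve T)

theorem shear_equation_iff (x y : T) :
    (W.shear s t).Equation x (y - s * x - t) ↔ W.Equation x y := by
  rw [equation_iff', equation_iff']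
  simp only [variableChange_a₁, variableChange_a₂, variableChange_a₃, variableChange_a₄,
    variableChange_a₆, inv_one, Units.val_one]
  ring_nf

theorem shear_negY (x y : T) :
    (W.shear s t).negY x (y - s * x - t) = W.negY x y - s * x - t := by
  simp only [negY, variableChange_a₁, variableChange_a₃, inv_one, Units.val_one]
  ring

theorem shear_nonsingular_iff (x y : T) :
    (W.shear s t).Nonsingular x (y - s * x - t) ↔ W.Nonsingular x y := by
  rw [nonsingular_iff', nonsingular_iff', shear_equation_iff]
  refine and_congr_right fun _ ↦ ?_
  have e1 : 2 * (y - s * x - t) + (W.shear s t).a₁ * x + (W.shear s t).a₃ =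
      2 * y + W.a₁ * x + W.a₃ := by
    simp only [variableChange_a₁, variableChange_a₃, inv_one, Units.val_one]; ring
  have e2 : (W.shear s t).a₁ * (y - s * x - t) -
      (3 * x ^ 2 + 2 * (W.shear s t).a₂ * x + (W.shear s t).a₄) =
      W.a₁ * y - (3 * x ^ 2 + 2 * W.a₂ * x + W.a₄) + s * (2 * y + W.a₁ * x + W.a₃) := by
    simp only [variableChange_a₁, variableChange_a₂, variableChange_a₄, inv_one, Units.val_one]
    ring
  rw [e1, e2]
  by_cases h : 2 * y + W.a₁ * x + W.a₃ = 0 <;> simp [h]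

variable [DecidableEq T]

variable {W} in
theorem shear_slope {x₁ x₂ y₁ y₂ : T} (h₁ : W.Equation x₁ y₁) (h₂ : W.Equation x₂ y₂)
    (hxy : ¬(x₁ = x₂ ∧ y₁ = W.negY x₂ y₂)) :
    (W.shear s t).slope x₁ x₂ (y₁ - s * x₁ - t) (y₂ - s * x₂ - t) = W.slope x₁ x₂ y₁ y₂ - s := by
  by_cases hx : x₁ = x₂
  · have hy : y₁ ≠ W.negY x₂ y₂ := fun h ↦ hxy ⟨hx, h⟩
    have hy' : y₁ - s * x₁ - t ≠ (W.shear s t).negY x₂ (y₂ - s * x₂ - t) := by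
      rw [shear_negY, hx]
      exact fun h ↦ hy (by simpa using h)
    rw [slope_of_Y_ne hx hy, slope_of_Y_ne hx hy', shear_negY]
    have h0 : y₁ - W.negY x₁ y₁ ≠ 0 := by
      have := Y_eq_of_Y_ne h₁ h₂ hx hy
      subst hx this
      exact sub_ne_zero.mpr hy
    have e : y₁ - s * x₁ - t - (W.negY x₁ y₁ - s * x₁ - t) = y₁ - W.negY x₁ y₁ := by ring
    rw [e, eq_sub_iff_add_eq, div_add' _ _ _ h0]
    congr 1
    simp only [variableChange_a₁, variableChange_a₂, variableChange_a₄, inv_one, Units.val_one,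
      negY]
    ring
  · rw [slope_of_X_ne hx, slope_of_X_ne hx]
    have := sub_ne_zero.mpr hx
    field_simp
    ring

/-- The map on points given by the change of coordinates `y ↦ y + sx + t`. -/
noncomputable def Point.shear : W.Point →+ (W.shear s t).Point where
  toFun
    | 0 => 0
    | .some x y h => .some x (y - s * x - t) ((shear_nonsingular_iff W s t x y).mpr h)
  map_zero' := rfl
  map_add' := by
    rintro (_ | ⟨x₁, y₁, h₁⟩) (_ | ⟨x₂, y₂, h₂⟩)
    any_goals rfl
    by_cases hxy : x₁ = x₂ ∧ y₁ = W.negY x₂ y₂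
    · rw [add_of_Y_eq hxy.1 hxy.2]
      change (0 : (W.shear s t).Point) = _
      refine (add_of_Y_eq hxy.1 ?_).symm
      rw [shear_negY, hxy.1, hxy.2]
    · have hxy' : ¬(x₁ = x₂ ∧
          y₁ - s * x₁ - t = (W.shear s t).negY x₂ (y₂ - s * x₂ - t)) := by
        rw [shear_negY]
        rintro ⟨rfl, h⟩
        exact hxy ⟨rfl, by simpa using h⟩
      rw [add_some hxy]
      change Point.some _ _ _ = Point.some _ _ _ + Point.some _ _ _
      rw [add_some hxy']
      simp only [some.injEq, shear_slope s t h₁.1 h₂.1 hxy, addX, addY, negAddY, negY,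
        variableChange_a₁, variableChange_a₂, variableChange_a₃, inv_one, Units.val_one]
      constructor <;> ring

theorem Point.shear_injective : Function.Injective (Point.shear W s t) := by
  rw [injective_iff_map_eq_zero]
  rintro (_ | ⟨x, y, h⟩) h0
  · rfl
  · exact absurd h0 (some_ne_zero _)

end Shear

section Close

variable {Γ : Type*} [LinearOrderedCommGroupWithZero Γ] {v : Valuation T Γ} {a b c D x y : T}
  {M ε : Γ}

/-- The derivative of a separable cubic is bounded below at points where the cubic is small. -/
theorem _root_.CubicBound.discr_le (h : CubicBound v a b c M) (hε1 : ε ≤ 1)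
    (hε : ε * M ^ 5 < v D) (hD : D = a ^ 2 * b ^ 2 - 4 * b ^ 3 - 4 * a ^ 3 * c - 27 * c ^ 2 +
      18 * a * b * c) (hx : v x ≤ M) (hy : v y ≤ ε * M)
    (hxy : y ^ 2 = x ^ 3 + a * x ^ 2 + b * x + c) :
    v D ≤ M ^ 4 * v (3 * x ^ 2 + 2 * a * x + b) := by
  obtain ⟨ha, hb, hc⟩ := h
  have mul {x y : T} {m n : ℕ} (hx : v x ≤ M ^ m) (hy : v y ≤ M ^ n) : v (x * y) ≤ M ^ (m + n) :=
    (v.map_mul_le_mul hx hy).trans_eq (pow_add _ _ _).symm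
  have ha' : v a ≤ M ^ 1 := by rwa [pow_one]
  have hx' : v x ≤ M ^ 1 := by rwa [pow_one]
  have ha2 : v (a ^ 2) ≤ M ^ 2 := v.map_pow_le_pow ha 2
  have hx2 : v (x ^ 2) ≤ M ^ 2 := v.map_pow_le_pow hx 2
  have hb2 : v (b ^ 2) ≤ M ^ 4 := (v.map_pow_le_pow hb 2).trans_eq (pow_mul _ _ _).symm
  have he : v (6 * b - 2 * a ^ 2) ≤ M ^ 2 :=
    v.map_sub_le (v.map_ofNat_mul_le 6 hb) (v.map_ofNat_mul_le 2 ha2)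
  have hd : v (9 * c - a * b) ≤ M ^ 3 := v.map_sub_le (v.map_ofNat_mul_le 9 hc) (mul ha' hb)
  have hU : v (3 * (6 * b - 2 * a ^ 2) * x + 2 * a * (6 * b - 2 * a ^ 2) -
      3 * (9 * c - a * b)) ≤ M ^ 3 :=
    v.map_sub_le (v.map_add_le (mul (v.map_ofNat_mul_le 3 he) hx')
      (mul (v.map_ofNat_mul_le 2 ha') he)) (v.map_ofNat_mul_le 3 hd)
  have hV : v ((6 * b - 2 * a ^ 2) * x ^ 2 + (a * (6 * b - 2 * a ^ 2) - (9 * c - a * b)) * x +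
      4 * b ^ 2 - a ^ 2 * b - 3 * a * c) ≤ M ^ 4 :=
    v.map_sub_le (v.map_sub_le (v.map_add_le (v.map_add_le (mul he hx2)
      (mul (v.map_sub_le (mul ha' he) hd) hx')) (v.map_ofNat_mul_le 4 hb2)) (mul ha2 hb))
      (mul (v.map_ofNat_mul_le 3 ha') hc)
  -- With e = Uf(x) - Vf'(x) the discriminant, |U| ≤ M³ makes the first term smaller than D, so
  -- Vf'(x) has size |D|; and |V| ≤ M⁴.
  have key := discr_cubic_identity a b c x
  rw [← hD, ← hxy] at key
  by_contra! hlt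
  refine lt_irrefl (v D) ?_
  conv_lhs => rw [← key]
  refine v.map_sub_lt (lt_of_le_of_lt (v.map_mul_le_mul hU (v.map_pow_le_pow hy 2)) ?_)
    (lt_of_le_of_lt (v.map_mul_le_mul hV le_rfl) hlt)
  refine lt_of_le_of_lt ?_ hε
  calc M ^ 3 * (ε * M) ^ 2 = ε * (ε * M ^ 5) := by
        simp only [pow_succ, pow_zero, one_mul]; ac_rfl
    _ ≤ 1 * (ε * M ^ 5) := mul_le_mul_left hε1 _
    _ = ε * M ^ 5 := one_mul _

variable {W : WeierstrassCurve.Affine T} [W.IsCharNeTwoNF] [DecidableEq T]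

/-- The difference of two points with nearby coordinates is near the origin. -/
theorem Point.sub_mem_nearZero (hW : CubicBound v W.a₂ W.a₄ W.a₆ M) (hM : 1 ≤ M) (h2 : v 2 = 1)
    (hε1 : ε ≤ 1) (hε : ε * M ^ 5 < v D)
    (hD : D = W.a₂ ^ 2 * W.a₄ ^ 2 - 4 * W.a₄ ^ 3 - 4 * W.a₂ ^ 3 * W.a₆ - 27 * W.a₆ ^ 2 +
      18 * W.a₂ * W.a₄ * W.a₆) {x₁ y₁ x₂ y₂ : T} {h₁ : W.Nonsingular x₁ y₁}
    {h₂ : W.Nonsingular x₂ y₂} (hx₁ : v x₁ ≤ M) (hx₂ : v x₂ ≤ M) (hx : v (x₁ - x₂) ≤ ε)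
    (hy : v (y₁ - y₂) ≤ ε) : some x₁ y₁ h₁ - some x₂ y₂ h₂ ∈ nearZero v W M := by
  by_cases hxy : x₁ = x₂ ∧ y₁ = y₂
  · obtain ⟨rfl, rfl⟩ := hxy
    rw [sub_self]; exact zero_mem_nearZero
  have hxy' : ¬(x₁ = x₂ ∧ y₁ = W.negY x₂ (W.negY x₂ y₂)) := by rwa [negY_negY]
  rw [sub_eq_add_neg, neg_some, add_some hxy', some_mem_nearZero]
  have hD0 : 0 < v D := zero_le.trans_lt hε
  have e₁ := (equation_iff_of_isCharNeTwoNF x₁ y₁).mp h₁.1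
  have e₂ := (equation_iff_of_isCharNeTwoNF x₂ y₂).mp h₂.1
  have hM0 : 0 < M := zero_lt_one.trans_le hM
  -- it suffices that the slope is large
  suffices hs : M < v (W.slope x₁ x₂ y₁ (W.negY x₂ y₂)) by
    have hs2 : M < v (W.slope x₁ x₂ y₁ (W.negY x₂ y₂) ^ 2) := by
      rw [map_pow, pow_two]
      exact lt_of_le_of_lt (by simpa using mul_le_mul_right hM M)
        (mul_lt_mul'' hs hs zero_le zero_le)
    have : v (W.a₂ + x₁ + x₂) ≤ M := v.map_add_le (v.map_add_le hW.a_le hx₁) hx₂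
    have e : W.addX x₁ x₂ (W.slope x₁ x₂ y₁ (W.negY x₂ y₂)) =
        W.slope x₁ x₂ y₁ (W.negY x₂ y₂) ^ 2 - (W.a₂ + x₁ + x₂) := by
      simp only [addX, a₁_of_isCharNeTwoNF]; ring
    rw [e, Valuation.map_sub_eq_of_lt_left _ (this.trans_lt hs2)]
    exact hs2
  -- Let the slope of the line through P₁ and -P₂ be at most M in size. Then y₁ is small, so f'(x₁)
  -- is bounded below by the discriminant; but a bounded slope also forces f'(x₁) to be small.
  by_contra! hle
  have main (hy₁ : v y₁ ≤ ε * M) := hW.discr_le hε1 hε hD hx₁ hy₁ e₁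
  by_cases hx0 : x₁ = x₂
  · subst hx0
    have hne : y₁ ≠ y₂ := fun h ↦ hxy ⟨rfl, h⟩
    have hyy : y₁ = -y₂ := by
      have := Y_eq_of_X_eq h₁.1 h₂.1 rfl
      rw [negY_of_isCharNeTwoNF] at this
      exact this.resolve_left hne
    have hn : y₁ ≠ W.negY x₁ (W.negY x₁ y₂) := by rwa [negY_negY]
    have hy₁ : v y₁ ≤ ε := by
      have : y₁ - y₂ = 2 * y₁ := by rw [hyy]; ring
      rwa [this, map_mul, h2, one_mul] at hy
    have hy₁' : v y₁ ≤ ε * M := hy₁.trans (by simpa using mul_le_mul_right hM ε)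
    rw [slope_of_Y_ne rfl hn, negY_of_isCharNeTwoNF, sub_neg_eq_add, ← two_mul, map_div₀, map_mul,
      h2, one_mul] at hle
    have hy0 : y₁ ≠ 0 := by
      rintro rfl
      exact hne (by rw [zero_eq_neg] at hyy; exact hyy.symm)
    rw [div_le_iff₀ (zero_lt_iff.mpr (v.ne_zero_iff.mpr hy0))] at hle
    simp only [a₁_of_isCharNeTwoNF, zero_mul, sub_zero] at hle
    refine lt_irrefl (v D) (lt_of_le_of_lt ((main hy₁').trans ?_) hε)
    calc _ ≤ M ^ 4 * (M * v y₁) := mul_le_mul_right hle _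
      _ ≤ M ^ 4 * (M * ε) := mul_le_mul_right (mul_le_mul_right hy₁ _) _
      _ = ε * M ^ 5 := by simp only [pow_succ, pow_zero, one_mul]; ac_rfl
  · have hx0' : 0 < v (x₁ - x₂) := zero_lt_iff.mpr (v.ne_zero_iff.mpr (sub_ne_zero.mpr hx0))
    rw [slope_of_X_ne hx0, negY_of_isCharNeTwoNF, sub_neg_eq_add, map_div₀,
      div_le_iff₀ hx0'] at hle
    have hy₁ : v y₁ ≤ ε * M := by
      have : 2 * y₁ = (y₁ + y₂) + (y₁ - y₂) := by ring
      rw [← one_mul (v y₁), ← h2, ← map_mul, this]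
      refine v.map_add_le (hle.trans ((mul_le_mul_right hx M).trans_eq (mul_comm _ _))) (hy.trans ?_)
      simpa using mul_le_mul_right hM ε
    have hf := main hy₁
    -- The divided difference of the cubic. It is close to f'(x₁), and it equals the slope times y₁
    -- - y₂.
    set g := x₁ ^ 2 + x₁ * x₂ + x₂ ^ 2 + W.a₂ * (x₁ + x₂) + W.a₄ with hg
    have hgy : (y₁ + y₂) * (y₁ - y₂) = (x₁ - x₂) * g := by rw [hg]; linear_combination e₁ - e₂
    have hfg : v (3 * x₁ ^ 2 + 2 * W.a₂ * x₁ + W.a₄ - g) ≤ ε * M := by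
      have : 3 * x₁ ^ 2 + 2 * W.a₂ * x₁ + W.a₄ - g = (x₁ - x₂) * (2 * x₁ + x₂ + W.a₂) := by
        rw [hg]; ring
      rw [this]
      exact v.map_mul_le_mul hx
        (v.map_add_le (v.map_add_le (v.map_ofNat_mul_le 2 hx₁) hx₂) hW.a_le)
    have hgle : v g ≤ ε * M := by
      have h1 := congr_arg v hgy
      rw [map_mul, map_mul] at h1
      refine le_of_mul_le_mul_left ?_ hx0'
      rw [← h1]
      calc _ ≤ (M * v (x₁ - x₂)) * ε := mul_le_mul' hle hy
        _ = _ := by ac_rfl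
    have hfle : v (3 * x₁ ^ 2 + 2 * W.a₂ * x₁ + W.a₄) ≤ ε * M := by
      rw [← sub_add_cancel (3 * x₁ ^ 2 + 2 * W.a₂ * x₁ + W.a₄) g]
      exact v.map_add_le hfg hgle
    refine lt_irrefl (v D) (lt_of_le_of_lt (hf.trans ?_) hε)
    calc _ ≤ M ^ 4 * (ε * M) := mul_le_mul_right hfle _
      _ = ε * M ^ 5 := by simp only [pow_succ, pow_zero, one_mul]; ac_rfl

end Close

end WeierstrassCurve.Affine

/-! ### Finiteness of torsion over a valued field with finite quotients -/

namespace WeierstrassCurve.Affine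

variable {T Γ : Type*} [Field T] [DecidableEq T] [LinearOrderedCommGroupWithZero Γ]
  {v : Valuation T Γ} (p : ℕ) [Fact p.Prime] [CharP T p]

section short

variable {W : WeierstrassCurve.Affine T} [W.IsCharNeTwoNF]

/-- A neighbourhood of the origin without points of order `p` is torsion-free. -/
theorem Point.eq_zero_of_mem_nearZero {ρ : Γ} (hp2 : p ≠ 2) (hW : CubicBound v W.a₂ W.a₄ W.a₆ ρ)
    (hρ : ∀ P ∈ nearZero v W ρ, p • P = 0 → P = 0) {P : W.Point} (hP : P ∈ nearZero v W ρ)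
    (hPt : IsOfFinAddOrder P) : P = 0 := by
  have h2 : v 2 = 1 := by
    have := v.map_natCast_eq_one p (n := 2) fun h ↦ hp2
      ((Nat.prime_dvd_prime_iff_eq Fact.out Nat.prime_two).mp h)
    exact_mod_cast this
  by_contra hP0
  obtain ⟨ℓ, hℓ, hdvd⟩ := Nat.exists_prime_and_dvd
    (n := addOrderOf P) (by rwa [Ne, AddMonoid.addOrderOf_eq_one_iff])
  obtain ⟨m, hm⟩ := hdvd
  have hmpos : 0 < m := Nat.pos_of_ne_zero fun h ↦ by
    rw [h, mul_zero] at hm; exact hPt.addOrderOf_pos.ne' hm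
  have hmP : m • P ≠ 0 := fun h ↦ by
    have h1 := Nat.le_of_dvd hmpos (addOrderOf_dvd_of_nsmul_eq_zero h)
    rw [hm] at h1
    have := hℓ.two_le
    nlinarith
  -- The multiple mP has prime order ℓ and is still near the origin; ℓ = p is excluded by hypothesis
  -- and ℓ ≠ p by first-order additivity.
  have hℓP : ℓ • m • P = 0 := by
    rw [← mul_nsmul', ← hm, addOrderOf_nsmul_eq_zero]
  have hmem := (nsmul_mem_nearZero hW h2 hP hP0 m).1
  by_cases hpℓ : p = ℓ
  · subst hpℓ
    exact hmP (hρ _ hmem hℓP)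
  · exact nsmul_ne_zero_of_mem_nearZero hW h2 hmem hmP (v.map_natCast_eq_one p
      fun h ↦ hpℓ ((Nat.prime_dvd_prime_iff_eq Fact.out hℓ).mp h)) hℓP

variable [W.IsElliptic]

/-- The bound r exceeds the abscissas of all points killed by p, so the points with |x| > |r|
contain no nonzero torsion. The remaining torsion points have bounded coordinates, and those with
the same approximate coordinates differ by a torsion point near the origin, that is, by 0. -/
theorem finite_torsion_of_isCharNeTwoNF (hp2 : p ≠ 2) {ϖ : T} (hϖ0 : ϖ ≠ 0) (hϖ : v ϖ < 1)
    (hv : ∀ δ : T, δ ≠ 0 → ∃ s : Set T, s.Finite ∧ ∀ x, v x ≤ 1 → ∃ y ∈ s, v (x - y) ≤ v δ) :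
    Finite (AddCommGroup.torsion W.Point) := by
  have h2 : v 2 = 1 := by
    have := v.map_natCast_eq_one p (n := 2) fun h ↦ hp2
      ((Nat.prime_dvd_prime_iff_eq Fact.out Nat.prime_two).mp h)
    exact_mod_cast this
  -- the size of the coefficients and of the `p`-torsion points
  let X : W.Point → T := fun P ↦ match P with
    | 0 => 0
    | .some x _ _ => x
  obtain ⟨r, -, hr⟩ := Set.exists_max_image (insert 1 (insert W.a₂ (insert W.a₄ (insert W.a₆
    (X '' {P | p • P = 0}))))) v (((((finite_setOf_nsmul_eq_zero p hp2).image X).insert _).insert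
      _).insert _ |>.insert _) ⟨1, Set.mem_insert _ _⟩
  simp only [Set.forall_mem_insert, Set.forall_mem_image, map_one] at hr
  obtain ⟨hr1, ha, hb, hc, hX⟩ := hr
  have hW : CubicBound v W.a₂ W.a₄ W.a₆ (v r) := ⟨ha, hb.trans (le_self_pow₀ hr1 two_ne_zero),
    hc.trans (le_self_pow₀ hr1 three_ne_zero)⟩
  have hr0 : r ≠ 0 := v.ne_zero_iff.mp (zero_lt_one.trans_le hr1).ne'
  have htf : ∀ P : W.Point, P ∈ Point.nearZero v W (v r) → IsOfFinAddOrder P → P = 0 := by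
    intro P
    refine Point.eq_zero_of_mem_nearZero p hp2 hW fun P hP hpP ↦ ?_
    rcases P with _ | ⟨x, y, h⟩
    · rfl
    · exact absurd (Point.some_mem_nearZero.mp hP) (hX hpP).not_gt
  obtain ⟨D, hD⟩ : ∃ D, D = W.a₂ ^ 2 * W.a₄ ^ 2 - 4 * W.a₄ ^ 3 - 4 * W.a₂ ^ 3 * W.a₆ -
    27 * W.a₆ ^ 2 + 18 * W.a₂ * W.a₄ * W.a₆ := ⟨_, rfl⟩
  have hD0 : D ≠ 0 := by
    have hΔ : W.Δ ≠ 0 := W.isUnit_Δ.ne_zero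
    rw [Δ_of_short, ← hD] at hΔ
    exact right_ne_zero_of_mul hΔ
  -- The precision required by `Point.sub_mem_nearZero`: ϖD/r⁵ if |D| ≤ 1, and ϖ/r⁵ otherwise.
  obtain ⟨e, he0, he1, he⟩ : ∃ e : T, e ≠ 0 ∧ v e ≤ 1 ∧ v e * v r ^ 5 < v D := by
    have hvr : ∀ n : ℕ, v (r ^ n)⁻¹ ≤ 1 := fun n ↦ by
      rw [map_inv₀, map_pow]; exact inv_le_one_of_one_le₀ (one_le_pow₀ hr1)
    have hvD : 0 < v D := zero_lt_iff.mpr (v.ne_zero_iff.mpr hD0)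
    rcases le_total (v D) 1 with h | h
    · refine ⟨ϖ * D * (r ^ 5)⁻¹, by positivity, ?_, ?_⟩
      · rw [map_mul, map_mul]
        exact mul_le_one' (mul_le_one' hϖ.le h) (hvr 5)
      · rw [← map_pow, ← map_mul, mul_assoc, inv_mul_cancel₀ (pow_ne_zero 5 hr0), mul_one, map_mul]
        exact mul_lt_of_lt_one_left hvD hϖ
    · refine ⟨ϖ * (r ^ 5)⁻¹, by positivity, ?_, ?_⟩
      · rw [map_mul]
        exact mul_le_one' hϖ.le (hvr 5)
      · rw [← map_pow, ← map_mul, mul_assoc, inv_mul_cancel₀ (pow_ne_zero 5 hr0), mul_one]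
        exact hϖ.trans_le h
  -- The integral elements are x/r and y/r²; scaling back loses at most a factor r², so precision
  -- e/r² is needed.
  obtain ⟨s, hs, hapx⟩ := hv (e / r ^ 2) (div_ne_zero he0 (pow_ne_zero 2 hr0))
  choose! f hfs hf using hapx
  -- torsion points are determined by approximations of their coordinates
  have hclose : ∀ {n : ℕ} {x₁ x₂ : T}, n ≤ 2 → v (x₁ / r ^ n) ≤ 1 → v (x₂ / r ^ n) ≤ 1 →
      f (x₁ / r ^ n) = f (x₂ / r ^ n) → v (x₁ - x₂) ≤ v e := by
    intro n x₁ x₂ hn h₁ h₂ h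
    have hle := v.map_sub_le (hf _ h₁) (h ▸ hf _ h₂)
    rw [sub_sub_sub_cancel_right, ← sub_div, map_div₀, map_div₀,
      div_le_iff₀ (zero_lt_iff.mpr (v.ne_zero_iff.mpr (pow_ne_zero n hr0)))] at hle
    refine hle.trans ?_
    rw [div_mul_eq_mul_div, div_le_iff₀ (zero_lt_iff.mpr (v.ne_zero_iff.mpr (pow_ne_zero 2 hr0)))]
    refine mul_le_mul_right ?_ _
    rw [map_pow, map_pow]
    exact pow_le_pow_right₀ hr1 hn
  have hbound : ∀ {x y : T} {h : W.Nonsingular x y}, IsOfFinAddOrder (Point.some x y h) →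
      v (x / r ^ 1) ≤ 1 ∧ v (y / r ^ 2) ≤ 1 := by
    intro x y h hP
    have hx : v x ≤ v r := by
      by_contra! hlt
      exact Point.some_ne_zero h (htf _ (Point.some_mem_nearZero.mpr hlt) hP)
    have hy : v y ≤ v r ^ 2 := by
      have h1 : v y ^ 2 ≤ v r ^ 3 := by
        rw [← map_pow, (equation_iff_of_isCharNeTwoNF x y).mp h.1]
        exact hW.map_le_of_le hx
      refine le_of_pow_le_pow_left₀ two_ne_zero zero_le (h1.trans ?_)
      rw [← pow_mul]
      exact pow_le_pow_right₀ hr1 (by norm_num)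
    constructor
    · rw [map_div₀, pow_one]
      exact div_le_one_of_le₀ hx zero_le
    · rw [map_div₀, map_pow]
      exact div_le_one_of_le₀ hy zero_le
  have := hs.to_subtype
  let g : AddCommGroup.torsion W.Point → Option (T × T) := fun P ↦ match P.1 with
    | 0 => none
    | .some x y _ => some (f (x / r ^ 1), f (y / r ^ 2))
  have hginj : Function.Injective g := by
    rintro ⟨_ | ⟨x₁, y₁, h₁⟩, hP₁⟩ ⟨_ | ⟨x₂, y₂, h₂⟩, hP₂⟩ hg
    · rfl
    · cases hg
    · cases hg
    · have hg' : some (f (x₁ / r ^ 1), f (y₁ / r ^ 2)) = some (f (x₂ / r ^ 1), f (y₂ / r ^ 2)) := hg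
      simp only [Option.some.injEq, Prod.mk.injEq] at hg'
      obtain ⟨hx₁, hy₁⟩ := hbound hP₁
      obtain ⟨hx₂, hy₂⟩ := hbound hP₂
      have hx := hclose one_le_two hx₁ hx₂ hg'.1
      have hy := hclose le_rfl hy₁ hy₂ hg'.2
      have toM : ∀ {x : T}, v (x / r ^ 1) ≤ 1 → v x ≤ v r := fun {x} h ↦ by
        rwa [map_div₀, pow_one, div_le_one₀ (zero_lt_one.trans_le hr1)] at h
      have hmem := Point.sub_mem_nearZero (h₁ := h₁) (h₂ := h₂) hW hr1 h2 he1 he hD (toM hx₁)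
        (toM hx₂) hx hy
      exact Subtype.ext (sub_eq_zero.mp (htf _ hmem ((AddCommGroup.torsion W.Point).sub_mem hP₁ hP₂)))
  have hrange : (Set.range g).Finite := by
    refine (((hs.prod hs).image some).insert none).subset ?_
    rintro _ ⟨⟨_ | ⟨x, y, h⟩, hP⟩, rfl⟩
    · exact Or.inl rfl
    · exact Or.inr ⟨_, ⟨hfs _ (hbound hP).1, hfs _ (hbound hP).2⟩, rfl⟩
  have := hrange.to_subtype
  exact Finite.of_injective _ (Set.rangeFactorization_injective.mpr hginj)

end short

/-- An elliptic curve over a field of odd characteristic `p` has finite torsion if the field has a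
nontrivial valuation such that all quotients of the ring of integers are finite. -/
theorem finite_torsion (W : WeierstrassCurve.Affine T) [W.IsElliptic] (hp2 : p ≠ 2) {ϖ : T}
    (hϖ0 : ϖ ≠ 0) (hϖ : v ϖ < 1)
    (hv : ∀ δ : T, δ ≠ 0 → ∃ s : Set T, s.Finite ∧ ∀ x, v x ≤ 1 → ∃ y ∈ s, v (x - y) ≤ v δ) :
    Finite (AddCommGroup.torsion W.Point) := by
  have h2 : (2 : T) ≠ 0 := by
    have := v.map_natCast_eq_one p (n := 2) fun h ↦ hp2
      ((Nat.prime_dvd_prime_iff_eq Fact.out Nat.prime_two).mp h)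
    exact v.ne_zero_iff.mp (ne_of_eq_of_ne (by exact_mod_cast this) one_ne_zero)
  let _ : Invertible (2 : T) := invertibleOfNonzero h2
  have : (W.shear (⅟2 * -W.a₁) (⅟2 * -W.a₃)).IsCharNeTwoNF := toCharNeTwoNF_spec W
  have := finite_torsion_of_isCharNeTwoNF (W := W.shear (⅟2 * -W.a₁) (⅟2 * -W.a₃)) p hp2 hϖ0 hϖ hv
  refine Finite.of_injective (fun P : AddCommGroup.torsion W.Point ↦
    (⟨Point.shear W _ _ P.1, AddMonoidHom.isOfFinAddOrder (Point.shear W _ _) P.2⟩ :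
      AddCommGroup.torsion (W.shear (⅟2 * -W.a₁) (⅟2 * -W.a₃)).Point)) fun P Q h ↦ ?_
  exact Subtype.ext (Point.shear_injective W _ _ (congr_arg Subtype.val h))

end WeierstrassCurve.Affine

/-! ### Frobenius elements of bounded order -/

noncomputable section

namespace RingClassTower

open scoped nonZeroDivisors

section Frobenius

variable (R : Type*) [CommRing R] {K : Type*} [Field K] [Algebra R K]

section basic

variable {L : Type*} [Field L] [Algebra K L] [Algebra R L] [IsScalarTower R K L]

@[simp]
theorem coe_restrictIntegers (σ : L ≃ₐ[K] L) (x : integralClosure R L) :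
    (restrictIntegers R σ x : L) = σ x := rfl

variable (K L) in
theorem restrictIntegers_injective [IsDomain R] [IsFractionRing R K] [FiniteDimensional K L] :
    Function.Injective (restrictIntegers R : (L ≃ₐ[K] L) → _) := by
  intro σ τ h
  have : IsFractionRing (integralClosure R L) L :=
    integralClosure.isFractionRing_of_finite_extension K L
  have : σ.toRingHom = τ.toRingHom := IsFractionRing.ringHom_ext (A := integralClosure R L)
    fun x ↦ congr_arg Subtype.val (DFunLike.congr_fun h x)
  ext x
  exact DFunLike.congr_fun this x

end basic

section tower

variable {F L : Type*} [Field F] [Field L] [Algebra K F] [Algebra K L] [Algebra F L]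
  [IsScalarTower K F L] [Algebra R F] [Algebra R L] [IsScalarTower R K F] [IsScalarTower R K L]

variable (K F L) in
/-- The inclusion of the integers of a subfield. -/
def integersMap : integralClosure R F →ₐ[R] integralClosure R L :=
  ((IsScalarTower.toAlgHom K F L).restrictScalars R).mapIntegralClosure

variable {R}

theorem IsArithFrobAt_restrictNormal [Normal K F] {σ : L ≃ₐ[K] L}
    {Q : Ideal (integralClosure R L)} (h : (restrictIntegers R σ).IsArithFrobAt Q) :
    (restrictIntegers R (σ.restrictNormal F)).IsArithFrobAt (Q.comap (integersMap R K F L)) := by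
  intro x
  have hu : (Q.comap (integersMap R K F L)).under R = Q.under R := by
    ext r
    simp only [Ideal.mem_comap, Ideal.under_def]
    rw [AlgHom.commutes]
  rw [hu, Ideal.mem_comap]
  convert h (integersMap R K F L x) using 1
  rw [map_sub, map_pow]
  congr 1
  apply Subtype.ext
  exact σ.restrictNormal_commutes F x.1

end tower

variable (K) in
/-- `L/K` is a finite Galois extension in which the Frobenius elements at each prime above `𝔮`
are unique and have order dividing `H`. -/
structure HasFrobeniusOrder (𝔮 : Ideal R) (H : ℕ) (L : Type*) [Field L] [Algebra K L] [Algebra R L]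
    [IsScalarTower R K L] : Prop where
  finite : FiniteDimensional K L
  galois : IsGalois K L
  unique : ∀ (σ τ : L ≃ₐ[K] L) (Q : Ideal (integralClosure R L)), Q.IsPrime → Q.under R = 𝔮 →
    (restrictIntegers R σ).IsArithFrobAt Q → (restrictIntegers R τ).IsArithFrobAt Q → σ = τ
  pow_eq_one : ∀ (σ : L ≃ₐ[K] L) (Q : Ideal (integralClosure R L)), Q.IsPrime → Q.under R = 𝔮 →
    (restrictIntegers R σ).IsArithFrobAt Q → σ ^ H = 1

variable {R} {Ω : Type*} [Field Ω] [Algebra K Ω] [Algebra R Ω] [IsScalarTower R K Ω] {𝔮 : Ideal R}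
  {H : ℕ}

omit [Algebra R K] [Algebra R Ω] [IsScalarTower R K Ω] in
theorem subsingleton_gal_bot :
    Subsingleton ((⊥ : IntermediateField K Ω) ≃ₐ[K] (⊥ : IntermediateField K Ω)) := by
  refine ⟨fun σ τ ↦ AlgEquiv.ext ?_⟩
  rintro ⟨x, hx⟩
  obtain ⟨y, rfl⟩ := IntermediateField.mem_bot.mp hx
  exact (σ.commutes y).trans (τ.commutes y).symm

theorem HasFrobeniusOrder.bot :
    HasFrobeniusOrder R K 𝔮 H (⊥ : IntermediateField K Ω) where
  finite := inferInstance
  galois := inferInstance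
  unique σ τ _ _ _ _ _ := by
    exact subsingleton_gal_bot.elim _ _
  pow_eq_one σ _ _ _ _ := by
    exact subsingleton_gal_bot.elim _ _

/-- An automorphism of the compositum is determined by its restrictions to the two factors, and a
Frobenius element restricts to Frobenius elements there. -/
theorem HasFrobeniusOrder.sup {L₁ L₂ : IntermediateField K Ω} (h₁ : HasFrobeniusOrder R K 𝔮 H L₁)
    (h₂ : HasFrobeniusOrder R K 𝔮 H L₂) :
    HasFrobeniusOrder R K 𝔮 H (L₁ ⊔ L₂ : IntermediateField K Ω) := by
  have := h₁.finite
  have := h₂.finite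
  have := h₁.galois
  have := h₂.galois
  let _ : Algebra L₁ (L₁ ⊔ L₂ : IntermediateField K Ω) :=
    (IntermediateField.inclusion le_sup_left).toAlgebra
  let _ : Algebra L₂ (L₁ ⊔ L₂ : IntermediateField K Ω) :=
    (IntermediateField.inclusion le_sup_right).toAlgebra
  have : IsScalarTower K L₁ (L₁ ⊔ L₂ : IntermediateField K Ω) := .of_algebraMap_eq fun _ ↦ rfl
  have : IsScalarTower K L₂ (L₁ ⊔ L₂ : IntermediateField K Ω) := .of_algebraMap_eq fun _ ↦ rfl
  have ext : ∀ σ τ : (L₁ ⊔ L₂ : IntermediateField K Ω) ≃ₐ[K] (L₁ ⊔ L₂ : IntermediateField K Ω),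
      σ.restrictNormal L₁ = τ.restrictNormal L₁ → σ.restrictNormal L₂ = τ.restrictNormal L₂ →
      σ = τ := by
    intro σ τ e₁ e₂
    have : (L₁ ⊔ L₂).val.comp σ.toAlgHom = (L₁ ⊔ L₂).val.comp τ.toAlgHom := by
      refine IntermediateField.algHom_ext_of_eq_adjoin K
        (IntermediateField.sup_def L₁ L₂) ?_
      rintro x (hx | hx)
      · have c₁ := σ.restrictNormal_commutes L₁ ⟨x, hx⟩
        have c₂ := τ.restrictNormal_commutes L₁ ⟨x, hx⟩
        rw [e₁] at c₁
        exact congr_arg Subtype.val (c₁.symm.trans c₂)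
      · have c₁ := σ.restrictNormal_commutes L₂ ⟨x, hx⟩
        have c₂ := τ.restrictNormal_commutes L₂ ⟨x, hx⟩
        rw [e₂] at c₁
        exact congr_arg Subtype.val (c₁.symm.trans c₂)
    ext x
    exact DFunLike.congr_fun this x
  have under (i : IntermediateField K Ω) [Algebra i (L₁ ⊔ L₂ : IntermediateField K Ω)]
      [IsScalarTower K i (L₁ ⊔ L₂ : IntermediateField K Ω)]
      (Q : Ideal (integralClosure R (L₁ ⊔ L₂ : IntermediateField K Ω))) :
      (Q.comap (integersMap R K i (L₁ ⊔ L₂ : IntermediateField K Ω))).under R = Q.under R := by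
    ext r
    simp only [Ideal.mem_comap, Ideal.under_def]
    rw [AlgHom.commutes]
  refine ⟨inferInstance, inferInstance, fun σ τ Q hQ hQ𝔮 hσ hτ ↦ ext _ _ ?_ ?_,
    fun σ Q hQ hQ𝔮 hσ ↦ ext _ _ ?_ ?_⟩
  · exact h₁.unique _ _ _ (hQ.comap _) ((under L₁ Q).trans hQ𝔮) (IsArithFrobAt_restrictNormal hσ)
      (IsArithFrobAt_restrictNormal hτ)
  · exact h₂.unique _ _ _ (hQ.comap _) ((under L₂ Q).trans hQ𝔮) (IsArithFrobAt_restrictNormal hσ)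
      (IsArithFrobAt_restrictNormal hτ)
  · have := h₁.pow_eq_one _ _ (hQ.comap _) ((under L₁ Q).trans hQ𝔮)
      (IsArithFrobAt_restrictNormal hσ)
    exact (map_pow (AlgEquiv.restrictNormalHom L₁) σ H).trans
      (this.trans (map_one (AlgEquiv.restrictNormalHom L₁)).symm)
  · have := h₂.pow_eq_one _ _ (hQ.comap _) ((under L₂ Q).trans hQ𝔮)
      (IsArithFrobAt_restrictNormal hσ)
    exact (map_pow (AlgEquiv.restrictNormalHom L₂) σ H).trans
      (this.trans (map_one (AlgEquiv.restrictNormalHom L₂)).symm)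

section consequences

variable [IsDedekindDomain R] [IsFractionRing R K] {L : Type*} [Field L] [Algebra K L] [Algebra R L]
  [IsScalarTower R K L]

variable (R K L) in
theorem exists_isArithFrobAt [FiniteDimensional K L] [IsGalois K L]
    (Q : Ideal (integralClosure R L)) [Q.IsPrime] [Finite (R ⧸ Q.under R)] :
    ∃ σ : L ≃ₐ[K] L, (restrictIntegers R σ).IsArithFrobAt Q := by
  have : Module.Finite R (integralClosure R L) := IsIntegralClosure.finite R K L _
  have : IsFractionRing (integralClosure R L) L :=
    integralClosure.isFractionRing_of_finite_extension K L
  let _ : MulSemiringAction Gal(L/K) (integralClosure R L) :=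
    IsIntegralClosure.MulSemiringAction R K L _
  have : IsGaloisGroup Gal(L/K) R (integralClosure R L) := IsGaloisGroup.of_isFractionRing _ _ _ K L
  have : Finite (integralClosure R L ⧸ Q) := Module.finite_of_finite (R ⧸ Q.under R)
  obtain ⟨σ, hσ⟩ := IsArithFrobAt.exists_of_isInvariant R Gal(L/K) Q
  refine ⟨σ, fun x ↦ ?_⟩
  convert hσ x using 2
  exact Subtype.ext (algebraMap_galRestrict_apply R σ x).symm

/-- The residues of integers are fixed by the `H`-th power of the Frobenius map. -/
theorem HasFrobeniusOrder.pow_sub_mem (h : HasFrobeniusOrder R K 𝔮 H L) [Finite (R ⧸ 𝔮)]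
    (Q : Ideal (integralClosure R L)) [Q.IsPrime] (hQ : Q.under R = 𝔮) (x : integralClosure R L) :
    x ^ (Nat.card (R ⧸ 𝔮) ^ H) - x ∈ Q := by
  have := h.finite
  have := h.galois
  subst hQ
  obtain ⟨σ, hσ⟩ := exists_isArithFrobAt R K L Q
  have key : ∀ j : ℕ, restrictIntegers R (σ ^ j) x - x ^ (Nat.card (R ⧸ Q.under R) ^ j) ∈ Q := by
    intro j
    induction j with
    | zero =>
      rw [pow_zero, pow_zero, pow_one]
      convert Q.zero_mem
      exact sub_self x
    | succ j ih =>
      have e : restrictIntegers R (σ ^ (j + 1)) x =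
          restrictIntegers R σ (restrictIntegers R (σ ^ j) x) := by
        apply Subtype.ext
        simp only [coe_restrictIntegers, pow_succ', AlgEquiv.mul_apply]
      rw [e, pow_succ, pow_mul, ← Ideal.Quotient.eq, map_pow]
      rw [← Ideal.Quotient.eq] at ih
      rw [← ih, ← map_pow, Ideal.Quotient.eq]
      exact hσ _
  have := key H
  rw [h.pow_eq_one σ Q inferInstance rfl hσ, ← neg_mem_iff, neg_sub] at this
  exact this

/-- A prime at which Frobenius elements are unique is unramified. -/
theorem HasFrobeniusOrder.not_le_sq (h : HasFrobeniusOrder R K 𝔮 H L) [Finite (R ⧸ 𝔮)]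
    (h0 : 𝔮 ≠ ⊥) (Q : Ideal (integralClosure R L)) [Q.IsPrime] (hQ : Q.under R = 𝔮) :
    ¬𝔮.map (algebraMap R (integralClosure R L)) ≤ Q ^ 2 := by
  have := h.finite
  have := h.galois
  subst hQ
  obtain ⟨σ, hσ⟩ := exists_isArithFrobAt R K L Q
  have : Module.Finite R (integralClosure R L) := IsIntegralClosure.finite R K L _
  have : IsDedekindDomain (integralClosure R L) := IsIntegralClosure.isDedekindDomain R K L _
  have : IsFractionRing (integralClosure R L) L :=
    integralClosure.isFractionRing_of_finite_extension K L
  let _ : MulSemiringAction Gal(L/K) (integralClosure R L) :=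
    IsIntegralClosure.MulSemiringAction R K L _
  have : IsGaloisGroup Gal(L/K) R (integralClosure R L) := IsGaloisGroup.of_isFractionRing _ _ _ K L
  have : FaithfulSMul R L := by
    rw [faithfulSMul_iff_algebraMap_injective, IsScalarTower.algebraMap_eq R K L]
    exact (algebraMap K L).injective.comp (IsFractionRing.injective R K)
  have : Module.Flat R (integralClosure R L) := inferInstance
  have hsmul : ∀ (τ : Gal(L/K)) (x : integralClosure R L), τ • x = restrictIntegers R τ x :=
    fun τ x ↦ Subtype.ext (algebraMap_galRestrict_apply R τ x)
  -- An inertia element times a Frobenius element is again one; uniqueness makes the inertia group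
  -- trivial, and its order is the ramification index.
  have hinertia : Nat.card (Q.inertia Gal(L/K)) = 1 := by
    rw [Nat.card_eq_one_iff_unique]
    refine ⟨⟨fun τ₁ τ₂ ↦ Subtype.ext ?_⟩, ⟨1⟩⟩
    have key : ∀ τ : Q.inertia Gal(L/K), (τ : Gal(L/K)) * σ = σ := by
      refine fun τ ↦ h.unique _ _ Q inferInstance rfl (fun x ↦ ?_) hσ
      have h1 := add_mem (τ.2 (restrictIntegers R σ x)) (hσ x)
      rwa [hsmul, sub_add_sub_cancel] at h1
    exact mul_right_cancel ((key τ₁).trans (key τ₂).symm)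
  have hmax : (Q.under R).IsMaximal := Ring.DimensionLEOne.maximalOfPrime h0 inferInstance
  have : Finite (Q.under R).ResidueField := Finite.of_surjective _
    (Q.under R).bijective_algebraMap_quotient_residueField.surjective
  rw [Ideal.card_inertia_eq_ramificationIdxIn (Q.under R) Q,
    Ideal.ramificationIdxIn_eq_ramificationIdx (Q.under R) Q Gal(L/K)] at hinertia
  have hmap : (Q.under R).map (algebraMap R (integralClosure R L)) ≠ ⊥ :=
    Ideal.map_ne_bot_of_ne_bot h0
  rw [Ideal.IsDedekindDomain.ramificationIdx_eq_multiplicity (Q.under R) Q hmap] at hinertia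
  intro hle
  have hfin : FiniteMultiplicity Q ((Q.under R).map (algebraMap R (integralClosure R L))) := by
    refine FiniteMultiplicity.of_not_isUnit ?_ hmap
    rw [Ideal.isUnit_iff]
    exact Ideal.IsPrime.ne_top'
  have := hfin.le_multiplicity_of_pow_dvd (Ideal.dvd_iff_le.mpr hle)
  omega

end consequences

end Frobenius

end RingClassTower

end

/-! ### Valuations centred at a prime of a Dedekind domain -/

noncomputable section

section DedekindValuation

variable {O L Γ : Type*} [CommRing O] [IsDedekindDomain O] [Field L] [Algebra O L]
  [IsFractionRing O L] [LinearOrderedCommGroupWithZero Γ] {Q : Ideal O} {π : O}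

/-- Every nonzero element is a power of a uniformizer, up to factors outside the prime. -/
theorem Ideal.exists_pow_mul_eq [Q.IsPrime] (hπ : π ∈ Q) (hπ2 : π ∉ Q ^ 2) {y : O} (hy : y ≠ 0) :
    ∃ (m : ℕ) (c d c' d' : O), c ∉ Q ∧ c' ∉ Q ∧ π ^ m * c = y * d ∧ y * c' = π ^ m * d' := by
  have hπ0 : π ≠ 0 := by rintro rfl; exact hπ2 (zero_mem _)
  have hQ0 : Q ≠ ⊥ := by rintro rfl; exact hπ0 hπ
  have hQm : Q.IsMaximal := Ring.DimensionLEOne.maximalOfPrime hQ0 inferInstance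
  have outside {I : Ideal O} (hI : Q ⊔ I = ⊤) : ∃ c ∈ I, c ∉ Q := by
    by_contra! h
    exact hQm.ne_top (by rwa [sup_of_le_left (show I ≤ Q from h)] at hI)
  have factor {z : O} (hz : z ≠ 0) : ∃ (n : ℕ) (I : Ideal O), Q ⊔ I = ⊤ ∧
      Ideal.span {z} = Q ^ n * I := by
    obtain ⟨I, hI, e⟩ := Ideal.eq_prime_pow_mul_coprime
      (show Ideal.span {z} ≠ ⊥ by rwa [Ne, Ideal.span_singleton_eq_bot]) Q
    exact ⟨_, I, hI, e⟩
  obtain ⟨n, I, hI, e⟩ := factor hπ0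
  obtain ⟨m, J, hJ, e'⟩ := factor hy
  have hn : n = 1 := by
    have h1 : n ≠ 0 := by
      intro h0
      rw [h0, pow_zero, one_mul] at e
      have : I ≤ Q := by rw [← e]; exact (Ideal.span_singleton_le_iff_mem _).mpr hπ
      exact hQm.ne_top (by rwa [sup_of_le_left this] at hI)
    have h2 : n < 2 := by
      by_contra! h
      have h3 : Ideal.span {π} ≤ Q ^ 2 := by
        rw [e]; exact Ideal.mul_le_left.trans (Ideal.pow_le_pow_right h)
      exact hπ2 ((Ideal.span_singleton_le_iff_mem _).mp h3)
    omega
  rw [hn, pow_one] at e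
  obtain ⟨c, hcJ, hc⟩ := outside hJ
  obtain ⟨b, hbI, hb⟩ := outside hI
  -- With (π) = QI and (y) = Q^m J, I and J prime to Q: an element c of J and an element b of I,
  -- both outside Q, provide the two denominators.
  have h1 : π ^ m * c ∈ Ideal.span {y} := by
    rw [e']; exact Ideal.mul_mem_mul (Ideal.pow_mem_pow hπ m) hcJ
  have h2 : y * b ^ m ∈ Ideal.span {π ^ m} := by
    rw [← Ideal.span_singleton_pow, e, mul_pow]
    refine Ideal.mul_mem_mul ?_ (Ideal.pow_mem_pow hbI m)
    have : y ∈ Ideal.span {y} := Ideal.mem_span_singleton_self y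
    rw [e'] at this
    exact Ideal.mul_le_left this
  obtain ⟨d, hd⟩ := Ideal.mem_span_singleton.mp h1
  obtain ⟨d', hd'⟩ := Ideal.mem_span_singleton.mp h2
  exact ⟨m, c, d, b ^ m, d', hc, fun h ↦ hb (Ideal.IsPrime.mem_of_pow_mem ‹_› m h), hd, hd'⟩

variable {v : Valuation L Γ} (hv : ∀ x : O, v (algebraMap O L x) ≤ 1)
  (hvQ : ∀ x : O, x ∈ Q ↔ v (algebraMap O L x) < 1)

include hv hvQ

omit [IsDedekindDomain O] [IsFractionRing O L] in
theorem Valuation.map_eq_one_of_notMem {c : O} (hc : c ∉ Q) : v (algebraMap O L c) = 1 :=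
  (hv c).eq_of_not_lt fun h ↦ hc ((hvQ c).mpr h)

omit [IsFractionRing O L] in
-- The valuation is known only through its being at most 1 on `O` and less than 1 exactly on Q; the
-- divisibilities of `Ideal.exists_pow_mul_eq` bound the value from both sides.
theorem Valuation.exists_map_eq_pow [Q.IsPrime] (hπ : π ∈ Q) (hπ2 : π ∉ Q ^ 2) {y : O}
    (hy : y ≠ 0) : ∃ m : ℕ, v (algebraMap O L y) = v (algebraMap O L π) ^ m := by
  obtain ⟨m, c, d, c', d', hc, hc', e, e'⟩ := Ideal.exists_pow_mul_eq hπ hπ2 hy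
  have h1 := congr_arg (fun x ↦ v (algebraMap O L x)) e
  have h2 := congr_arg (fun x ↦ v (algebraMap O L x)) e'
  simp only [map_mul, map_pow, v.map_eq_one_of_notMem hv hvQ hc, v.map_eq_one_of_notMem hv hvQ hc',
    mul_one] at h1 h2
  refine ⟨m, le_antisymm ?_ ?_⟩
  · rw [h2]; exact mul_le_of_le_one_right' (hv d')
  · rw [h1]; exact mul_le_of_le_one_right' (hv d)

/-- An element of the valuation ring is a fraction with denominator outside the prime. -/
theorem Valuation.exists_mul_eq_of_le_one [Q.IsPrime] (hπ : π ∈ Q) (hπ2 : π ∉ Q ^ 2) {x : L}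
    (hx : v x ≤ 1) : ∃ u e : O, u ∉ Q ∧ x * algebraMap O L u = algebraMap O L e := by
  have hπ0 : π ≠ 0 := by rintro rfl; exact hπ2 (zero_mem _)
  obtain ⟨y, z, hz, rfl⟩ := IsFractionRing.div_surjective (A := O) x
  have hz0 : z ≠ 0 := nonZeroDivisors.ne_zero hz
  have hzL : algebraMap O L z ≠ 0 := by simpa using hz0
  have hπL : algebraMap O L π ≠ 0 := by simpa using hπ0
  by_cases hy : y = 0
  · exact ⟨1, 0, fun h ↦ ‹Q.IsPrime›.ne_top ((Ideal.eq_top_iff_one Q).mpr h), by simp [hy]⟩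
  obtain ⟨m, c, d, c', d', hc, hc', e, e'⟩ := Ideal.exists_pow_mul_eq hπ hπ2 hy
  obtain ⟨n, b, a, b', a', hb, hb', f, f'⟩ := Ideal.exists_pow_mul_eq hπ hπ2 hz0
  have hmn : n ≤ m := by
    by_contra! hlt
    have hd : v (algebraMap O L π) ^ m ≤ v (algebraMap O L y) := by
      have h1 := congr_arg (fun x ↦ v (algebraMap O L x)) e
      simp only [map_mul, map_pow, v.map_eq_one_of_notMem hv hvQ hc, mul_one] at h1
      rw [h1]; exact mul_le_of_le_one_right' (hv d)
    have hd' : v (algebraMap O L z) ≤ v (algebraMap O L π) ^ n := by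
      have h1 := congr_arg (fun x ↦ v (algebraMap O L x)) f'
      simp only [map_mul, map_pow, v.map_eq_one_of_notMem hv hvQ hb', mul_one] at h1
      rw [h1]; exact mul_le_of_le_one_right' (hv a')
    have hle : v (algebraMap O L y) ≤ v (algebraMap O L z) := by
      rwa [map_div₀, div_le_one₀ (zero_lt_iff.mpr (v.ne_zero_iff.mpr hzL))] at hx
    exact (pow_lt_pow_right_of_lt_one₀ (zero_lt_iff.mpr (v.ne_zero_iff.mpr hπL)) ((hvQ π).mp hπ)
      hlt).not_ge (hd.trans (hle.trans hd'))
  obtain ⟨k, rfl⟩ := Nat.exists_eq_add_of_le hmn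
  refine ⟨c' * b, π ^ k * d' * a, fun h ↦ (‹Q.IsPrime›.mem_or_mem h).elim hc' hb, ?_⟩
  rw [div_mul_eq_mul_div, div_eq_iff hzL, ← map_mul, ← map_mul]
  congr 1
  linear_combination b * e' + π ^ k * d' * f

theorem Valuation.exists_pow_le_map [Q.IsPrime] (hπ : π ∈ Q) (hπ2 : π ∉ Q ^ 2) {x : L}
    (hx : x ≠ 0) : ∃ m : ℕ, v (algebraMap O L π) ^ m ≤ v x := by
  obtain ⟨y, z, hz, rfl⟩ := IsFractionRing.div_surjective (A := O) x
  have hz0 : z ≠ 0 := nonZeroDivisors.ne_zero hz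
  have hzL : algebraMap O L z ≠ 0 := by simpa using hz0
  have hy : y ≠ 0 := by rintro rfl; simp at hx
  obtain ⟨m, hm⟩ := v.exists_map_eq_pow hv hvQ hπ hπ2 hy
  refine ⟨m, ?_⟩
  rw [← hm, map_div₀, le_div_iff₀ (zero_lt_iff.mpr (v.ne_zero_iff.mpr hzL))]
  exact mul_le_of_le_one_right' (hv z)

theorem Valuation.map_le_of_lt_one [Q.IsPrime] (hπ : π ∈ Q) (hπ2 : π ∉ Q ^ 2) {x : L}
    (hx : v x < 1) : v x ≤ v (algebraMap O L π) := by
  obtain ⟨u, e, hu, he⟩ := v.exists_mul_eq_of_le_one hv hvQ hπ hπ2 hx.le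
  have h1 := congr_arg v he
  rw [map_mul, v.map_eq_one_of_notMem hv hvQ hu, mul_one] at h1
  rw [h1] at hx ⊢
  by_cases he0 : e = 0
  · rw [he0]; simp
  obtain ⟨m, hm⟩ := v.exists_map_eq_pow hv hvQ hπ hπ2 he0
  have hm0 : m ≠ 0 := by rintro rfl; rw [hm, pow_zero] at hx; exact lt_irrefl _ hx
  rw [hm]
  exact pow_le_of_le_one zero_le (hv π) hm0

theorem Valuation.map_pow_sub_lt_one [Q.IsPrime] (hπ : π ∈ Q) (hπ2 : π ∉ Q ^ 2) {q : ℕ}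
    (hq : ∀ y : O, y ^ q - y ∈ Q) {x : L} (hx : v x ≤ 1) : v (x ^ q - x) < 1 := by
  obtain ⟨u, e, hu, he⟩ := v.exists_mul_eq_of_le_one hv hvQ hπ hπ2 hx
  have hvu := v.map_eq_one_of_notMem hv hvQ hu
  have h1 : v ((x ^ q - x) * algebraMap O L (u ^ q)) < 1 := by
    have : (x ^ q - x) * algebraMap O L (u ^ q) =
        algebraMap O L (e ^ q - e) - x * algebraMap O L (u ^ q - u) := by
      simp only [_root_.map_sub, map_pow]
      rw [← he]
      ring
    rw [this]
    refine v.map_sub_lt ((hvQ _).mp (hq e)) ?_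
    rw [map_mul]
    exact (mul_le_of_le_one_left' hx).trans_lt ((hvQ _).mp (hq u))
  rwa [map_mul, map_pow, map_pow, hvu, one_pow, mul_one] at h1

end DedekindValuation

/-- The quotients of a valuation ring are finite if its residue field is finite and its maximal
ideal is principal with powers tending to zero. -/
theorem Valuation.exists_finite_approx {T Γ : Type*} [Field T] [LinearOrderedCommGroupWithZero Γ]
    {v : Valuation T Γ} {π : T} (hπ0 : π ≠ 0) {q : ℕ} (hq : 1 < q)
    (hpow : ∀ x, x ≠ 0 → ∃ m : ℕ, v π ^ m ≤ v x) (hle : ∀ x, v x < 1 → v x ≤ v π)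
    (hres : ∀ x, v x ≤ 1 → v (x ^ q - x) < 1) {δ : T} (hδ : δ ≠ 0) :
    ∃ s : Set T, s.Finite ∧ ∀ x, v x ≤ 1 → ∃ y ∈ s, v (x - y) ≤ v δ := by
  have h1 : ∃ s : Set T, s.Finite ∧ ∀ x, v x ≤ 1 → ∃ y ∈ s, v (x - y) ≤ v π := by
    classical
    let κ := IsLocalRing.ResidueField v.valuationSubring
    let f : κ → T := fun a ↦ (Function.surjInv (IsLocalRing.residue_surjective) a).1
    -- All residues are roots of X^q - X by `hres`, so this bounds the residue field.
    have hfin : {a : κ | a ^ q - a = 0}.Finite := by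
      have hne : (Polynomial.X ^ q - Polynomial.X : Polynomial κ) ≠ 0 :=
        FiniteField.X_pow_card_sub_X_ne_zero κ hq
      refine (Polynomial.X ^ q - Polynomial.X : Polynomial κ).roots.toFinset.finite_toSet.subset ?_
      intro a ha
      simpa [hne, sub_eq_zero] using ha
    have hlt : ∀ a : v.valuationSubring, IsLocalRing.residue _ a = 0 ↔ v (a : T) < 1 := by
      intro a
      rw [IsLocalRing.residue_eq_zero_iff, IsLocalRing.mem_maximalIdeal, mem_nonunits_iff,
        (show v.Integers v.valuationSubring from Valuation.integer.integers v).isUnit_iff_valuation_eq_one]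
      exact ⟨fun h ↦ lt_of_le_of_ne a.2 h, fun h ↦ h.ne⟩
    refine ⟨f '' {a : κ | a ^ q - a = 0}, hfin.image f, fun x hx ↦ ?_⟩
    let x' : v.valuationSubring := ⟨x, hx⟩
    refine ⟨_, ⟨IsLocalRing.residue _ x', ?_, rfl⟩, hle _ ?_⟩
    · change _ ^ q - _ = _
      rw [← map_pow, ← _root_.map_sub, hlt]
      exact hres x hx
    · have : IsLocalRing.residue _ (x' - Function.surjInv IsLocalRing.residue_surjective
          (IsLocalRing.residue v.valuationSubring x')) = 0 := by
        rw [_root_.map_sub, Function.surjInv_eq IsLocalRing.residue_surjective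
          (IsLocalRing.residue v.valuationSubring x'), sub_self]
      exact (hlt _).mp this
  have hn : ∀ n : ℕ, ∃ s : Set T, s.Finite ∧ ∀ x, v x ≤ 1 → ∃ y ∈ s, v (x - y) ≤ v π ^ n := by
    intro n
    induction n with
    | zero => exact ⟨{0}, Set.finite_singleton 0, fun x hx ↦ ⟨0, rfl, by simpa using hx⟩⟩
    | succ n ih =>
      obtain ⟨s, hs, hsx⟩ := h1
      obtain ⟨t, ht, htx⟩ := ih
      -- Digit expansion in powers of π: a first digit from s, the remaining n from t.
      refine ⟨_, hs.image2 (fun y z ↦ y + π * z) ht, fun x hx ↦ ?_⟩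
      obtain ⟨y, hy, hxy⟩ := hsx x hx
      have hle1 : v ((x - y) / π) ≤ 1 := by
        rw [map_div₀]; exact div_le_one_of_le₀ hxy zero_le
      obtain ⟨z, hz, hyz⟩ := htx _ hle1
      refine ⟨_, Set.mem_image2_of_mem hy hz, ?_⟩
      have : x - (y + π * z) = π * ((x - y) / π - z) := by field_simp; ring
      rw [this, map_mul, pow_succ']
      gcongr
  obtain ⟨m, hm⟩ := hpow δ hδ
  obtain ⟨s, hs, hsx⟩ := hn m
  exact ⟨s, hs, fun x hx ↦ (hsx x hx).imp fun y hy ↦ ⟨hy.1, hy.2.trans hm⟩⟩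

end

/-! ### A valuation with finite quotients on an infinite union -/

noncomputable section

namespace RingClassTower

section Valuation

variable {R : Type*} [CommRing R] [IsDedekindDomain R] {K : Type*} [Field K] [Algebra R K]
  [IsFractionRing R K] {Ω : Type*} [Field Ω] [Algebra K Ω] [Algebra R Ω] [IsScalarTower R K Ω]
  {𝔮 : Ideal R} {H : ℕ}

omit [IsDedekindDomain R] in
-- Existence of a valuation ring dominating the image of `R` at 𝔮 in the big field; maximality of 𝔮
-- turns inclusion of the centre into equality.
theorem exists_valuationSubring_above (K : Type*) [Field K] [Algebra R K] [IsFractionRing R K]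
    [Algebra K Ω] [IsScalarTower R K Ω] [𝔮.IsMaximal] :
    ∃ V : ValuationSubring Ω, (∀ r : R, algebraMap R Ω r ∈ V) ∧
      ∀ r : R, r ∈ 𝔮 ↔ V.valuation (algebraMap R Ω r) < 1 := by
  have hinj : Function.Injective (algebraMap R Ω) := by
    rw [IsScalarTower.algebraMap_eq R K Ω]
    exact (algebraMap K Ω).injective.comp (IsFractionRing.injective R K)
  let f := (algebraMap R Ω).rangeRestrict
  have hf : Function.Surjective f := (algebraMap R Ω).rangeRestrict_surjective
  have hker : RingHom.ker f ≤ 𝔮 := by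
    intro r hr
    have : algebraMap R Ω r = 0 := congr_arg Subtype.val ((RingHom.mem_ker).mp hr)
    rw [← map_zero (algebraMap R Ω)] at this
    rw [hinj this]
    exact 𝔮.zero_mem
  have hI : 𝔮.map f ≠ ⊤ := by
    intro h
    have h1 := congr_arg (Ideal.comap f) h
    rw [Ideal.comap_map_of_surjective' f hf, Ideal.comap_top, sup_of_le_left hker] at h1
    exact Ideal.IsPrime.ne_top' h1
  obtain ⟨V, hV, hIV⟩ := Ideal.image_subset_nonunits_valuationSubring (𝔮.map f) hI
  have hRV : ∀ r : R, algebraMap R Ω r ∈ V := fun r ↦ hV ⟨r, rfl⟩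
  refine ⟨V, hRV, fun r ↦ ⟨fun hr ↦ ?_, fun hr ↦ ?_⟩⟩
  · exact V.mem_nonunits_iff.mp (hIV ⟨f r, Ideal.mem_map_of_mem f hr, rfl⟩)
  · by_contra hr𝔮
    obtain ⟨a, i, hi, e⟩ := Ideal.IsMaximal.exists_inv ‹_› hr𝔮
    have h1 := congr_arg (fun z ↦ V.valuation (algebraMap R Ω z)) e
    simp only [map_add, map_mul, map_one] at h1
    refine (V.valuation.map_add_lt ?_ ?_ : _ < (1 : V.ValueGroup)).ne h1
    · rw [map_mul]
      exact (mul_le_of_le_one_left' ((V.valuation_le_one_iff _).mpr (hRV a))).trans_lt hr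
    · exact V.mem_nonunits_iff.mp (hIV ⟨f i, Ideal.mem_map_of_mem f hi, rfl⟩)

/-- The valuation ring `V` induces the prime `𝔮` of `R`. -/
structure LiesAbove (𝔮 : Ideal R) (V : ValuationSubring Ω) : Prop where
  mem : ∀ r : R, algebraMap R Ω r ∈ V
  mem_iff : ∀ r : R, r ∈ 𝔮 ↔ V.valuation (algebraMap R Ω r) < 1

omit [IsDedekindDomain R] in
theorem LiesAbove.integral_mem {V : ValuationSubring Ω} (hV : LiesAbove 𝔮 V) {x : Ω}
    (hx : IsIntegral R x) : x ∈ V := by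
  let _ : Algebra R V := ((algebraMap R Ω).codRestrict V.toSubring hV.mem).toAlgebra
  have : IsScalarTower R V Ω := .of_algebraMap_eq fun _ ↦ rfl
  obtain ⟨y, rfl⟩ := (IsIntegrallyClosed.isIntegral_iff (R := V)).mp (hx.tower_top (A := V))
  exact y.2

/-- The centre of V on the integers of L is a prime Q above 𝔮, unramified by uniqueness of
Frobenius, so π remains a uniformizer. All three bounds involve only π, 𝔮 and H, not L, and so pass
to unions. -/
theorem HasFrobeniusOrder.valuation_spec {L : IntermediateField K Ω}
    (hL : HasFrobeniusOrder R K 𝔮 H L) [𝔮.IsMaximal] [Finite (R ⧸ 𝔮)] (h0 : 𝔮 ≠ ⊥)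
    {V : ValuationSubring Ω} (hV : LiesAbove 𝔮 V) {π : R} (hπ : π ∈ 𝔮) (hπ2 : π ∉ 𝔮 ^ 2) {x : Ω}
    (hx : x ∈ L) :
    (x ≠ 0 → ∃ m : ℕ, V.valuation (algebraMap R Ω π) ^ m ≤ V.valuation x) ∧
    (V.valuation x < 1 → V.valuation x ≤ V.valuation (algebraMap R Ω π)) ∧
    (V.valuation x ≤ 1 → V.valuation (x ^ (Nat.card (R ⧸ 𝔮) ^ H) - x) < 1) := by
  have := hL.finite
  have := hL.galois
  have : IsDedekindDomain (integralClosure R L) := IsIntegralClosure.isDedekindDomain R K L _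
  have : IsFractionRing (integralClosure R L) L :=
    integralClosure.isFractionRing_of_finite_extension K L
  have : IsScalarTower R L Ω := .of_algebraMap_eq fun _ ↦ rfl
  let v : Valuation L V.ValueGroup := V.valuation.comap (algebraMap L Ω)
  have hmem : ∀ y : integralClosure R L, (y : Ω) ∈ V := fun y ↦
    hV.integral_mem (y.2.map (IsScalarTower.toAlgHom R L Ω))
  have hv : ∀ y : integralClosure R L, v (algebraMap _ L y) ≤ 1 := fun y ↦
    (V.valuation_le_one_iff _).mpr (hmem y)
  let Q : Ideal (integralClosure R L) :=
    { carrier := {y | v (algebraMap _ L y) < 1}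
      add_mem' := fun {a b} ha hb ↦ by
        rw [Set.mem_ofPred_eq, _root_.map_add]
        exact v.map_add_lt ha hb
      zero_mem' := by simp
      smul_mem' := fun c y hy ↦ by
        rw [Set.mem_ofPred_eq, smul_eq_mul, map_mul, map_mul]
        exact (mul_le_of_le_one_left' (hv c)).trans_lt hy }
  have hvQ : ∀ y : integralClosure R L, y ∈ Q ↔ v (algebraMap _ L y) < 1 := fun y ↦ Iff.rfl
  have hQ : Q.IsPrime := by
    refine ⟨fun h ↦ ?_, fun {a b} hab ↦ ?_⟩
    · have : (1 : integralClosure R L) ∈ Q := h ▸ Submodule.mem_top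
      rw [hvQ, map_one, map_one] at this
      exact lt_irrefl _ this
    · by_contra! h
      rw [hvQ, map_mul, map_mul, v.map_eq_one_of_notMem hv hvQ h.1,
        v.map_eq_one_of_notMem hv hvQ h.2, one_mul] at hab
      exact lt_irrefl _ hab
  have hQ𝔮 : Q.under R = 𝔮 := by
    ext r
    exact (hV.mem_iff r).symm
  have hπQ : algebraMap R (integralClosure R L) π ∈ Q := by
    rw [← hQ𝔮] at hπ; exact hπ
  have hπQ2 : algebraMap R (integralClosure R L) π ∉ Q ^ 2 := by
    intro hmem
    refine hL.not_le_sq h0 Q hQ𝔮 ?_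
    -- As 𝔮 = 𝔮² + (π), having π in Q² would put all of 𝔮 in Q² and make Q ramified.
    have hsup : 𝔮 ≤ 𝔮 ^ 2 ⊔ Ideal.span {π} := by
      refine (pow_one 𝔮).symm.trans_le (Ideal.eq_prime_pow_of_succ_lt_of_le (P := 𝔮) (i := 1) h0
        (lt_of_le_of_ne le_sup_left fun h ↦ hπ2 ?_) ?_).ge
      · rw [h]
        exact Ideal.mem_sup_right (Ideal.mem_span_singleton_self π)
      · rw [pow_one]
        exact sup_le (Ideal.pow_le_self two_ne_zero) ((Ideal.span_singleton_le_iff_mem _).mpr hπ)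
    refine (Ideal.map_mono hsup).trans ?_
    rw [Ideal.map_sup, Ideal.map_pow, Ideal.map_span, Set.image_singleton]
    refine sup_le (Ideal.pow_right_mono (Ideal.map_le_iff_le_comap.mpr hQ𝔮.ge) 2) ?_
    exact (Ideal.span_singleton_le_iff_mem _).mpr hmem
  have hq := hL.pow_sub_mem Q hQ𝔮
  refine ⟨fun hx0 ↦ ?_, fun hx1 ↦ ?_, fun hx1 ↦ ?_⟩
  · exact v.exists_pow_le_map hv hvQ hπQ hπQ2 (x := ⟨x, hx⟩) fun h ↦ hx0 (congr_arg Subtype.val h)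
  · exact v.map_le_of_lt_one hv hvQ hπQ hπQ2 (x := ⟨x, hx⟩) hx1
  · exact v.map_pow_sub_lt_one hv hvQ hπQ hπQ2 hq (x := ⟨x, hx⟩) hx1

/-- A union of extensions in which the Frobenius elements at `𝔮` are unique and have bounded order
carries a valuation with finite quotients. -/
theorem exists_valuation_finite_approx (h𝔮 : 𝔮.IsPrime) [Finite (R ⧸ 𝔮)] (h0 : 𝔮 ≠ ⊥) (hH : H ≠ 0)
    {T : IntermediateField K Ω} (hT : ∀ x ∈ T, ∃ L : IntermediateField K Ω, HasFrobeniusOrder R K 𝔮 H L ∧ x ∈ L) :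
    ∃ (V : ValuationSubring Ω) (ϖ : T), ϖ ≠ 0 ∧ V.valuation.comap (algebraMap T Ω) ϖ < 1 ∧
      ∀ δ : T, δ ≠ 0 → ∃ s : Set T, s.Finite ∧ ∀ x,
        V.valuation.comap (algebraMap T Ω) x ≤ 1 → ∃ y ∈ s,
          V.valuation.comap (algebraMap T Ω) (x - y) ≤ V.valuation.comap (algebraMap T Ω) δ := by
  have hm : 𝔮.IsMaximal := Ring.DimensionLEOne.maximalOfPrime h0 h𝔮
  obtain ⟨V, hV1, hV2⟩ := exists_valuationSubring_above (Ω := Ω) (𝔮 := 𝔮) K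
  have hV : LiesAbove 𝔮 V := ⟨hV1, hV2⟩
  obtain ⟨π, hπ, hπ2⟩ : ∃ π ∈ 𝔮, π ∉ 𝔮 ^ 2 := by
    have := Ideal.pow_succ_lt_pow h0 1
    rw [pow_one] at this
    exact Set.exists_of_ssubset this
  have hq : 1 < Nat.card (R ⧸ 𝔮) ^ H := Nat.one_lt_pow hH Finite.one_lt_card
  have hπ0 : π ≠ 0 := by rintro rfl; exact hπ2 (zero_mem _)
  have hπT : algebraMap R T π ≠ 0 := by
    rw [IsScalarTower.algebraMap_apply R K T]
    simpa using hπ0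
  refine ⟨V, algebraMap R T π, hπT, (hV.mem_iff π).mp hπ, fun δ hδ ↦ ?_⟩
  refine Valuation.exists_finite_approx (π := algebraMap R T π) hπT hq ?_ ?_ ?_ hδ
  · rintro ⟨x, hx⟩ hx0
    obtain ⟨L, hL, hxL⟩ := hT x hx
    exact (hL.valuation_spec h0 hV hπ hπ2 hxL).1 fun h ↦ hx0 (Subtype.ext h)
  · rintro ⟨x, hx⟩ hx1
    obtain ⟨L, hL, hxL⟩ := hT x hx
    exact (hL.valuation_spec h0 hV hπ hπ2 hxL).2.1 hx1
  · rintro ⟨x, hx⟩ hx1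
    obtain ⟨L, hL, hxL⟩ := hT x hx
    exact (hL.valuation_spec h0 hV hπ hπ2 hxL).2.2 hx1

end Valuation

end RingClassTower

end

/-! ### Application to the ring class tower -/

noncomputable section

namespace RingClassTower

open scoped nonZeroDivisors

theorem integralClosure_isDedekindDomain (R K L : Type*) [CommRing R] [IsDedekindDomain R] [Field K]
    [Algebra R K] [IsFractionRing R K] [Field L] [Algebra K L] [Algebra R L] [IsScalarTower R K L]
    [FiniteDimensional K L] [Algebra.IsSeparable K L] : IsDedekindDomain (integralClosure R L) :=
  IsIntegralClosure.isDedekindDomain R K L _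

variable {k : Type*} [Field k] {A : Subring k} {K : Type*} [Field K] [Algebra k K]
  [IsDedekindDomain (maxOrder A K)] [IsFractionRing (maxOrder A K) K]
  {𝔭 : Ideal A} {Q : Ideal (maxOrder A K)} {H : ℕ} {a : A}

/-- The H-th power of the symbol of Q is the symbol of (a), which is trivial because a lies in `A`,
hence in the order of every level, and is prime to `𝔭`. Since L is unramified at Q, every Frobenius
element above Q equals the symbol. Neither Q nor H depends on n. -/
theorem IsRingClassExtension.hasFrobeniusOrder {n : ℕ} {L : IntermediateField K (SeparableClosure K)}
    (hL : IsRingClassExtension K 𝔭 n L) [h𝔭 : 𝔭.IsMaximal] (hQ : Q.IsPrime) (h0 : Q ≠ ⊥)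
    (hQ𝔭 : ¬extend K 𝔭 ≤ Q) (ha : a ∉ 𝔭) (hQH : Q ^ H = Ideal.span {algebraMap A (maxOrder A K) a}) :
    HasFrobeniusOrder (maxOrder A K) K Q H L := by
  have := hL.finite
  have := hL.abelian
  obtain ⟨φ, hφ, hφ1⟩ := hL.artin
  let Q' : (Ideal (maxOrder A K))⁰ := ⟨Q, mem_nonZeroDivisors_of_ne_zero h0⟩
  have : IsDedekindDomain (integralClosure (maxOrder A K) L) :=
    integralClosure_isDedekindDomain (maxOrder A K) K L
  have eq (σ : L ≃ₐ[K] L) (P : Ideal (integralClosure (maxOrder A K) L)) (hP : P.IsPrime)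
      (hPQ : P.under (maxOrder A K) = Q) (hσ : (restrictIntegers (maxOrder A K) σ).IsArithFrobAt P) :
      σ = φ Q' := by
    have hf := hφ Q' hQ hQ𝔭 P hP hPQ
    have := hL.unramified P (by rwa [hPQ]) (by rwa [hPQ])
    exact restrictIntegers_injective (maxOrder A K) K L
      (hσ.eq_of_isUnramifiedAt hf (Ideal.primeCompl_le_nonZeroDivisors P))
  have hφQ : φ Q' ^ H = 1 := by
    have ha0 : algebraMap A (maxOrder A K) a ≠ 0 := by
      intro h
      rw [h, Ideal.span_singleton_eq_bot.mpr rfl] at hQH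
      exact pow_ne_zero H h0 hQH
    have hcop : IsCoprime (Ideal.span {algebraMap A (maxOrder A K) a}) (extend K 𝔭) := by
      rw [Ideal.isCoprime_iff_sup_eq, extend, ← Set.image_singleton, ← Ideal.map_span,
        ← Ideal.map_sup, (Ideal.isMaximal_def.mp h𝔭).2 (Ideal.span {a} ⊔ 𝔭), Ideal.map_top]
      refine lt_of_le_of_ne le_sup_right fun h ↦ ha ?_
      rw [h]
      exact Ideal.mem_sup_left (Ideal.mem_span_singleton_self a)
    have h1 := hφ1 (algebraMap A (maxOrder A K) a) ha0 (Subalgebra.algebraMap_mem _ a) hcop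
    rw [← map_pow, ← h1]
    congr 1
    exact Subtype.ext hQH
  refine ⟨hL.finite, inferInstance, fun σ τ P hP hPQ hσ hτ ↦ ?_, fun σ P hP hPQ hσ ↦ ?_⟩
  · rw [eq σ P hP hPQ hσ, eq τ P hP hPQ hτ]
  · rw [eq σ P hP hPQ hσ, hφQ]

/-- An element of a compositum lies in a finite sub-compositum, and the property is stable under
finite composita. -/
theorem exists_hasFrobeniusOrder_of_mem_ringClassTower [𝔭.IsMaximal] (hQ : Q.IsPrime)
    (h0 : Q ≠ ⊥) (hQ𝔭 : ¬extend K 𝔭 ≤ Q) (ha : a ∉ 𝔭)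
    (hQH : Q ^ H = Ideal.span {algebraMap A (maxOrder A K) a}) {x : SeparableClosure K}
    (hx : x ∈ ringClassTower K 𝔭) :
    ∃ L : IntermediateField K (SeparableClosure K),
      HasFrobeniusOrder (maxOrder A K) K Q H L ∧ x ∈ L := by
  let S := {L : IntermediateField K (SeparableClosure K) //
    HasFrobeniusOrder (maxOrder A K) K Q H L}
  have hle : ringClassTower K 𝔭 ≤ ⨆ L : S, L.1 :=
    iSup₂_le fun n _ ↦ iSup₂_le fun L hL ↦
      le_iSup (fun L : S ↦ L.1) ⟨L, hL.hasFrobeniusOrder hQ h0 hQ𝔭 ha hQH⟩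
  obtain ⟨s, hs⟩ := IntermediateField.exists_finset_of_mem_iSup (hle hx)
  refine ⟨⨆ i ∈ s, i.1, ?_, hs⟩
  clear hs
  classical
  induction s using Finset.induction_on with
  | empty =>
    rw [show (⨆ i ∈ (∅ : Finset S), i.1) = ⊥ by simp]
    exact HasFrobeniusOrder.bot
  | insert L s _ ih =>
    rw [Finset.iSup_insert]
    exact L.2.sup ih

open scoped Classical in
/-- Torsion is finite over the ring class tower as soon as some prime away from `𝔭` has a power
generated by an element of `A` prime to `𝔭`. -/
theorem finite_torsion_of_principal_power (p : ℕ) [Fact p.Prime] (hp : p ≠ 2) [CharP k p]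
    [𝔭.IsMaximal] (hQ : Q.IsPrime) (h0 : Q ≠ ⊥) (hQ𝔭 : ¬extend K 𝔭 ≤ Q)
    [Finite (maxOrder A K ⧸ Q)] (ha : a ∉ 𝔭) (hH : H ≠ 0)
    (hQH : Q ^ H = Ideal.span {algebraMap A (maxOrder A K) a})
    (E : WeierstrassCurve (ringClassTower K 𝔭)) [E.IsElliptic] :
    Finite (AddCommGroup.torsion (WeierstrassCurve.Affine.Point E)) := by
  obtain ⟨V, ϖ, hϖ0, hϖ, hv⟩ := exists_valuation_finite_approx (K := K) hQ h0 hH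
    fun x hx ↦ exists_hasFrobeniusOrder_of_mem_ringClassTower hQ h0 hQ𝔭 ha hQH hx
  have : CharP K p := charP_of_injective_algebraMap (algebraMap k K).injective p
  have : CharP (ringClassTower K 𝔭) p := charP_of_injective_algebraMap (algebraMap K _).injective p
  exact WeierstrassCurve.Affine.finite_torsion p E hp hϖ0 hϖ hv

end RingClassTower

end

/-! ### Norms modulo an element, and squares in finite rings -/

theorem LinearMap.det_pi_dependent {ι R : Type*} [Fintype ι] [DecidableEq ι] [CommRing R]
    {M : ι → Type*} [∀ i, AddCommGroup (M i)] [∀ i, Module R (M i)] [∀ i, Module.Free R (M i)]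
    [∀ i, Module.Finite R (M i)] (f : ∀ i, M i →ₗ[R] M i) :
    LinearMap.det (LinearMap.pi fun i ↦ f i ∘ₗ LinearMap.proj i) = ∏ i, LinearMap.det (f i) := by
  classical
  let b i := Module.Free.chooseBasis R (M i)
  rw [← LinearMap.det_toMatrix (Pi.basis b)]
  have hM (x y) : LinearMap.toMatrix (Pi.basis b) (Pi.basis b)
      (LinearMap.pi fun i ↦ f i ∘ₗ LinearMap.proj i) x y =
      if h : x.1 = y.1 then LinearMap.toMatrix (b x.1) (b x.1) (f x.1) x.2 (h ▸ y.2) else 0 := by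
    obtain ⟨i, x⟩ := x
    obtain ⟨j, y⟩ := y
    rw [LinearMap.toMatrix_apply, Pi.basis_repr, Pi.basis_apply]
    split_ifs with h
    · obtain rfl : i = j := h
      simp [LinearMap.toMatrix_apply]
    · change i ≠ j at h
      simp [Pi.single_eq_of_ne h]
  let e := Fintype.equivFin ι
  rw [Matrix.BlockTriangular.det_fintype (b := fun x ↦ e x.1), ← e.prod_comp]
  · refine Finset.prod_congr rfl fun i _ ↦ ?_
    rw [← LinearMap.det_toMatrix (b i)]
    let e' : {x : Σ i, Module.Free.ChooseBasisIndex R (M i) // e x.1 = e i} ≃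
        Module.Free.ChooseBasisIndex R (M i) :=
      { toFun x := e.injective x.2 ▸ x.1.2
        invFun y := ⟨⟨i, y⟩, rfl⟩
        left_inv := by
          rintro ⟨⟨j, y⟩, h⟩
          obtain rfl := e.injective h
          rfl
        right_inv _ := rfl }
    rw [← Matrix.det_submatrix_equiv_self e'.symm]
    congr 1
    ext x y
    rw [Matrix.submatrix_apply, Matrix.toSquareBlock_def, Matrix.of_apply, hM]
    exact dif_pos rfl
  · intro x y h
    rw [hM, dif_neg]
    intro h'
    simp [h'] at h

namespace Polynomial

open Polynomial

variable {F : Type*} [Field F]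

/-- The value at `0`, up to sign, of the monic polynomial proportional to `P`: the norm of `X`
modulo `P`. -/
noncomputable def normX (P : F[X]) : F := (-1) ^ P.natDegree * P.coeff 0 / P.leadingCoeff

theorem normX_mul (P Q : F[X]) : normX (P * Q) = normX P * normX Q := by
  by_cases hP : P = 0
  · simp [hP, normX]
  by_cases hQ : Q = 0
  · simp [hQ, normX]
  rw [normX, normX, normX, natDegree_mul hP hQ, mul_coeff_zero, leadingCoeff_mul, pow_add]
  field_simp

theorem normX_one : normX (1 : F[X]) = 1 := by simp [normX]

theorem normX_prod {ι : Type*} (s : Finset ι) (P : ι → F[X]) :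
    normX (∏ i ∈ s, P i) = ∏ i ∈ s, normX (P i) := by
  classical
  induction s using Finset.induction_on with
  | empty => simp [normX_one]
  | insert i s hi ih => rw [Finset.prod_insert hi, Finset.prod_insert hi, normX_mul, ih]

theorem normX_C {c : F} (hc : c ≠ 0) : normX (C c) = 1 := by simp [normX, hc]

theorem normX_eq_of_associated {P Q : F[X]} (h : Associated P Q) : normX P = normX Q := by
  obtain ⟨u, rfl⟩ := h
  obtain ⟨c, hc, hu⟩ := Polynomial.isUnit_iff.mp u.isUnit
  rw [normX_mul, ← hu, normX_C hc.ne_zero, mul_one]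

theorem norm_root_eq_normX {P : F[X]} (hP : P ≠ 0) :
    Algebra.norm F (AdjoinRoot.root P) = normX P := by
  have := Algebra.PowerBasis.norm_gen_eq_coeff_zero_minpoly (AdjoinRoot.powerBasis hP)
  rw [AdjoinRoot.powerBasis_gen, AdjoinRoot.minpoly_root hP, AdjoinRoot.powerBasis_dim] at this
  rw [this, normX, coeff_mul_C]
  ring

open Ideal in
/-- The norm of `X` on `S / f` is determined by the relative norm of `f`. -/
theorem norm_X_quotient_span {S ι : Type*} [CommRing S] [IsDomain S] [Algebra F[X] S]
    [Algebra F S] [IsScalarTower F F[X] S] [Finite ι] (b : Module.Basis ι F[X] S) {f : S}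
    (hf : f ≠ 0) :
    Algebra.norm F (Ideal.Quotient.mk (span {f}) (algebraMap F[X] S X)) =
      normX (Algebra.norm F[X] f) := by
  classical
  have := Fintype.ofFinite ι
  have hI : span {f} ≠ ⊥ := span_singleton_eq_bot.not.2 hf
  -- Smith normal form: S/f is the product of the F[X]/cᵢ, and the relative norm of f is the product
  -- of the cᵢ up to a unit.
  rw [normX_eq_of_associated (associated_norm_prod_smith b hf), normX_prod]
  let c i := (span {f}).smithCoeffs b hI i
  have hc i : c i ≠ 0 := smithCoeffs_ne_zero b _ hI i
  let e := quotientEquivPiSpan (span {f}) b hI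
  have : ∏ i, normX (c i) = ∏ i, LinearMap.det
      (LinearMap.lsmul F[X] (F[X] ⧸ span {c i}) X |>.restrictScalars F) := by
    refine Finset.prod_congr rfl fun i _ ↦ ?_
    rw [← norm_root_eq_normX (hc i), Algebra.norm_apply]
    congr 1
  rw [this, ← LinearMap.det_pi_dependent, Algebra.norm_apply, ← LinearMap.det_conj _ (e.restrictScalars F)]
  congr 1
  refine LinearMap.ext fun x ↦ ?_
  obtain ⟨x, rfl⟩ := e.surjective x
  ext i
  obtain ⟨x, rfl⟩ := Ideal.Quotient.mk_surjective x
  simp only [LinearMap.comp_apply, LinearEquiv.coe_coe, LinearEquiv.restrictScalars_apply,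
    LinearMap.pi_apply, LinearMap.proj_apply, LinearMap.restrictScalars_apply, LinearMap.lsmul_apply]
  rw [show (e.restrictScalars F).symm (e (Ideal.Quotient.mk _ x)) = Ideal.Quotient.mk _ x from
    e.symm_apply_apply _, ← Pi.smul_apply, ← map_smul]
  rw [Algebra.coe_lmul_eq_mul, LinearMap.mul_apply', ← map_mul, ← Algebra.smul_def]
  rfl

end Polynomial

/-- Squares in a finite ring of odd prime characteristic are detected by the residue fields. -/
theorem isSquare_of_forall_isMaximal {S : Type*} [CommRing S] [Finite S] (p : ℕ) [Fact p.Prime]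
    (hp : p ≠ 2) [CharP S p] {t : S} (ht : IsUnit t)
    (h : ∀ M : Ideal S, M.IsMaximal → IsSquare (Ideal.Quotient.mk M t)) : IsSquare t := by
  choose y hy using fun M : MaximalSpectrum S ↦ h M.1 M.2
  obtain ⟨z, hz⟩ := (IsArtinianRing.quotNilradicalEquivPi S).surjective y
  obtain ⟨z, rfl⟩ := Ideal.Quotient.mk_surjective z
  have hzt : z * z - t ∈ nilradical S := by
    rw [← Ideal.Quotient.eq, ← (IsArtinianRing.quotNilradicalEquivPi S).injective.eq_iff, map_mul,
      map_mul, hz]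
    ext M
    rw [Pi.mul_apply, ← hy]
    rfl
  obtain ⟨n, hn⟩ := hzt
  have hpp : p.Prime := Fact.out
  -- A square root modulo nilpotents becomes exact after raising to the power p^n = 2m + 1; dividing
  -- by the square t^(2m) gives t itself.
  have key : (z * z) ^ p ^ n = t ^ p ^ n := by
    have : (z * z - t) ^ p ^ n = 0 := pow_eq_zero_of_le (Nat.lt_pow_self hpp.one_lt).le hn
    rwa [sub_pow_char_pow, sub_eq_zero] at this
  obtain ⟨m, hm⟩ : Odd (p ^ n) := (hpp.odd_of_ne_two hp).pow
  have hu : t * (t ^ m * t ^ m) = (z ^ p ^ n) * (z ^ p ^ n) := by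
    rw [← mul_pow z z, key, hm]
    ring
  obtain ⟨u, rfl⟩ := ht
  refine ⟨z ^ p ^ n * ↑(u⁻¹ ^ m), ?_⟩
  rw [mul_mul_mul_comm, ← hu, mul_assoc, ← Units.val_pow_eq_pow_val, ← Units.val_mul,
    ← Units.val_mul, ← Units.val_mul, ← Units.val_mul]
  congr 1
  rw [mul_mul_mul_comm]
  simp

namespace Polynomial

variable {F S ι : Type*} [Field F] [CommRing S] [IsDomain S] [Algebra F[X] S] [Algebra F S]
  [IsScalarTower F F[X] S]

omit [IsDomain S] [Algebra F S] [IsScalarTower F F[X] S] in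
-- Modulo X the matrix of multiplication is the identity.
theorem coeff_zero_norm_one_add_X_mul [Fintype ι] (b : Module.Basis ι F[X] S) (x : S) :
    (Algebra.norm F[X] (1 + algebraMap F[X] S X * x)).coeff 0 = 1 := by
  classical
  rw [Algebra.norm_eq_matrix_det b, coeff_zero_eq_eval_zero, ← coe_evalRingHom, RingHom.map_det,
    map_add, map_one, ← Algebra.smul_def, map_smul]
  have : (evalRingHom (0 : F)).mapMatrix (1 + (X : F[X]) • Algebra.leftMulMatrix b x) = 1 := by
    ext i j
    simp [Matrix.one_apply, apply_ite]
  rw [this, Matrix.det_one]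

theorem finite_quotient_span [Finite F] [Finite ι] (b : Module.Basis ι F[X] S) {f : S}
    (hf : f ≠ 0) : Module.Finite F (S ⧸ Ideal.span {f}) :=
  have hI : Ideal.span {f} ≠ ⊥ := Ideal.span_singleton_eq_bot.not.2 hf
  Module.Finite.equiv ((Ideal.quotientEquivPiSpan _ b hI).restrictScalars F).symm

/-- Let a = 1 + Xx. X is a unit modulo a and a square in each residue field, hence a square modulo
a. Its norm to F is therefore a square, and it is also (-1)^deg divided by the leading coefficient
of N(a), because N(a) has constant term 1. -/
theorem isSquare_leadingCoeff_norm [Finite F] (p : ℕ) [Fact p.Prime] (hp : p ≠ 2) [CharP F p]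
    [Finite ι] (b : Module.Basis ι F[X] S) {x : S} (h0 : 1 + algebraMap F[X] S X * x ≠ 0)
    (h : ∀ M : Ideal S, M.IsMaximal → 1 + algebraMap F[X] S X * x ∈ M →
      IsSquare (Ideal.Quotient.mk M (algebraMap F[X] S X))) :
    IsSquare ((-1) ^ (Algebra.norm F[X] (1 + algebraMap F[X] S X * x)).natDegree *
      (Algebra.norm F[X] (1 + algebraMap F[X] S X * x)).leadingCoeff) := by
  have := Fintype.ofFinite ι
  set a := 1 + algebraMap F[X] S X * x with ha
  have := finite_quotient_span b h0
  have : Finite (S ⧸ Ideal.span {a}) := Module.finite_of_finite F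
  have hsq : IsSquare (Ideal.Quotient.mk (Ideal.span {a}) (algebraMap F[X] S X)) := by
    cases subsingleton_or_nontrivial (S ⧸ Ideal.span {a})
    · exact ⟨0, Subsingleton.elim _ _⟩
    have : CharP (S ⧸ Ideal.span {a}) p :=
      charP_of_injective_algebraMap (algebraMap F (S ⧸ Ideal.span {a})).injective p
    refine isSquare_of_forall_isMaximal p hp ?_ fun M hM ↦ ?_
    · refine IsUnit.of_mul_eq_one (Ideal.Quotient.mk _ (-x)) ?_
      rw [← map_mul, ← map_one (Ideal.Quotient.mk (Ideal.span {a})), Ideal.Quotient.eq,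
        Ideal.mem_span_singleton]
      exact ⟨-1, by rw [ha]; ring⟩
    · have hM' := Ideal.comap_isMaximal_of_surjective (Ideal.Quotient.mk (Ideal.span {a}))
        Ideal.Quotient.mk_surjective (K := M)
      have haM : a ∈ M.comap (Ideal.Quotient.mk (Ideal.span {a})) := by
        rw [Ideal.mem_comap, Ideal.Quotient.eq_zero_iff_mem.mpr (Ideal.mem_span_singleton_self a)]
        exact M.zero_mem
      obtain ⟨y, hy⟩ := h _ hM' haM
      obtain ⟨y, rfl⟩ := Ideal.Quotient.mk_surjective y
      refine ⟨Ideal.Quotient.mk M (Ideal.Quotient.mk _ y), ?_⟩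
      rw [← map_mul, Ideal.Quotient.eq] at hy ⊢
      rwa [Ideal.mem_comap, map_sub, map_mul] at hy
  obtain ⟨y, hy⟩ := hsq
  have hn := norm_X_quotient_span b h0
  rw [hy, map_mul, normX, coeff_zero_norm_one_add_X_mul b, mul_one] at hn
  have hl : (Algebra.norm F[X] a).leadingCoeff ≠ 0 :=
    leadingCoeff_ne_zero.mpr (Algebra.norm_ne_zero_iff_of_basis b |>.mpr h0)
  refine ⟨Algebra.norm F y * (Algebra.norm F[X] a).leadingCoeff, ?_⟩
  rw [mul_mul_mul_comm, hn]
  field_simp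

end Polynomial

/-! ### Norms of uniformizers in extensions of discrete valuation rings -/

namespace IsLocalRing

open Module

variable {O V ι : Type*} [CommRing O] [IsDomain O] [IsLocalRing O] [CommRing V] [IsDomain V]
  [IsLocalRing V] [Algebra O V] [IsLocalHom (algebraMap O V)]
  [Fintype ι] {s : O} {ϖ : V} (ε : Basis ι (ResidueField O) (ResidueField V)) {ε' : ι → V}
  {n : ℕ} {δ : Vˣ}

omit [IsDomain O] [IsDomain V] in
include ε in
theorem dvd_of_dvd_sum_smul (hs : maximalIdeal O = Ideal.span {s})
    (hϖ : maximalIdeal V = Ideal.span {ϖ}) (hε : ∀ i, residue V (ε' i) = ε i) {r : ι → O}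
    (h : ϖ ∣ ∑ i, r i • ε' i) (i : ι) : s ∣ r i := by
  rw [← Ideal.mem_span_singleton, ← hϖ, ← residue_eq_zero_iff, map_sum] at h
  have h' : ∑ i, residue O (r i) • ε i = 0 := by
    rw [← h]
    refine Finset.sum_congr rfl fun i _ ↦ ?_
    rw [← hε, Algebra.smul_def, Algebra.smul_def, map_mul]
    rfl
  have := Fintype.linearIndependent_iff.mp ε.linearIndependent _ h' i
  rwa [residue_eq_zero_iff, hs, Ideal.mem_span_singleton] at this

omit [IsDomain O] in
include ε in
-- Induction on the exponent m, modulo ϖ^(m+1): coefficients of smaller exponents are divisible by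
-- s, hence their terms by ϖ^(n+1), and larger exponents do not contribute.
theorem dvd_of_sum_smul_eq_zero (hs : maximalIdeal O = Ideal.span {s})
    (hϖ : maximalIdeal V = Ideal.span {ϖ}) (hϖ0 : ϖ ≠ 0)
    (hδ : ϖ ^ (n + 1) = δ * algebraMap O V s) (hε : ∀ i, residue V (ε' i) = ε i)
    {r : ι × Fin (n + 1) → O} (h : ∑ x, r x • (ε' x.1 * ϖ ^ (x.2 : ℕ)) = 0) (x) : s ∣ r x := by
  suffices H : ∀ m : ℕ, ∀ (hm : m < n + 1) (i : ι), s ∣ r (i, ⟨m, hm⟩) from H x.2 x.2.2 x.1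
  intro m
  induction m using Nat.strong_induction_on with
  | _ m ih =>
    intro hm
    refine dvd_of_dvd_sum_smul ε hs hϖ hε ?_
    rw [← mul_dvd_mul_iff_right (pow_ne_zero m hϖ0), ← pow_succ', Finset.sum_mul]
    rw [Fintype.sum_prod_type_right, ← Finset.add_sum_erase _ _ (Finset.mem_univ (⟨m, hm⟩ : Fin _)),
      add_eq_zero_iff_eq_neg] at h
    simp_rw [smul_mul_assoc]
    rw [h]
    refine dvd_neg.mpr (Finset.dvd_sum fun j hj ↦ Finset.dvd_sum fun i _ ↦ ?_)
    rcases lt_trichotomy (j : ℕ) m with hjm | hjm | hjm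
    · obtain ⟨c, hc⟩ := ih j hjm j.2 i
      refine (pow_dvd_pow ϖ hm).trans ?_
      rw [hδ, Fin.eta] at *
      rw [hc, Algebra.smul_def, map_mul, mul_assoc, δ.isUnit.mul_left_dvd]
      exact dvd_mul_right _ _
    · exact absurd (Fin.ext hjm) (Finset.ne_of_mem_erase hj)
    · rw [Algebra.smul_def, ← mul_assoc]
      exact (pow_dvd_pow ϖ hjm).mul_left _

include ε in
-- The coefficients of a relation are divisible by s, and the quotients satisfy the same relation;
-- so they are divisible by all powers of s.
theorem linearIndependent_mul_pow [IsNoetherianRing O] [FaithfulSMul O V]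
    (hs : maximalIdeal O = Ideal.span {s})
    (hϖ : maximalIdeal V = Ideal.span {ϖ}) (hϖ0 : ϖ ≠ 0)
    (hδ : ϖ ^ (n + 1) = δ * algebraMap O V s) (hε : ∀ i, residue V (ε' i) = ε i) :
    LinearIndependent O fun x : ι × Fin (n + 1) ↦ ε' x.1 * ϖ ^ (x.2 : ℕ) := by
  have hs0 : algebraMap O V s ≠ 0 := by
    intro h
    rw [h, mul_zero] at hδ
    exact pow_ne_zero _ hϖ0 hδ
  rw [Fintype.linearIndependent_iff]
  intro r hr x
  by_contra hx
  have hsu : ¬IsUnit s := by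
    rw [← mem_nonunits_iff, ← mem_maximalIdeal, hs]
    exact Ideal.mem_span_singleton_self s
  obtain ⟨N, hN⟩ := FiniteMultiplicity.of_not_isUnit hsu hx
  refine hN ?_
  clear hN hx
  revert x
  induction N + 1 with
  | zero => simp
  | succ N ih =>
    choose c hc using ih
    have : ∑ x, c x • (ε' x.1 * ϖ ^ (x.2 : ℕ)) = 0 := by
      refine (mul_eq_zero_iff_left (pow_ne_zero N hs0)).mp ?_
      rw [← hr, Finset.mul_sum]
      refine Finset.sum_congr rfl fun x _ ↦ ?_
      rw [hc x, Algebra.smul_def, Algebra.smul_def (s ^ N * c x), map_mul, map_pow, mul_assoc]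
    intro x
    rw [hc x, pow_succ]
    exact mul_dvd_mul_left _ (dvd_of_sum_smul_eq_zero ε hs hϖ hϖ0 hδ hε this x)

omit [IsDomain O] [IsDomain V] in
include ε in
-- Successive approximation modulo ϖ up to ϖ^(n+1), which is s up to a unit; then Nakayama.
theorem span_mul_pow_eq_top [Module.Finite O V]
    (hϖ : maximalIdeal V = Ideal.span {ϖ})
    (hs : s ∈ maximalIdeal O)
    (hδ : ϖ ^ (n + 1) = δ * algebraMap O V s) (hε : ∀ i, residue V (ε' i) = ε i) :
    ⊤ ≤ Submodule.span O (Set.range fun x : ι × Fin (n + 1) ↦ ε' x.1 * ϖ ^ (x.2 : ℕ)) := by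
  set N := Submodule.span O (Set.range fun x : ι × Fin (n + 1) ↦ ε' x.1 * ϖ ^ (x.2 : ℕ))
  have approx (v : V) : ∃ r : ι → O, ϖ ∣ v - ∑ i, r i • ε' i := by
    choose r hr using fun i ↦ residue_surjective (ε.repr (residue V v) i)
    refine ⟨r, ?_⟩
    rw [← Ideal.mem_span_singleton, ← hϖ, ← residue_eq_zero_iff, map_sub, sub_eq_zero, map_sum]
    conv_lhs => rw [← ε.sum_repr (residue V v)]
    refine Finset.sum_congr rfl fun i _ ↦ ?_
    rw [← hε, ← hr, Algebra.smul_def, Algebra.smul_def, map_mul]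
    rfl
  have key (m : ℕ) (hm : m ≤ n + 1) (v : V) : ∃ x ∈ N, ϖ ^ m ∣ v - x := by
    induction m with
    | zero => exact ⟨0, N.zero_mem, by simp⟩
    | succ m ih =>
      obtain ⟨x, hx, w, hw⟩ := ih (by omega)
      obtain ⟨r, u, hu⟩ := approx w
      refine ⟨x + ∑ i, r i • (ε' i * ϖ ^ m), N.add_mem hx (N.sum_mem fun i _ ↦ N.smul_mem _
        (Submodule.subset_span ⟨(i, ⟨m, hm⟩), rfl⟩)), u, ?_⟩
      simp_rw [← smul_mul_assoc]
      rw [← sub_sub, hw, ← Finset.sum_mul, sub_eq_iff_eq_add.mp hu]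
      ring
  refine Submodule.le_of_le_smul_of_le_jacobson_bot (I := maximalIdeal O) Module.Finite.fg_top
    (maximalIdeal_le_jacobson ⊥) fun v _ ↦ ?_
  obtain ⟨x, hx, w, hw⟩ := key (n + 1) le_rfl v
  refine Submodule.mem_sup.mpr ⟨x, hx, s • (δ * w), Submodule.smul_mem_smul hs trivial, ?_⟩
  rw [Algebra.smul_def, ← mul_assoc, mul_comm (algebraMap O V s), ← hδ, ← hw]
  ring

/-- The norm of a uniformizer of a finite extension of discrete valuation rings. -/
theorem exists_norm_uniformizer_eq [IsNoetherianRing O] [FaithfulSMul O V] [Module.Finite O V]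
    (hs : maximalIdeal O = Ideal.span {s})
    (hϖ : maximalIdeal V = Ideal.span {ϖ}) (hϖ0 : ϖ ≠ 0)
    (hδ : ϖ ^ (n + 1) = δ * algebraMap O V s) :
    ∃ d : O, residue O d = Algebra.norm (ResidueField O) (residue V δ) ∧
      Algebra.norm O ϖ = (-1) ^ (n * finrank (ResidueField O) (ResidueField V)) *
        s ^ finrank (ResidueField O) (ResidueField V) * d := by
  classical
  let ε := finBasis (ResidueField O) (ResidueField V)
  set f := finrank (ResidueField O) (ResidueField V)
  choose ε' hε using fun i ↦ residue_surjective (ε i)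
  let b := Basis.mk (linearIndependent_mul_pow ε hs hϖ hϖ0 hδ hε)
    (span_mul_pow_eq_top ε hϖ (by rw [hs]; exact Ideal.mem_span_singleton_self s) hδ hε)
  have hb (x) : b x = ε' x.1 * ϖ ^ (x.2 : ℕ) := Basis.mk_apply ..
  let σ : Equiv.Perm (Fin f × Fin (n + 1)) := Equiv.prodCongrRight fun _ ↦ finRotate (n + 1)
  let τ : V →ₗ[O] V := b.constr O (b ∘ σ)
  let S : V →ₗ[O] V := b.constr O fun x ↦ (if x.2 = 0 then s else 1) • b x
  let C : V →ₗ[O] V := b.constr O fun x ↦ if x.2 = 0 then δ * ε' x.1 else b x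
  -- Multiplication by ϖ shifts the exponent, and the last power wraps around as ϖ^(n+1) = δs: a
  -- cyclic permutation τ, then s (in S) and δ (in C) on the vectors of exponent 0. The f cycles of
  -- length n + 1 give the sign.
  have hmul : Algebra.lmul O V ϖ = C ∘ₗ S ∘ₗ τ := by
    refine b.ext fun ⟨i, j⟩ ↦ ?_
    rw [LinearMap.comp_apply, LinearMap.comp_apply, Basis.constr_basis, Function.comp_apply,
      Basis.constr_basis, map_smul, Basis.constr_basis]
    change ϖ * b (i, j) = (if finRotate (n + 1) j = 0 then s else 1) •
      (if finRotate (n + 1) j = 0 then δ * ε' i else b (i, finRotate (n + 1) j))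
    rw [hb, finRotate_apply]
    rcases Fin.eq_castSucc_or_eq_last j with ⟨j, rfl⟩ | rfl
    · have : j.castSucc + 1 ≠ 0 := by
        rw [Fin.coeSucc_eq_succ]
        exact Fin.succ_ne_zero j
      rw [if_neg this, if_neg this, one_smul, hb, Fin.coeSucc_eq_succ]
      simp only [Fin.val_castSucc, Fin.val_succ, pow_succ]
      ring
    · rw [Fin.last_add_one, if_pos rfl, if_pos rfl, Algebra.smul_def,
        show algebraMap O V s * (δ * ε' i) = ε' i * (δ * algebraMap O V s) by ring, ← hδ]
      simp only [Fin.val_last, pow_succ]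
      ring
  have hτ : LinearMap.det τ = (-1) ^ (n * f) := by
    have h := b.det_comp τ b
    rw [b.det_self, mul_one] at h
    rw [← h, show τ ∘ b = b ∘ σ from funext fun x ↦ b.constr_basis O _ x, AlternatingMap.map_perm,
      b.det_self, Equiv.Perm.sign_prodCongrRight, sign_finRotate]
    simp [pow_mul, Units.smul_def]
  have hS : LinearMap.det S = s ^ f := by
    have : LinearMap.toMatrix b b S = Matrix.diagonal fun x ↦ if x.2 = 0 then s else 1 := by
      ext x y
      rw [LinearMap.toMatrix_apply, Basis.constr_basis, map_smul, Basis.repr_self,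
        Finsupp.smul_single, smul_eq_mul, mul_one, Matrix.diagonal_apply, Finsupp.single_apply]
      by_cases h : x = y
      · subst h; simp
      · rw [if_neg h, if_neg (Ne.symm h)]
    rw [← LinearMap.det_toMatrix b, this, Matrix.det_diagonal, Fintype.prod_prod_type]
    simp
  refine ⟨LinearMap.det C, ?_, ?_⟩
  · have hCM (x y) : LinearMap.toMatrix b b C x y =
        if y.2 = 0 then b.repr (δ * ε' y.1) x else if y = x then 1 else 0 := by
      rw [LinearMap.toMatrix_apply, Basis.constr_basis]
      split_ifs with h1 h2
      · rfl
      · rw [Basis.repr_self, h2, Finsupp.single_eq_same]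
      · rw [Basis.repr_self, Finsupp.single_apply, if_neg ‹_›]
    -- C fixes the basis vectors of nonzero exponent, so only the block of exponent 0 counts; it
    -- reduces to multiplication by the residue of δ in the basis ε.
    rw [← LinearMap.det_toMatrix b, Matrix.twoBlockTriangular_det _ (fun x ↦ x.2 ≠ 0)]
    · have h1 : (LinearMap.toMatrix b b C).toSquareBlockProp (fun x ↦ x.2 ≠ 0) = 1 := by
        ext x y
        rw [Matrix.toSquareBlockProp_def, Matrix.of_apply, hCM, if_neg y.2, Matrix.one_apply]
        simp only [Subtype.ext_iff, eq_comm]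
      rw [h1, Matrix.det_one, one_mul]
      let e : {x : Fin f × Fin (n + 1) // ¬x.2 ≠ 0} ≃ Fin f :=
        { toFun x := x.1.1
          invFun i := ⟨(i, 0), by simp⟩
          left_inv := fun ⟨⟨i, j⟩, h⟩ ↦ by
            obtain rfl : j = 0 := not_not.mp h
            rfl
          right_inv _ := rfl }
      rw [← Matrix.det_submatrix_equiv_self e.symm, RingHom.map_det, Algebra.norm_eq_matrix_det ε]
      congr 1
      ext i l
      rw [RingHom.mapMatrix_apply, Matrix.map_apply, Matrix.submatrix_apply,
        Matrix.toSquareBlockProp_def, Matrix.of_apply, hCM,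
        Algebra.leftMulMatrix_eq_repr_mul]
      change residue O (b.repr (δ * ε' l) (i, 0)) = _
      have h2 : residue V δ * ε l = ∑ i, residue O (b.repr (δ * ε' l) (i, 0)) • ε i := by
        rw [← hε, ← map_mul]
        conv_lhs => rw [← b.sum_repr (δ * ε' l)]
        rw [map_sum, Fintype.sum_prod_type]
        refine Finset.sum_congr rfl fun i _ ↦ ?_
        rw [Finset.sum_eq_single 0]
        · rw [hb, Algebra.smul_def, Algebra.smul_def, (residue V).map_mul,
            (residue V).map_mul (ε' i), hε]
          simp only [Fin.val_zero, pow_zero, map_one, mul_one]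
          rfl
        · intro j _ hj
          obtain ⟨j, rfl⟩ := Fin.exists_succ_eq.mpr hj
          rw [hb, Algebra.smul_def, residue_eq_zero_iff, hϖ, Ideal.mem_span_singleton]
          exact ((dvd_pow_self ϖ (by simp)).mul_left _).mul_left _
        · simp
      rw [h2, ε.repr_sum_self]
    · intro x hx y hy
      rw [hCM, if_neg hy, if_neg]
      rintro rfl
      exact hx hy
  · rw [Algebra.norm_apply, hmul, LinearMap.det_comp, LinearMap.det_comp, hτ, hS]
    ring

end IsLocalRing

/-- Euler's criterion: N(x) is x to the power (q' - 1)/(q - 1), so N(x)^((q-1)/2) = x^((q'-1)/2). -/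
theorem FiniteField.isSquare_of_isSquare_norm {K K' : Type*} [Field K] [Field K'] [Algebra K K']
    [Finite K'] (hK : ringChar K ≠ 2) {x : K'} (h : IsSquare (Algebra.norm K x)) :
    IsSquare x := by
  classical
  have := Finite.of_injective _ (algebraMap K K').injective
  have := Fintype.ofFinite K
  have := Fintype.ofFinite K'
  by_cases hx : x = 0
  · exact ⟨0, by simp [hx]⟩
  have hK' : ringChar K' ≠ 2 := by rwa [← Algebra.ringChar_eq K K']
  rw [FiniteField.isSquare_iff hK (Algebra.norm_ne_zero_iff.mpr hx)] at h
  rw [FiniteField.isSquare_iff hK' hx]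
  have h' := congr_arg (algebraMap K K') h
  rw [map_pow, FiniteField.algebraMap_norm_eq_pow, map_one, ← pow_mul, Nat.card_eq_fintype_card,
    Nat.card_eq_fintype_card] at h'
  rw [← h']
  congr 1
  have h1 := FiniteField.odd_card_of_char_ne_two hK
  have h2 := FiniteField.odd_card_of_char_ne_two hK'
  have hd : Fintype.card K - 1 ∣ Fintype.card K' - 1 := by
    rw [Module.card_eq_pow_finrank (K := K) (V := K')]
    exact Nat.sub_one_dvd_pow_sub_one _ _
  obtain ⟨c, hc⟩ := hd
  have h3 : 1 < Fintype.card K := Fintype.one_lt_card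
  rw [hc, Nat.mul_div_cancel_left _ (by omega)]
  obtain ⟨a, ha⟩ := Nat.odd_iff.mpr h1
  obtain ⟨b, hb⟩ := Nat.odd_iff.mpr h2
  rw [ha, hb, Nat.add_sub_cancel, Nat.add_sub_cancel] at hc
  rw [ha, hb]
  have : b = a * c := by
    rw [mul_assoc] at hc
    exact Nat.eq_of_mul_eq_mul_left two_pos hc
  rw [show (2 * b + 1) / 2 = b by omega, show (2 * a + 1) / 2 = a by omega, this, mul_comm]

/-! ### Leading terms at infinity and reciprocity -/

namespace IsLocalRing

open Module

/-- For a uniformizer `s` of a local ring `O`, the elements `u * s ^ n` with `u` a unit such that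
`(-1) ^ n * u` is a square modulo `s`. -/
def SignSquare {O F : Type*} [CommRing O] [IsLocalRing O] [Field F] [Algebra O F] (s : O)
    (r : F) : Prop :=
  ∃ (n : ℤ) (u : O), r = algebraMap O F s ^ n * algebraMap O F u ∧ residue O u ≠ 0 ∧
    IsSquare ((-1) ^ n * residue O u)

section SignSquare

variable {O F : Type*} [CommRing O] [IsLocalRing O] [Field F] [Algebra O F] {s : O}

theorem SignSquare.mul {r r' : F} (hs : algebraMap O F s ≠ 0) (h : SignSquare s r)
    (h' : SignSquare s r') : SignSquare s (r * r') := by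
  obtain ⟨n, u, rfl, hu, hn⟩ := h
  obtain ⟨m, v, rfl, hv, hm⟩ := h'
  refine ⟨n + m, u * v, ?_, ?_, ?_⟩
  · rw [zpow_add₀ hs, map_mul]
    ring
  · rw [map_mul]
    exact mul_ne_zero hu hv
  · rw [zpow_add₀ (neg_ne_zero.mpr one_ne_zero), map_mul, mul_mul_mul_comm]
    exact hn.mul hm

theorem SignSquare.inv {r : F} (h : SignSquare s r) : SignSquare s r⁻¹ := by
  obtain ⟨n, u, rfl, hu, hn⟩ := h
  obtain ⟨u, rfl⟩ := residue_ne_zero_iff_isUnit _ |>.mp hu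
  have hr : residue O ↑u⁻¹ = (residue O u)⁻¹ := by
    refine eq_inv_of_mul_eq_one_left ?_
    rw [← map_mul, Units.inv_mul, map_one]
  refine ⟨-n, ↑u⁻¹, ?_, ?_, ?_⟩
  · rw [mul_inv, zpow_neg]
    congr 1
    refine inv_eq_of_mul_eq_one_right ?_
    rw [← map_mul, Units.mul_inv, map_one]
  · rw [hr]
    exact inv_ne_zero hu
  · rw [hr, zpow_neg, ← mul_inv]
    exact hn.inv

theorem eq_of_zpow_mul_eq (hF : Function.Injective (algebraMap O F)) (hs : s ∈ maximalIdeal O)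
    (hs0 : s ≠ 0) {m n : ℤ} {u v : O}
    (hu : IsUnit u) (hv : IsUnit v)
    (h : algebraMap O F s ^ m * algebraMap O F u = algebraMap O F s ^ n * algebraMap O F v) :
    m = n ∧ u = v := by
  have hs' : algebraMap O F s ≠ 0 := (map_ne_zero_iff _ hF).mpr hs0
  have le {m n : ℤ} {u v : O} (hv : IsUnit v)
      (h : algebraMap O F s ^ m * algebraMap O F u = algebraMap O F s ^ n * algebraMap O F v) :
      m ≤ n := by
    by_contra! hmn
    obtain ⟨d, hd⟩ := Int.le.dest (Int.add_one_le_of_lt hmn)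
    rw [← hd, add_assoc, zpow_add₀ hs', mul_assoc] at h
    have := mul_left_cancel₀ (zpow_ne_zero n hs') h
    rw [add_comm, zpow_add_one₀ hs', zpow_natCast, ← map_pow, ← map_mul, ← map_mul, hF.eq_iff] at this
    rw [← this] at hv
    exact (mem_maximalIdeal _).mp hs
      (isUnit_of_mul_isUnit_right (isUnit_of_mul_isUnit_left hv))
  obtain rfl := le_antisymm (le hv h) (le hu h.symm)
  exact ⟨rfl, hF (mul_left_cancel₀ (zpow_ne_zero m hs') h)⟩

theorem SignSquare.isSquare (hF : Function.Injective (algebraMap O F)) (hs : s ∈ maximalIdeal O)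
    (hs0 : s ≠ 0) {m : ℤ} {u : O} (hu : IsUnit u)
    (h : SignSquare s (algebraMap O F s ^ m * algebraMap O F u)) :
    IsSquare ((-1) ^ m * residue O u) := by
  obtain ⟨n, v, hv, hv0, h⟩ := h
  obtain ⟨rfl, rfl⟩ := eq_of_zpow_mul_eq hF hs hs0 hu (residue_ne_zero_iff_isUnit _ |>.mp hv0) hv
  exact h

open Polynomial in
/-- The behaviour at infinity of a polynomial is governed by its leading term. -/
theorem exists_algebraMap_eq_zpow_mul {k : Type*} [Field k] [Algebra k[X] F] (c : k →+* O)
    (hc : ∀ a, algebraMap O F (c a) = algebraMap k[X] F (C a)) (hs : s ∈ maximalIdeal O)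
    (hsX : algebraMap O F s * algebraMap k[X] F X = 1) (P : k[X]) :
    ∃ u : O, algebraMap k[X] F P = algebraMap O F s ^ (-(P.natDegree : ℤ)) * algebraMap O F u ∧
      residue O u = residue O (c P.leadingCoeff) := by
  -- P is X^deg times its reverse evaluated at s = 1/X; the constant term of the reverse is the
  -- leading coefficient.
  refine ⟨P.reverse.eval₂ c s, ?_, ?_⟩
  · have hX : algebraMap k[X] F X ≠ 0 := right_ne_zero_of_mul_eq_one hsX
    let _ := invertibleOfNonzero hX
    have h := eval₂_reverse_mul_pow ((algebraMap k[X] F).comp C) (algebraMap k[X] F X) P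
    rw [← hom_eval₂, eval₂_C_X] at h
    rw [← h, zpow_neg, zpow_natCast, ← inv_pow, ← eq_inv_of_mul_eq_one_right hsX, mul_comm,
      hom_eval₂, show (algebraMap O F).comp c = (algebraMap k[X] F).comp C from RingHom.ext hc,
      eq_inv_of_mul_eq_one_left hsX, invOf_eq_inv]
  · rw [hom_eval₂, (residue_eq_zero_iff s).mpr hs, eval₂_at_zero, coeff_zero_reverse]
    rfl

end SignSquare

section Norm

variable {O V F : Type*} [CommRing O] [IsDomain O] [IsLocalRing O] [CommRing V] [IsDomain V]
  [IsDiscreteValuationRing V] [Algebra O V] [IsLocalHom (algebraMap O V)] [IsNoetherianRing O]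
  [FaithfulSMul O V] [Module.Finite O V] {s : O}

omit [IsDomain O] [IsNoetherianRing O] [Module.Finite O V] in
theorem exists_pow_uniformizer_eq (hs : s ∈ maximalIdeal O) (hs0 : s ≠ 0) {ϖ : V}
    (hϖ : Irreducible ϖ) : ∃ (n : ℕ) (δ : Vˣ), ϖ ^ (n + 1) = δ * algebraMap O V s := by
  have hs0' : algebraMap O V s ≠ 0 := (map_ne_zero_iff _ (FaithfulSMul.algebraMap_injective O V)).mpr hs0
  obtain ⟨n, hn⟩ := IsDiscreteValuationRing.associated_pow_irreducible hs0' hϖ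
  obtain ⟨δ, hδ⟩ := hn
  cases n with
  | zero =>
    rw [pow_zero] at hδ
    exact absurd (isUnit_of_map_unit (algebraMap O V) s (IsUnit.of_mul_eq_one _ hδ))
      ((mem_maximalIdeal _).mp hs)
  | succ n => exact ⟨n, δ, by rw [← hδ, mul_comm]⟩

/-- Compare the norms of the uniformizers ϖ and ϖ(1 + z): the units δ and δ(1 + z)^(n+1) have the
same residue, so the two norms have the same leading term. -/
theorem residue_norm_one_add (hs : maximalIdeal O = Ideal.span {s}) (hs0 : s ≠ 0) {z : V}
    (hz : z ∈ maximalIdeal V) : residue O (Algebra.norm O (1 + z)) = 1 := by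
  obtain ⟨ϖ, hϖ⟩ := IsDiscreteValuationRing.exists_irreducible V
  have hsm : s ∈ maximalIdeal O := hs ▸ Ideal.mem_span_singleton_self s
  obtain ⟨n, δ, hδ⟩ := exists_pow_uniformizer_eq hsm hs0 hϖ
  have hu : IsUnit (1 + z) := by
    rw [← residue_ne_zero_iff_isUnit, map_add, (residue_eq_zero_iff z).mpr hz]
    simp
  obtain ⟨d, hd, h⟩ := exists_norm_uniformizer_eq hs hϖ.maximalIdeal_eq hϖ.ne_zero hδ
  have hϖ' : Irreducible (ϖ * (1 + z)) := (irreducible_mul_isUnit hu).mpr hϖ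
  have hδ' : (ϖ * (1 + z)) ^ (n + 1) = ↑(δ * hu.unit ^ (n + 1)) * algebraMap O V s := by
    rw [mul_pow, hδ]
    simp only [Units.val_mul, Units.val_pow_eq_pow_val, IsUnit.unit_spec]
    ring
  obtain ⟨d', hd', h'⟩ := exists_norm_uniformizer_eq hs hϖ'.maximalIdeal_eq hϖ'.ne_zero hδ'
  have hdd : residue O d' = residue O d := by
    rw [hd, hd']
    congr 1
    simp [(residue_eq_zero_iff z).mpr hz]
  have hd0 : residue O d ≠ 0 := by
    rw [hd]
    exact Algebra.norm_ne_zero_iff.mpr (residue_ne_zero_iff_isUnit _ |>.mpr δ.isUnit)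
  rw [map_mul, h, mul_assoc] at h'
  have hne : ((-1) ^ (n * finrank (ResidueField O) (ResidueField V)) *
      s ^ finrank (ResidueField O) (ResidueField V) : O) ≠ 0 :=
    mul_ne_zero (pow_ne_zero _ (neg_ne_zero.mpr one_ne_zero)) (pow_ne_zero _ hs0)
  have := congr_arg (residue O) (mul_left_cancel₀ hne h')
  rw [map_mul, hdd] at this
  exact mul_left_cancel₀ hd0 (this.trans (mul_one _).symm)

/-- If the norms of all uniformizers are squares up to sign, then the uniformizer of the base is,
up to squares and principal units, an even power of a uniformizer. -/
theorem exists_even_isSquare_residue [Field F] [Algebra O F] [FaithfulSMul O F]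
    [Finite (ResidueField O)] (hchar : ringChar (ResidueField O) ≠ 2)
    (hs : maximalIdeal O = Ideal.span {s}) (hs0 : s ≠ 0)
    (h : ∀ ϖ : V, Irreducible ϖ → SignSquare s (algebraMap O F (Algebra.norm O ϖ))) :
    ∃ (ϖ : V) (m : ℕ) (δ : Vˣ), ϖ ≠ 0 ∧ (ϖ ^ m) ^ 2 = δ * algebraMap O V s ∧
      IsSquare (residue V δ) := by
  have : Finite (ResidueField V) := Module.finite_of_finite (ResidueField O)
  have hchar' : ringChar (ResidueField V) ≠ 2 := by
    rwa [← Algebra.ringChar_eq (ResidueField O) (ResidueField V)]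
  have hsm : s ∈ maximalIdeal O := hs ▸ Ideal.mem_span_singleton_self s
  have key {ϖ : V} (hϖ : Irreducible ϖ) {n : ℕ} {δ : Vˣ} (hδ : ϖ ^ (n + 1) = δ * algebraMap O V s) :
      IsSquare ((-1) ^ ((n + 1) * finrank (ResidueField O) (ResidueField V)) *
        Algebra.norm (ResidueField O) (residue V δ)) := by
    obtain ⟨d, hd, hn⟩ := exists_norm_uniformizer_eq hs hϖ.maximalIdeal_eq hϖ.ne_zero hδ
    have hd0 : residue O d ≠ 0 := by
      rw [hd]
      exact Algebra.norm_ne_zero_iff.mpr (residue_ne_zero_iff_isUnit _ |>.mpr δ.isUnit)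
    set f := finrank (ResidueField O) (ResidueField V)
    have hsq := h ϖ hϖ
    rw [hn, mul_comm ((-1) ^ _) (s ^ f), mul_assoc, map_mul, map_pow, ← zpow_natCast] at hsq
    have := hsq.isSquare (FaithfulSMul.algebraMap_injective O F) hsm hs0
      ((isUnit_one.neg.pow _).mul (residue_ne_zero_iff_isUnit _ |>.mp hd0))
    rw [map_mul, map_pow, map_neg, map_one, zpow_natCast, ← mul_assoc, ← pow_add, hd] at this
    rwa [add_mul, one_mul, add_comm]
  obtain ⟨ϖ, hϖ⟩ := IsDiscreteValuationRing.exists_irreducible V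
  obtain ⟨n, δ, hδ⟩ := exists_pow_uniformizer_eq hsm hs0 hϖ
  have h1 := key hϖ hδ
  obtain ⟨c, hc⟩ := FiniteField.exists_nonsquare hchar'
  obtain ⟨c, rfl⟩ := residue_surjective c
  have hcu : IsUnit c := by
    rw [← residue_ne_zero_iff_isUnit]
    intro h0
    exact hc ⟨0, by rw [h0, mul_zero]⟩
  -- Replacing ϖ by cϖ with c a non-square residue multiplies δ by c^(n+1), which must then be a
  -- square. So n + 1 is even, the sign disappears, and δ itself is a square.
  have h2 := key (n := n) (δ := δ * hcu.unit ^ (n + 1)) ((irreducible_mul_isUnit hcu).mpr hϖ) (by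
    rw [mul_pow, hδ]
    simp only [Units.val_mul, Units.val_pow_eq_pow_val, IsUnit.unit_spec]
    ring)
  have hδ0 : residue V δ ≠ 0 := residue_ne_zero_iff_isUnit _ |>.mpr δ.isUnit
  have h3 : IsSquare (residue V c ^ (n + 1)) := by
    refine FiniteField.isSquare_of_isSquare_norm hchar ?_
    have := h2.div h1
    simp only [Units.val_mul, Units.val_pow_eq_pow_val, IsUnit.unit_spec, map_mul, map_pow] at this ⊢
    rw [← mul_assoc, mul_div_cancel_left₀] at this
    · exact this
    · exact mul_ne_zero (pow_ne_zero _ (neg_ne_zero.mpr one_ne_zero))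
        (Algebra.norm_ne_zero_iff.mpr hδ0)
  have hev : Even (n + 1) := by
    by_contra hodd
    obtain ⟨m, hm⟩ := Nat.not_even_iff_odd.mp hodd
    refine hc ?_
    have : IsSquare (residue V c ^ (2 * m)) := ⟨residue V c ^ m, by rw [two_mul, pow_add]⟩
    have h4 := h3.div this
    rwa [hm, pow_succ, mul_div_cancel_left₀] at h4
    exact pow_ne_zero _ (residue_ne_zero_iff_isUnit _ |>.mpr hcu)
  obtain ⟨m, hm⟩ := hev
  refine ⟨ϖ, m, δ, hϖ.ne_zero, by rw [← hδ, hm, ← pow_mul, mul_two],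
    FiniteField.isSquare_of_isSquare_norm hchar ?_⟩
  rwa [hm, add_mul, pow_add, ← mul_pow, neg_one_mul, neg_neg, one_pow, one_mul] at h1

end Norm

end IsLocalRing

namespace IsLocalRing

open Polynomial

/-- Quadratic reciprocity over a function field, in the form of an existence statement: if `X` is
not a square at infinity, then it is a non-square at some prime not dividing `π`. -/
theorem exists_isMaximal_not_isSquare {F A F' k O V : Type*} [Field F] [Finite F] (p : ℕ)
    [Fact p.Prime] (hp : p ≠ 2) [CharP F p] [CommRing A] [IsDomain A] [Algebra F[X] A]
    [Algebra F A] [IsScalarTower F F[X] A] [Module.Finite F[X] A] [Module.Free F[X] A]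
    [Field F'] [Algebra F[X] F'] [IsFractionRing F[X] F'] [Field k] [Algebra A k]
    [IsFractionRing A k] [Algebra F' k]
    [CommRing O] [IsDomain O] [IsLocalRing O] [IsNoetherianRing O] [CommRing V] [IsDomain V]
    [IsDiscreteValuationRing V] [Algebra O V] [IsLocalHom (algebraMap O V)]
    [FaithfulSMul O V] [Module.Finite O V] [Algebra O F'] [FaithfulSMul O F'] [Algebra V k]
    [FaithfulSMul V k] [Finite (ResidueField O)]
    (hnA : ∀ a : A, Algebra.norm F' (algebraMap A k a) = algebraMap F[X] F' (Algebra.norm F[X] a))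
    (hnV : ∀ v : V, Algebra.norm F' (algebraMap V k v) = algebraMap O F' (Algebra.norm O v))
    (c : F →+* O) (hc : ∀ a, algebraMap O F' (c a) = algebraMap F[X] F' (C a)) {s : O}
    (hs : maximalIdeal O = Ideal.span {s}) (hsX : algebraMap O F' s * algebraMap F[X] F' X = 1)
    (hsX' : algebraMap V k (algebraMap O V s) * algebraMap A k (algebraMap F[X] A X) = 1)
    (hA : ∀ y : A, y ≠ 0 → ¬IsUnit y →
      ∃ z ∈ maximalIdeal V, algebraMap V k z * algebraMap A k y = 1)
    (hns : ∀ y : k, ∀ z ∈ maximalIdeal V,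
      algebraMap A k (algebraMap F[X] A X) * y ^ 2 ≠ 1 + algebraMap V k z)
    {π : A} (hπ0 : π ≠ 0) (hπ : ¬IsUnit π) :
    ∃ M : Ideal A, M.IsMaximal ∧ π ∉ M ∧ algebraMap F[X] A X ∉ M ∧
      ¬IsSquare (Ideal.Quotient.mk M (algebraMap F[X] A X)) := by
  by_contra! hsq
  have hchar : ringChar (ResidueField O) ≠ 2 := by
    have : CharP (ResidueField O) p :=
      charP_of_injective_ringHom ((residue O).comp c).injective p
    rwa [ringChar.eq (ResidueField O) p]
  have hsm : s ∈ maximalIdeal O := hs ▸ Ideal.mem_span_singleton_self s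
  have hs' : algebraMap O F' s ≠ 0 := left_ne_zero_of_mul_eq_one hsX
  have hs0 : s ≠ 0 := by
    rintro rfl
    exact hs' (map_zero _)
  have hX0 : algebraMap F[X] A X ≠ 0 := by
    intro h
    rw [h, map_zero, mul_zero] at hsX'
    exact zero_ne_one hsX'
  have hinjA : Function.Injective (algebraMap A k) := IsFractionRing.injective A k
  -- The element 1 + w with w = Xy is prime to X and π, so X is a square at all its prime divisors
  -- and the norm of 1 + w is a sign-square. Now 1 + w = w(1 + 1/w), and 1 + 1/w is a principal unit
  -- at infinity.
  have h1 (y : A) (hy : π ∣ y) (hy0 : y ≠ 0) :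
      SignSquare s (Algebra.norm F' (algebraMap A k (algebraMap F[X] A X * y))) := by
    set w := algebraMap F[X] A X * y with hw
    have hw0 : w ≠ 0 := mul_ne_zero hX0 hy0
    have hπw : π ∣ w := hy.mul_left _
    have hwu : ¬IsUnit w := fun h ↦ hπ (isUnit_of_dvd_unit hπw h)
    have h1w : 1 + w ≠ 0 := by
      intro h
      refine hwu ?_
      rw [← neg_eq_of_add_eq_zero_right h]
      exact isUnit_one.neg
    have hnw : IsSquare ((-1) ^ (Algebra.norm F[X] (1 + w)).natDegree *
      (Algebra.norm F[X] (1 + w)).leadingCoeff) := by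
      refine isSquare_leadingCoeff_norm p hp (Module.Free.chooseBasis F[X] A) h1w
        fun M hM hwM ↦ hsq M hM (fun hπM ↦ ?_) (fun hXM ↦ ?_)
      · refine hM.ne_top ((Ideal.eq_top_iff_one M).mpr ?_)
        exact (M.add_mem_iff_left (Ideal.mem_of_dvd M hπw hπM)).mp hwM
      · refine hM.ne_top ((Ideal.eq_top_iff_one M).mpr ?_)
        exact (M.add_mem_iff_left (M.mul_mem_right y hXM)).mp hwM
    have hs1 : SignSquare s (Algebra.norm F' (algebraMap A k (1 + w))) := by
      obtain ⟨u, hu, hru⟩ := exists_algebraMap_eq_zpow_mul c hc hsm hsX (Algebra.norm F[X] (1 + w))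
      have hl : (Algebra.norm F[X] (1 + w)).leadingCoeff ≠ 0 :=
        leadingCoeff_ne_zero.mpr
          ((Algebra.norm_ne_zero_iff_of_basis (Module.Free.chooseBasis F[X] A)).mpr h1w)
      refine ⟨_, u, (hnA _).trans hu, ?_, ?_⟩
      · rw [hru]
        exact (map_ne_zero ((residue O).comp c)).mpr hl
      · have := hnw.map ((residue O).comp c)
        rw [map_mul, map_pow, map_neg, map_one] at this
        rw [hru, zpow_neg, zpow_natCast, ← inv_pow, inv_neg_one]
        exact this
    obtain ⟨z, hz, hzw⟩ := hA w hw0 hwu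
    have hs2 : SignSquare s (Algebra.norm F' (algebraMap V k (1 + z))) := by
      have hr := residue_norm_one_add hs hs0 hz
      refine ⟨0, Algebra.norm O (1 + z), by rw [hnV, zpow_zero, one_mul], ?_, ?_⟩
      · rw [hr]
        exact one_ne_zero
      · rw [hr, zpow_zero, mul_one]
        exact IsSquare.one
    have hw1 : Algebra.norm F' (algebraMap A k (1 + w)) =
        Algebra.norm F' (algebraMap A k w) * Algebra.norm F' (algebraMap V k (1 + z)) := by
      rw [← map_mul]
      congr 1
      rw [map_add, map_add, map_one, map_one, mul_add, mul_comm _ (algebraMap V k z), hzw]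
      ring
    have hne : Algebra.norm F' (algebraMap V k (1 + z)) ≠ 0 := by
      intro h0
      obtain ⟨n, u, hu, hu0, -⟩ := hs1
      rw [hw1, h0, mul_zero] at hu
      rcases mul_eq_zero.mp hu.symm with h | h
      · exact zpow_ne_zero n hs' h
      · rw [map_eq_zero_iff _ (FaithfulSMul.algebraMap_injective O F')] at h
        rw [h, map_zero] at hu0
        exact hu0 rfl
    rw [(eq_mul_inv_iff_mul_eq₀ hne).mpr hw1.symm]
    exact hs1.mul hs' hs2.inv
  -- The quotient of Xπx by Xπ, both covered by `h1`.
  have h2 (x : A) (hx : x ≠ 0) : SignSquare s (Algebra.norm F' (algebraMap A k x)) := by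
    have hπ1 := h1 π dvd_rfl hπ0
    have hπx := h1 (π * x) (dvd_mul_right _ _) (mul_ne_zero hπ0 hx)
    have hne : Algebra.norm F' (algebraMap A k (algebraMap F[X] A X * π)) ≠ 0 := by
      intro h0
      obtain ⟨n, u, hu, hu0, -⟩ := hπ1
      rw [h0] at hu
      rcases mul_eq_zero.mp hu.symm with h | h
      · exact zpow_ne_zero n hs' h
      · rw [map_eq_zero_iff _ (FaithfulSMul.algebraMap_injective O F')] at h
        rw [h, map_zero] at hu0
        exact hu0 rfl
    have := hπx.mul hs' hπ1.inv
    rwa [← mul_assoc, map_mul, map_mul _ (algebraMap A k _), mul_comm, inv_mul_cancel_left₀ hne] at this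
  have h3 (x : k) (hx : x ≠ 0) : SignSquare s (Algebra.norm F' x) := by
    obtain ⟨a, b, hb, rfl⟩ := IsFractionRing.div_surjective (A := A) x
    rw [div_ne_zero_iff, map_ne_zero_iff _ hinjA, map_ne_zero_iff _ hinjA] at hx
    have hinv : Algebra.norm F' (algebraMap A k b)⁻¹ = (Algebra.norm F' (algebraMap A k b))⁻¹ := by
      refine eq_inv_of_mul_eq_one_left ?_
      rw [← map_mul, inv_mul_cancel₀ ((map_ne_zero_iff _ hinjA).mpr hx.2), map_one]
    rw [div_eq_mul_inv, map_mul, hinv]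
    exact (h2 a hx.1).mul hs' (h2 b hx.2).inv
  obtain ⟨ϖ, m, δ, hϖ0, hδ, d, hd⟩ := exists_even_isSquare_residue (V := V) (F := F') hchar hs hs0
    fun ϖ hϖ ↦ by
      rw [← hnV]
      exact h3 _ ((map_ne_zero_iff _ (FaithfulSMul.algebraMap_injective V k)).mpr hϖ.ne_zero)
  obtain ⟨d, rfl⟩ := residue_surjective d
  have hdu : IsUnit d := by
    rw [← residue_ne_zero_iff_isUnit]
    intro h0
    rw [h0, mul_zero, residue_eq_zero_iff] at hd
    exact (mem_maximalIdeal _).mp hd δ.isUnit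
  obtain ⟨d, rfl⟩ := hdu
  -- As (ϖ^m)² = δs with s = 1/X and δ congruent to d², X(ϖ^m/d)² = δ/d² is a principal unit.
  refine hns (algebraMap V k (ϖ ^ m * ↑d⁻¹)) (δ * ↑d⁻¹ ^ 2 - 1) ?_ ?_
  · rw [← residue_eq_zero_iff, map_sub, map_mul, hd, map_one, sub_eq_zero, map_pow, ← pow_two,
      ← mul_pow, ← map_mul, Units.mul_inv, map_one, one_pow]
  · rw [map_mul, mul_pow, ← map_pow, hδ, map_mul, map_sub, map_mul, map_pow, map_one]
    linear_combination (algebraMap V k δ) * (algebraMap V k ↑d⁻¹) ^ 2 * hsX'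

end IsLocalRing

/-! ### Places and regular functions -/

namespace ValuationSubring

variable {R k : Type*} [CommRing R] [Field k] [Algebra R k] {x : k}

theorem mem_of_isIntegral (V : ValuationSubring k) (hR : ∀ r, algebraMap R k r ∈ V)
    (hx : IsIntegral R x) : x ∈ V := by
  let f : R →+* V := (algebraMap R k).codRestrict V.toSubring hR
  obtain ⟨P, hP, h0⟩ := hx
  have : IsIntegral V x := ⟨P.map f, hP.map f, by rw [Polynomial.eval₂_map]; exact h0⟩
  obtain ⟨y, rfl⟩ := IsIntegrallyClosed.algebraMap_eq_of_integral this
  exact y.2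

/-- The integral closure of a subring of a field is the intersection of the valuation rings
containing it. The map from R need not be injective, so a monic equation over its image is lifted to
R. -/
theorem isIntegral_iff :
    IsIntegral R x ↔ ∀ V : ValuationSubring k, (∀ r, algebraMap R k r ∈ V) → x ∈ V := by
  refine ⟨fun h V hV ↦ V.mem_of_isIntegral hV h, fun h ↦ ?_⟩
  let s : Set k := Set.range (algebraMap R k)
  have hx : x ∈ (⨅ V : {V : ValuationSubring k // s ⊆ V.toSubring}, V.1.toSubring) := by
    rw [Subring.mem_iInf]
    exact fun V ↦ h V.1 fun r ↦ V.2 ⟨r, rfl⟩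
  rw [iInf_valuationSubring_superset] at hx
  change IsIntegral (Subring.closure s) x at hx
  have hs : Subring.closure s = (algebraMap R k).range :=
    (congr_arg Subring.closure (RingHom.coe_range _).symm).trans (Subring.closure_eq _)
  rw [hs] at hx
  obtain ⟨P, hP, h0⟩ := hx
  obtain ⟨Q, hQ, -, hQm⟩ := Polynomial.lifts_and_degree_eq_and_monic
    (f := (algebraMap R k).rangeRestrict) (p := P) ((Polynomial.mem_lifts P).mpr
      (Polynomial.map_surjective _ (algebraMap R k).rangeRestrict_surjective P)) hP
  refine ⟨Q, hQm, ?_⟩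
  rw [← hQ, Polynomial.eval₂_map] at h0
  exact h0

theorem algebraMap_mem_of_finite (F : Type*) [Field F] [Finite F] [Algebra F k]
    (V : ValuationSubring k) (a : F) : algebraMap F k a ∈ V := by
  have : Algebra.IsIntegral ℤ F := inferInstance
  exact V.mem_of_isIntegral (R := ℤ) (fun r ↦ by simp)
    ((Algebra.IsIntegral.isIntegral (R := ℤ) a).map (IsScalarTower.toAlgHom ℤ F k))

theorem isIntegral_finite_iff (F : Type*) [Field F] [Finite F] [Algebra F k] :
    IsIntegral F x ↔ ∀ V : ValuationSubring k, x ∈ V := by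
  rw [isIntegral_iff]
  exact forall_congr' fun V ↦ by simp [V.algebraMap_mem_of_finite F]

end ValuationSubring

namespace RingClassTower

open Polynomial

section

variable {F k : Type*} [Field F] [Finite F] [Field k] [Algebra F k]
  {Vinf : ValuationSubring k}

/-- A regular function without pole at infinity is constant. -/
theorem isIntegral_of_mem_regularOutside {x : k} (hx : x ∈ regularOutside Vinf) (h : x ∈ Vinf) :
    IsIntegral F x := by
  rw [ValuationSubring.isIntegral_finite_iff F]
  intro V
  by_cases hV : V = ⊤
  · rw [hV]
    trivial
  by_cases hV' : V = Vinf
  · rwa [hV']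
  · exact hx V hV hV'

theorem mem_regularOutside_of_isIntegral {x : k} (hx : IsIntegral F x) :
    x ∈ regularOutside Vinf := fun V _ _ ↦ (ValuationSubring.isIntegral_finite_iff F).mp hx V

theorem isUnit_of_mem (F : Type*) [Field F] [Finite F] [Algebra F k] {y : regularOutside Vinf}
    (hy0 : y ≠ 0) (h : (y : k) ∈ Vinf) : IsUnit y := by
  have hy0' : (y : k) ≠ 0 := fun h0 ↦ hy0 (Subtype.ext h0)
  have : IsIntegral F (y : k)⁻¹ := (isIntegral_of_mem_regularOutside y.2 h).inv
  exact IsUnit.of_mul_eq_one ⟨_, mem_regularOutside_of_isIntegral this⟩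
    (Subtype.ext (mul_inv_cancel₀ hy0'))

variable [Algebra F[X] k] [IsScalarTower F F[X] k]

theorem algebraMap_mem_iff (V : ValuationSubring k) :
    (∀ P : F[X], algebraMap F[X] k P ∈ V) ↔ algebraMap F[X] k X ∈ V := by
  refine ⟨fun h ↦ h X, fun h P ↦ ?_⟩
  induction P using Polynomial.induction_on' with
  | add P Q hP hQ =>
    rw [map_add]
    exact V.add_mem _ _ hP hQ
  | monomial n a =>
    rw [← C_mul_X_pow_eq_monomial, map_mul, map_pow, ← Polynomial.algebraMap_eq,
      ← IsScalarTower.algebraMap_apply]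
    exact V.mul_mem _ _ (V.algebraMap_mem_of_finite F a) (pow_mem h n)

variable [FaithfulSMul F[X] k]

theorem algebraMap_X_notMem (hX : algebraMap F[X] k X ∈ regularOutside Vinf) :
    algebraMap F[X] k X ∉ Vinf := by
  intro h
  obtain ⟨P, hP, h0⟩ := isIntegral_of_mem_regularOutside (F := F) hX h
  have : aeval (algebraMap F[X] k X) P = 0 := h0
  rw [aeval_algebraMap_apply, aeval_X_left_apply,
    map_eq_zero_iff _ (FaithfulSMul.algebraMap_injective F[X] k)] at this
  exact hP.ne_zero this

omit [Finite F] [Algebra F k] [IsScalarTower F F[X] k] [FaithfulSMul F[X] k] in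
theorem eq_of_algebraMap_X_notMem (hX : algebraMap F[X] k X ∈ regularOutside Vinf)
    {V : ValuationSubring k} (hV : algebraMap F[X] k X ∉ V) : V = Vinf := by
  by_contra h
  refine hV (hX V ?_ h)
  rintro rfl
  exact hV trivial

/-- The ring of functions regular outside `∞` is the integral closure of `F[t]`, for any
nonconstant `t` in it. -/
theorem mem_regularOutside_iff (hX : algebraMap F[X] k X ∈ regularOutside Vinf) {x : k} :
    x ∈ regularOutside Vinf ↔ IsIntegral F[X] x := by
  rw [ValuationSubring.isIntegral_iff]
  simp_rw [algebraMap_mem_iff]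
  constructor
  · intro h V hV
    by_cases hVt : V = ⊤
    · rw [hVt]
      trivial
    · exact h V hVt fun h' ↦ algebraMap_X_notMem hX (h' ▸ hV)
  · exact fun h V h1 h2 ↦ h V (hX V h1 h2)

theorem isIntegralClosure_regularOutside [Algebra F[X] (regularOutside Vinf)]
    [IsScalarTower F[X] (regularOutside Vinf) k] :
    IsIntegralClosure (regularOutside Vinf) F[X] k where
  algebraMap_injective := Subtype.val_injective
  isIntegral_iff {x} := by
    have hX : algebraMap F[X] k X ∈ regularOutside Vinf := by
      rw [IsScalarTower.algebraMap_apply F[X] (regularOutside Vinf) k]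
      exact (algebraMap F[X] (regularOutside Vinf) X).2
    rw [← mem_regularOutside_iff hX]
    exact ⟨fun h ↦ ⟨⟨x, h⟩, rfl⟩, fun ⟨y, hy⟩ ↦ hy ▸ y.2⟩

end

end RingClassTower

/-! ### The place at infinity of F(X) and its extension to k -/

namespace IsLocalRing

open Polynomial

variable {F F' O : Type*} [Field F] [Field F'] [Algebra F[X] F'] [IsFractionRing F[X] F']
  [CommRing O] [IsDomain O] [IsLocalRing O] [Algebra O F'] [IsFractionRing O F'] {c : F →+* O}
  {s : O}

omit [IsDomain O] [IsFractionRing O F'] in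
-- Leading terms of numerator and denominator. This forces `O` to be the local ring of the
-- projective line at infinity, with every unit congruent to a constant.
theorem exists_eq_zpow_mul_unit
    (hc : ∀ a, algebraMap O F' (c a) = algebraMap F[X] F' (C a)) (hs : s ∈ maximalIdeal O)
    (hsX : algebraMap O F' s * algebraMap F[X] F' X = 1) {r : F'} (hr : r ≠ 0) :
    ∃ (n : ℤ) (u : Oˣ) (a : F), r = algebraMap O F' s ^ n * algebraMap O F' u ∧
      residue O u = residue O (c a) := by
  have key (P : F[X]) (hP : P ≠ 0) : ∃ (n : ℤ) (u : Oˣ),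
      algebraMap F[X] F' P = algebraMap O F' s ^ n * algebraMap O F' u ∧
      residue O u = residue O (c P.leadingCoeff) := by
    obtain ⟨u, hu, hru⟩ := exists_algebraMap_eq_zpow_mul c hc hs hsX P
    have : residue O u ≠ 0 := by
      rw [hru]
      exact (map_ne_zero ((residue O).comp c)).mpr (leadingCoeff_ne_zero.mpr hP)
    obtain ⟨u, rfl⟩ := residue_ne_zero_iff_isUnit _ |>.mp this
    exact ⟨_, u, hu, hru⟩
  obtain ⟨P, Q, -, rfl⟩ := IsFractionRing.div_surjective (A := F[X]) r
  have hinj := IsFractionRing.injective F[X] F'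
  rw [div_ne_zero_iff, map_ne_zero_iff _ hinj, map_ne_zero_iff _ hinj] at hr
  obtain ⟨n, u, hu, hru⟩ := key P hr.1
  obtain ⟨m, v, hv, hrv⟩ := key Q hr.2
  have hs0 : algebraMap O F' s ≠ 0 := left_ne_zero_of_mul_eq_one hsX
  have hvv : algebraMap O F' ↑v⁻¹ = (algebraMap O F' v)⁻¹ := by
    refine eq_inv_of_mul_eq_one_left ?_
    rw [← map_mul, Units.inv_mul, map_one]
  have hvr : residue O ↑v⁻¹ = residue O (c Q.leadingCoeff⁻¹) := by
    have h1 : residue O (c Q.leadingCoeff⁻¹) = (residue O (c Q.leadingCoeff))⁻¹ :=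
      map_inv₀ ((residue O).comp c) _
    rw [h1, ← hrv]
    refine eq_inv_of_mul_eq_one_left ?_
    rw [← map_mul, Units.inv_mul, map_one]
  refine ⟨n - m, u * v⁻¹, P.leadingCoeff * Q.leadingCoeff⁻¹, ?_, ?_⟩
  · rw [hu, hv, zpow_sub₀ hs0, Units.val_mul, map_mul, hvv]
    field_simp
  · rw [Units.val_mul, map_mul, map_mul, map_mul, hru, hvr]

omit [IsDomain O] in
theorem exists_eq_pow_mul_unit
    (hc : ∀ a, algebraMap O F' (c a) = algebraMap F[X] F' (C a)) (hs : s ∈ maximalIdeal O)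
    (hsX : algebraMap O F' s * algebraMap F[X] F' X = 1) {r : O} (hr : r ≠ 0) :
    ∃ (n : ℕ) (u : Oˣ) (a : F), r = s ^ n * u ∧ residue O u = residue O (c a) := by
  have hinj := IsFractionRing.injective O F'
  obtain ⟨n, u, a, h, hu⟩ := exists_eq_zpow_mul_unit hc hs hsX ((map_ne_zero_iff _ hinj).mpr hr)
  have hs0 : algebraMap O F' s ≠ 0 := left_ne_zero_of_mul_eq_one hsX
  rcases Int.eq_nat_or_neg n with ⟨n, rfl | rfl⟩
  · refine ⟨n, u, a, hinj ?_, hu⟩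
    rw [h, map_mul, map_pow, zpow_natCast]
  · refine ⟨0, u, a, ?_, hu⟩
    have h' : s ^ n * r = u := by
      apply hinj
      rw [map_mul, map_pow, h, zpow_neg, zpow_natCast, mul_inv_cancel_left₀ (pow_ne_zero n hs0)]
    cases n with
    | zero => rw [← h']; simp
    | succ n =>
      refine absurd (isUnit_of_mul_isUnit_left (h' ▸ u.isUnit)) fun h ↦ ?_
      exact (mem_maximalIdeal _).mp hs ((isUnit_pow_iff (Nat.succ_ne_zero n)).mp h)

omit [IsDomain O] in
theorem maximalIdeal_eq_span
    (hc : ∀ a, algebraMap O F' (c a) = algebraMap F[X] F' (C a)) (hs : s ∈ maximalIdeal O)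
    (hsX : algebraMap O F' s * algebraMap F[X] F' X = 1) : maximalIdeal O = Ideal.span {s} := by
  refine le_antisymm (fun r hr ↦ ?_) ((Ideal.span_singleton_le_iff_mem _).mpr hs)
  rw [Ideal.mem_span_singleton]
  by_cases h0 : r = 0
  · rw [h0]
    exact dvd_zero s
  obtain ⟨n, u, -, rfl, -⟩ := exists_eq_pow_mul_unit hc hs hsX h0
  cases n with
  | zero =>
    rw [pow_zero, one_mul] at hr
    exact absurd u.isUnit ((mem_maximalIdeal _).mp hr)
  | succ n => exact (dvd_pow_self s n.succ_ne_zero).mul_right _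

theorem isDiscreteValuationRing_of_inv_X
    (hc : ∀ a, algebraMap O F' (c a) = algebraMap F[X] F' (C a)) (hs : s ∈ maximalIdeal O)
    (hsX : algebraMap O F' s * algebraMap F[X] F' X = 1) : IsDiscreteValuationRing O := by
  refine IsDiscreteValuationRing.ofHasUnitMulPowIrreducibleFactorization ⟨s, ?_, fun {r} hr ↦ ?_⟩
  · refine Prime.irreducible ?_
    rw [← Ideal.span_singleton_prime, ← maximalIdeal_eq_span hc hs hsX]
    · infer_instance
    · rintro rfl
      simp at hsX
  · obtain ⟨n, u, -, rfl, -⟩ := exists_eq_pow_mul_unit hc hs hsX hr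
    exact ⟨n, u, rfl⟩

omit [IsDomain O] in
theorem finite_residueField_of_inv_X [Finite F]
    (hc : ∀ a, algebraMap O F' (c a) = algebraMap F[X] F' (C a)) (hs : s ∈ maximalIdeal O)
    (hsX : algebraMap O F' s * algebraMap F[X] F' X = 1) : Finite (ResidueField O) := by
  refine Finite.of_surjective ((residue O).comp c) fun r ↦ ?_
  obtain ⟨r, rfl⟩ := residue_surjective r
  by_cases h0 : residue O r = 0
  · exact ⟨0, by rw [h0, map_zero]⟩
  have hr : r ≠ 0 := by
    rintro rfl
    exact h0 (map_zero _)
  obtain ⟨n, u, a, rfl, hu⟩ := exists_eq_pow_mul_unit hc hs hsX hr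
  cases n with
  | zero => exact ⟨a, by rw [pow_zero, one_mul, hu]; rfl⟩
  | succ n =>
    refine absurd ?_ h0
    rw [map_mul, map_pow, (residue_eq_zero_iff s).mpr hs, zero_pow n.succ_ne_zero, zero_mul]

end IsLocalRing

namespace RingClassTower

open Polynomial IsLocalRing

/-- If `t` is not a square times a principal unit at infinity, it is a non-square at some finite
prime away from any given one. -/
theorem exists_isMaximal_not_isSquare {F F' k : Type*} [Field F] [Finite F] (p : ℕ)
    [Fact p.Prime] (hp : p ≠ 2) [CharP F p] [Field k] [Algebra F k] [Algebra F[X] k]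
    [IsScalarTower F F[X] k] [Field F'] [Algebra F[X] F'] [IsFractionRing F[X] F'] [Algebra F' k]
    [IsScalarTower F[X] F' k] [FiniteDimensional F' k] [Algebra.IsSeparable F' k]
    {Vinf : ValuationSubring k} [Algebra F[X] (regularOutside Vinf)]
    [IsScalarTower F[X] (regularOutside Vinf) k]
    (hns : ∀ y z : k, Vinf.valuation z < 1 → algebraMap F[X] k X * y ^ 2 ≠ 1 + z)
    {π : regularOutside Vinf} (hπ0 : π ≠ 0) (hπ : ¬IsUnit π) :
    ∃ M : Ideal (regularOutside Vinf), M.IsMaximal ∧ π ∉ M ∧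
      algebraMap F[X] (regularOutside Vinf) X ∉ M ∧
      ¬IsSquare (Ideal.Quotient.mk M (algebraMap F[X] (regularOutside Vinf) X)) := by
  have hfaith : FaithfulSMul F[X] k := by
    rw [faithfulSMul_iff_algebraMap_injective, IsScalarTower.algebraMap_eq F[X] F' k]
    exact (algebraMap F' k).injective.comp (IsFractionRing.injective F[X] F')
  have hX : algebraMap F[X] k X ∈ regularOutside Vinf := by
    rw [IsScalarTower.algebraMap_apply F[X] (regularOutside Vinf) k]
    exact (algebraMap F[X] (regularOutside Vinf) X).2
  have hXV := algebraMap_X_notMem hX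
  have hXO : algebraMap F' k (algebraMap F[X] F' X) = algebraMap F[X] k X :=
    (IsScalarTower.algebraMap_apply F[X] F' k X).symm
  have hX0 : algebraMap F[X] F' X ≠ 0 := by
    intro h
    rw [h, map_zero] at hXO
    exact hXV (hXO ▸ Vinf.zero_mem)
  let O := Vinf.comap (algebraMap F' k)
  let φ : O →+* Vinf := ((algebraMap F' k).comp O.subtype).codRestrict Vinf.toSubring fun x ↦ x.2
  let _ : Algebra O Vinf := φ.toAlgebra
  let _ : Algebra O k := ((algebraMap F' k).comp O.subtype).toAlgebra
  have : IsScalarTower O F' k := IsScalarTower.of_algebraMap_eq fun _ ↦ rfl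
  have : IsScalarTower O Vinf k := IsScalarTower.of_algebraMap_eq fun _ ↦ rfl
  have : FaithfulSMul O Vinf := by
    rw [faithfulSMul_iff_algebraMap_injective]
    intro x y h
    exact Subtype.ext ((algebraMap F' k).injective (congr_arg Subtype.val h))
  let c : F →+* O := ((algebraMap F[X] F').comp C).codRestrict O.toSubring fun a ↦ by
    change algebraMap F' k (algebraMap F[X] F' (C a)) ∈ Vinf
    rw [← IsScalarTower.algebraMap_apply F[X] F' k, ← Polynomial.algebraMap_eq,
      ← IsScalarTower.algebraMap_apply F F[X] k]
    exact Vinf.algebraMap_mem_of_finite F a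
  have hc a : algebraMap O F' (c a) = algebraMap F[X] F' (C a) := rfl
  have hXinv : (algebraMap F[X] F' X)⁻¹ ∈ O := by
    change algebraMap F' k _ ∈ Vinf
    rw [map_inv₀, hXO]
    exact (Vinf.mem_or_inv_mem _).resolve_left hXV
  let s : O := ⟨_, hXinv⟩
  have hsX : algebraMap O F' s * algebraMap F[X] F' X = 1 := inv_mul_cancel₀ hX0
  have hsm : s ∈ maximalIdeal O := by
    intro hu
    obtain ⟨x, hx⟩ := hu.exists_right_inv
    refine hXV ?_
    have : (x : F') = algebraMap F[X] F' X := by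
      have := congr_arg (Subtype.val) hx
      change (algebraMap F[X] F' X)⁻¹ * (x : F') = 1 at this
      rw [inv_mul_eq_one₀ hX0] at this
      exact this.symm
    rw [← hXO, ← this]
    exact x.2
  have hO : IsDiscreteValuationRing O := isDiscreteValuationRing_of_inv_X hc hsm hsX
  have hfin := finite_residueField_of_inv_X hc hsm hsX
  -- A valuation ring of k over `O` either contains X, hence `O[X] = F'` and by algebraicity all of
  -- k, or is `Vinf`, the only place where X has a pole.
  have hint : IsIntegralClosure Vinf O k :=
    { algebraMap_injective := Subtype.val_injective
      isIntegral_iff {x} := by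
        rw [ValuationSubring.isIntegral_iff]
        constructor
        · exact fun h ↦ ⟨⟨x, h Vinf fun r ↦ r.2⟩, rfl⟩
        · rintro ⟨x, rfl⟩ V hV
          by_cases hXV' : algebraMap F[X] k X ∈ V
          · refine V.mem_of_isIntegral (R := F') (fun r ↦ ?_) (Algebra.IsIntegral.isIntegral _)
            by_cases hr : r = 0
            · rw [hr, map_zero]
              exact V.zero_mem
            obtain ⟨n, u, -, h, -⟩ := exists_eq_zpow_mul_unit hc hsm hsX hr
            rw [h, map_mul]
            refine V.mul_mem _ _ ?_ (hV u)
            rcases Int.eq_nat_or_neg n with ⟨n, rfl | rfl⟩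
            · rw [zpow_natCast, map_pow]
              exact pow_mem (hV s) n
            · rw [zpow_neg, zpow_natCast, ← inv_pow, map_pow,
                inv_eq_of_mul_eq_one_right hsX, hXO]
              exact pow_mem hXV' n
          · rw [eq_of_algebraMap_X_notMem hX hXV']
            exact x.2 }
  have hfinV : Module.Finite O Vinf := IsIntegralClosure.finite O F' k Vinf
  have hV : IsDiscreteValuationRing Vinf := by
    have : IsDedekindDomain Vinf := IsIntegralClosure.isDedekindDomain O F' k Vinf
    have hnf : ¬IsField Vinf := by
      intro h
      have hs0 : φ s ≠ 0 := by
        intro h0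
        have := congr_arg Subtype.val h0
        change algebraMap F' k (algebraMap F[X] F' X)⁻¹ = 0 at this
        exact inv_ne_zero hX0 ((map_eq_zero _).mp this)
      obtain ⟨y, hy⟩ := h.mul_inv_cancel hs0
      have hsu : IsUnit s := isUnit_of_map_unit (algebraMap O Vinf) s (IsUnit.of_mul_eq_one y hy)
      exact (mem_maximalIdeal _).mp hsm hsu
    exact ((IsDiscreteValuationRing.TFAE Vinf hnf).out 0 2).mpr this
  have hA : IsIntegralClosure (regularOutside Vinf) F[X] k := isIntegralClosure_regularOutside
  have hfinA : Module.Finite F[X] (regularOutside Vinf) :=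
    IsIntegralClosure.finite F[X] F' k (regularOutside Vinf)
  have hfrac : IsFractionRing (regularOutside Vinf) k :=
    IsIntegralClosure.isFractionRing_of_finite_extension F[X] F' k _
  have hfaithA : FaithfulSMul F[X] (regularOutside Vinf) := by
    rw [faithfulSMul_iff_algebraMap_injective]
    refine .of_comp (f := algebraMap (regularOutside Vinf) k) ?_
    rw [← RingHom.coe_comp, ← IsScalarTower.algebraMap_eq]
    exact FaithfulSMul.algebraMap_injective _ _
  have : IsLocalization (Algebra.algebraMapSubmonoid (regularOutside Vinf) (nonZeroDivisors F[X])) k :=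
    IsIntegralClosure.isLocalization F[X] F' k _
  have : IsLocalization (Algebra.algebraMapSubmonoid Vinf (nonZeroDivisors O)) k :=
    IsIntegralClosure.isLocalization O F' k _
  let _ : Algebra F (regularOutside Vinf) :=
    ((algebraMap F[X] (regularOutside Vinf)).comp (algebraMap F F[X])).toAlgebra
  have : IsScalarTower F F[X] (regularOutside Vinf) := IsScalarTower.of_algebraMap_eq fun _ ↦ rfl
  refine IsLocalRing.exists_isMaximal_not_isSquare (F := F) (F' := F') (k := k) (O := O) (V := Vinf)
    p hp (fun a ↦ Algebra.norm_localization F[X] (nonZeroDivisors F[X]) a)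
    (fun a ↦ Algebra.norm_localization O (nonZeroDivisors O) a) c hc
    (maximalIdeal_eq_span hc hsm hsX) hsX ?_ ?_ ?_ hπ0 hπ
  · change algebraMap F' k (algebraMap F[X] F' X)⁻¹ * _ = 1
    rw [← IsScalarTower.algebraMap_apply F[X] (regularOutside Vinf) k, map_inv₀, hXO]
    refine inv_mul_cancel₀ ?_
    rintro h0
    exact hXV (h0 ▸ Vinf.zero_mem)
  · intro y hy0 hyu
    have hyV : (y : k) ∉ Vinf := fun h ↦ hyu (isUnit_of_mem F hy0 h)
    have hyV' := (Vinf.mem_or_inv_mem _).resolve_left hyV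
    refine ⟨⟨(y : k)⁻¹, hyV'⟩, ?_, inv_mul_cancel₀ fun h0 ↦ hy0 (Subtype.ext h0)⟩
    rw [ValuationSubring.valuation_lt_one_iff]
    change Vinf.valuation (y : k)⁻¹ < 1
    rw [map_inv₀]
    refine inv_lt_one_of_one_lt₀ ?_
    rwa [← not_le, ValuationSubring.valuation_le_one_iff]
  · intro y z hz
    rw [← IsScalarTower.algebraMap_apply F[X] (regularOutside Vinf) k]
    exact hns y z ((ValuationSubring.valuation_lt_one_iff _ _).mp hz)

end RingClassTower

/-! ### Derivations and separating elements -/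

section Derivation

/-- Derivations are the linear forms on the Kähler differentials, and linear forms on a vector space
separate points. -/
theorem Algebra.FormallyUnramified.of_derivation_eq_zero {R k : Type*} [CommRing R] [Field k]
    [Algebra R k] (h : ∀ D : Derivation R k k, D = 0) : Algebra.FormallyUnramified R k := by
  refine ⟨⟨fun x y ↦ ?_⟩⟩
  rw [← sub_eq_zero, ← Module.forall_dual_apply_eq_zero_iff k]
  intro φ
  have hφ : φ = 0 := by
    refine LinearMap.ext_on (KaehlerDifferential.span_range_derivation R k) ?_
    rintro _ ⟨z, rfl⟩
    exact congr($(h (φ.compDer (KaehlerDifferential.D R k))) z)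
  rw [hφ, LinearMap.zero_apply]

theorem Derivation.eq_zero_of_formallyUnramified {R S M : Type*} [CommRing R] [CommRing S]
    [Algebra R S] [AddCommGroup M] [Module R M] [Module S M] [IsScalarTower R S M]
    [Algebra.FormallyUnramified R S] (D : Derivation R S M) : D = 0 := by
  rw [← D.liftKaehlerDifferential_comp]
  ext x
  change D.liftKaehlerDifferential (KaehlerDifferential.D R S x) = 0
  rw [Subsingleton.elim (KaehlerDifferential.D R S x) 0, map_zero]

variable {F k : Type*} [Field F] [Field k] [Algebra F k]

theorem Derivation.eq_zero_of_forall_mem_adjoin {s : Set k}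
    [Algebra.IsSeparable (IntermediateField.adjoin F s) k] (D : Derivation F k k)
    (h : ∀ x ∈ s, D x = 0) : D = 0 := by
  let E := IntermediateField.adjoin F s
  have hE (x : k) (hx : x ∈ E) : D x = 0 := by
    induction hx using IntermediateField.adjoin_induction with
    | mem x hx => exact h x hx
    | algebraMap x => exact D.map_algebraMap x
    | add x y _ _ hx hy => rw [map_add, hx, hy, add_zero]
    | inv x _ hx => rw [D.leibniz_inv, hx, smul_zero]
    | mul x y _ _ hx hy => rw [D.leibniz, hx, hy, smul_zero, smul_zero, add_zero]
  let D' : Derivation E k k := Derivation.mk'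
    { toFun := D
      map_add' := map_add D
      map_smul' := fun c x ↦ by
        change D (c.1 * x) = c.1 * D x
        rw [D.leibniz, hE c.1 c.2, smul_zero, add_zero, smul_eq_mul] } D.leibniz
  have : Algebra.FormallyUnramified E k := Algebra.FormallyUnramified.of_isSeparable E k
  ext x
  exact congr($(D'.eq_zero_of_formallyUnramified) x)

/-- A separating transcendence basis has one element s, and a derivation extends uniquely from F(s).
-/
theorem exists_forall_derivation_eq_zero [PerfectField F] [Algebra.EssFiniteType F k]
    (h : Algebra.trdeg F k = 1) : ∃ s : k, ∀ D : Derivation F k k, D s = 0 → D = 0 := by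
  obtain ⟨s, hs, hsep⟩ := exists_isTranscendenceBasis_and_isSeparable_of_perfectField F k
  have hc := hs.cardinalMk_eq_trdeg
  rw [h, Cardinal.mk_coe_finset, Nat.cast_eq_one, Finset.card_eq_one] at hc
  obtain ⟨x, rfl⟩ := hc
  exact ⟨x, fun D hD ↦ D.eq_zero_of_forall_mem_adjoin (s := (({x} : Finset k) : Set k)) (by simpa using hD)⟩

/-- Without derivations the field would be unramified, hence algebraic, over F. -/
theorem exists_derivation_ne_zero [Algebra.EssFiniteType F k] [Algebra.Transcendental F k] :
    ∃ D : Derivation F k k, D ≠ 0 := by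
  by_contra! h
  have := Algebra.FormallyUnramified.of_derivation_eq_zero h
  have := Algebra.FormallyUnramified.isSeparable F k
  obtain ⟨x, hx⟩ := Algebra.Transcendental.transcendental (R := F) (A := k)
  exact hx (Algebra.IsAlgebraic.isAlgebraic x)

theorem transcendental_of_derivation_ne_zero [PerfectField F] (D : Derivation F k k) {t : k}
    (h : D t ≠ 0) : Transcendental F t := by
  intro ht
  have hsep : IsSeparable F t :=
    PerfectField.separable_of_irreducible (minpoly.irreducible ht.isIntegral)
  have h0 := D.map_aeval (minpoly F t) t
  rw [minpoly.aeval, map_zero, smul_eq_mul, eq_comm, mul_eq_zero] at h0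
  exact hsep.aeval_derivative_ne_zero (minpoly.aeval F t) (h0.resolve_right h)

/-- Derivations form a space of dimension at most one. One that is E-linear kills t, while D does
not, so it is zero; hence k is unramified over E. -/
theorem isSeparable_finite_of_derivation_ne_zero [PerfectField F] [Algebra.EssFiniteType F k]
    (h : Algebra.trdeg F k = 1) {E : Type*} [Field E] [Algebra F E] [Algebra E k]
    [IsScalarTower F E k] (D : Derivation F k k) {t : E} (ht : D (algebraMap E k t) ≠ 0) :
    Algebra.IsSeparable E k ∧ FiniteDimensional E k := by
  have : Algebra.EssFiniteType E k := Algebra.EssFiniteType.of_comp F E k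
  have : Algebra.FormallyUnramified E k := by
    refine .of_derivation_eq_zero fun D₁ ↦ ?_
    obtain ⟨s, hs⟩ := exists_forall_derivation_eq_zero h
    let D₂ : Derivation F k k := D₁.restrictScalars F
    have h0 := hs (D s • D₂ - D₂ s • D) (by
      simp only [Derivation.sub_apply, Derivation.smul_apply, smul_eq_mul]
      ring)
    have h1 := congr($h0 (algebraMap E k t))
    have h2 : D₂ (algebraMap E k t) = 0 := D₁.map_algebraMap t
    simp only [Derivation.sub_apply, Derivation.smul_apply, smul_eq_mul, h2, mul_zero, zero_sub,
      Derivation.zero_apply, neg_eq_zero, mul_eq_zero, ht, or_false] at h1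
    have h3 := hs D₂ h1
    ext x
    exact congr($h3 x)
  exact ⟨Algebra.FormallyUnramified.isSeparable E k, Algebra.FormallyUnramified.finite_of_free E k⟩

end Derivation

section Trdeg

open Polynomial

variable {F k : Type*} [Field F] [Field k] [Algebra F k] [Algebra F[X] k] [IsScalarTower F F[X] k]
  [FaithfulSMul F[X] k]

theorem trdeg_eq_one_iff_isAlgebraic :
    Algebra.trdeg F k = 1 ↔ Algebra.IsAlgebraic F[X] k := by
  have h := lift_trdeg_add_eq F F[X] k
  rw [Polynomial.trdeg_of_isDomain, Cardinal.lift_one] at h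
  rw [← trdeg_eq_zero_iff, ← Cardinal.lift_eq_one, ← h, ← Cardinal.lift_eq_zero]
  refine ⟨fun h1 ↦ ?_, fun h1 ↦ by rw [h1, add_zero]⟩
  refine Cardinal.eq_of_add_eq_add_left (a := 1) ?_ Cardinal.one_lt_aleph0
  rw [h1, add_zero]

end Trdeg

/-! ### Nonsplit primes and places in quadratic extensions -/

section Nonsplit

variable {A k K : Type*} [CommRing A] [IsDomain A] [IsIntegrallyClosed A] [Field k] [Algebra A k]
  [IsFractionRing A k] [Field K] [Algebra k K] [Algebra A K] [IsScalarTower A k K]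

omit [IsDomain A] in
/-- A prime modulo which `t` is not a square does not split in the extension by `√t`. -/
theorem Ideal.eq_of_under_eq_of_not_isSquare (σ : K ≃ₐ[k] K)
    (hσ : ∀ x, σ x = x → ∃ y, algebraMap k K y = x) (hσσ : ∀ x, σ (σ x) = x) {t : A} {s : K}
    (hs : s ^ 2 = algebraMap A K t) (hσs : σ s = -s) {M : Ideal A} [M.IsMaximal]
    (hns : ¬IsSquare (Ideal.Quotient.mk M t)) {P Q : Ideal (integralClosure A K)} [P.IsPrime]
    [Q.IsPrime] (hP : P.under A = M) (hQ : Q.under A = M) : P = Q := by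
  let B := integralClosure A K
  have descend (y : B) (hy : σ y = y) : ∃ a : A, algebraMap A B a = y := by
    obtain ⟨z, hz⟩ := hσ y hy
    have hint : IsIntegral A z := by
      rw [← isIntegral_algebraMap_iff (algebraMap k K).injective (R := A), hz]
      exact y.2
    obtain ⟨a, ha⟩ := IsIntegrallyClosed.algebraMap_eq_of_integral hint
    refine ⟨a, Subtype.ext ?_⟩
    change algebraMap A K a = y
    rw [IsScalarTower.algebraMap_apply A k K, ha, hz]
  let τ : B ≃ₐ[A] B := (σ.restrictScalars A).mapIntegralClosure
  have hτ (x : B) : (τ x : K) = σ x := rfl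
  let s' : B := ⟨s, .of_pow two_pos (hs ▸ isIntegral_algebraMap)⟩
  have hs' : s' ^ 2 = algebraMap A B t := Subtype.ext hs
  have hPmax : P.IsMaximal := Ideal.isMaximal_of_isIntegral_of_isMaximal_comap P
    (by change (P.under A).IsMaximal; rwa [hP])
  by_contra hPQ
  have hle : ¬P ≤ Q := fun h ↦ hPQ (hPmax.eq_of_le ‹Q.IsPrime›.ne_top h)
  obtain ⟨x, hxP, hxQ⟩ := Set.not_subset.mp hle
  have hmem {a : A} : a ∈ M ↔ algebraMap A B a ∈ Q := by rw [← hQ]; rfl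
  have hmem' {a : A} : a ∈ M ↔ algebraMap A B a ∈ P := by rw [← hP]; rfl
  obtain ⟨n, hn⟩ := descend (x * τ x) (by
    change σ (x * σ x) = x * σ x
    rw [map_mul, hσσ, mul_comm])
  have hτxQ : τ x ∈ Q := by
    have : n ∈ M := hmem'.mpr (hn ▸ P.mul_mem_right _ hxP)
    rw [hmem, hn] at this
    exact (‹Q.IsPrime›.mem_or_mem this).resolve_left hxQ
  obtain ⟨T, hT⟩ := descend (x + τ x) (by
    change σ (x + σ x) = x + σ x
    rw [map_add, hσσ, add_comm])
  -- For x in P but not in Q, σ(x) lies in Q. With T = x + σ(x) and U = s(x - σ(x)), both in A, tT²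
  -- - U² = 4t·xσ(x) lies in M while T does not, so t is the square of U/T modulo M.
  obtain ⟨U, hU⟩ := descend (s' * (x - τ x)) (by
    change σ (s * (x - σ x)) = s * (x - σ x)
    rw [map_mul, map_sub, hσσ, hσs]
    ring)
  have hTM : T ∉ M := by
    rw [hmem, hT]
    exact fun h ↦ hxQ ((Q.add_mem_iff_left hτxQ).mp h)
  have key : t * T ^ 2 - U ^ 2 ∈ M := by
    rw [hmem, map_sub, map_mul, map_pow, map_pow, hT, hU, ← hs']
    have : s' ^ 2 * (x + τ x) ^ 2 - (s' * (x - τ x)) ^ 2 = (4 * s' ^ 2 * x) * τ x := by ring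
    rw [this]
    exact Q.mul_mem_left _ hτxQ
  let _ := Ideal.Quotient.field M
  rw [← Ideal.Quotient.eq, map_mul, map_pow, map_pow] at key
  have hT0 : Ideal.Quotient.mk M T ≠ 0 := fun h ↦ hTM (Ideal.Quotient.eq_zero_iff_mem.mp h)
  refine hns ⟨Ideal.Quotient.mk M U / Ideal.Quotient.mk M T, ?_⟩
  rw [eq_comm, div_mul_div_comm, div_eq_iff (mul_ne_zero hT0 hT0), ← pow_two, ← pow_two, key]

end Nonsplit

theorem Ideal.exists_pow_eq_map {A B : Type*} [CommRing A] [CommRing B] [Algebra A B]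
    [IsDedekindDomain B] [Algebra.IsIntegral A B] [FaithfulSMul A B] {M : Ideal A} [hM : M.IsMaximal]
    (hM0 : M ≠ ⊥) (h : ∀ P Q : Ideal B, P.IsPrime → Q.IsPrime → P.under A = M → Q.under A = M →
      P = Q) : ∃ (Q : Ideal B) (i : ℕ), Q.IsPrime ∧ Q.under A = M ∧ Q ≠ ⊥ ∧ i ≠ 0 ∧
        M.map (algebraMap A B) = Q ^ i := by
  obtain ⟨Q, hQ, hQM⟩ := Ideal.exists_ideal_over_maximal_of_isIntegral (S := B) M
    (by rw [(RingHom.injective_iff_ker_eq_bot _).mp (FaithfulSMul.algebraMap_injective A B)]; exact bot_le)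
  have hmap : M.map (algebraMap A B) ≠ ⊥ := by
    rwa [Ne, Ideal.map_eq_bot_iff_of_injective (FaithfulSMul.algebraMap_injective A B)]
  have hQ0 : Q ≠ ⊥ := by
    rintro rfl
    refine hmap (le_bot_iff.mp ?_)
    rw [Ideal.map_le_iff_le_comap, hQM]
  have hfac : ∀ P ∈ UniqueFactorizationMonoid.normalizedFactors (M.map (algebraMap A B)), P = Q := by
    intro P hP
    have hPp := Ideal.isPrime_of_prime (UniqueFactorizationMonoid.prime_of_normalized_factor P hP)
    refine h P Q hPp hQ.isPrime ?_ hQM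
    have hle : M.map (algebraMap A B) ≤ P :=
      Ideal.le_of_dvd (UniqueFactorizationMonoid.dvd_of_mem_normalizedFactors hP)
    exact (hM.eq_of_le (Ideal.IsPrime.comap (algebraMap A B) (K := P)).ne_top
      (Ideal.map_le_iff_le_comap.mp hle)).symm
  have hprod := Ideal.prod_normalizedFactors_eq_self hmap
  rw [Multiset.eq_replicate_card.mpr hfac, Multiset.prod_replicate] at hprod
  refine ⟨Q, _, hQ.isPrime, hQM, hQ0, ?_, hprod.symm⟩
  intro h0
  rw [h0, pow_zero, Ideal.one_eq_top] at hprod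
  refine hQ.ne_top (top_le_iff.mp ?_)
  rw [hprod, Ideal.map_le_iff_le_comap, hQM]

section Quadratic

variable (k K : Type*) [Field k] [Field K] [Algebra k K] [Algebra.IsQuadraticExtension k K]

theorem Algebra.IsQuadraticExtension.exists_sq_eq (h2 : (2 : k) ≠ 0) :
    ∃ (s : K) (d : k), s ∉ (algebraMap k K).range ∧ s ^ 2 = algebraMap k K d := by
  have hrank := Algebra.IsQuadraticExtension.finrank_eq_two k K
  have hx : ∃ x : K, x ∉ (algebraMap k K).range := by
    by_contra! h
    have : (⊥ : Subalgebra k K) = ⊤ := _root_.eq_top_iff.mpr fun x _ ↦ Algebra.mem_bot.mpr (h x)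
    rw [Subalgebra.bot_eq_top_iff_finrank_eq_one, hrank] at this
    omega
  obtain ⟨x, hx⟩ := hx
  have hdep : ¬LinearIndependent k ![1, x, x ^ 2] := by
    intro h
    have := h.fintype_card_le_finrank
    simp [hrank] at this
  rw [Fintype.not_linearIndependent_iff] at hdep
  obtain ⟨g, hg, i, hi⟩ := hdep
  rw [Fin.sum_univ_three] at hg
  simp only [Matrix.cons_val_zero, Matrix.cons_val_one, Matrix.cons_val] at hg
  rw [Algebra.smul_def, Algebra.smul_def, Algebra.smul_def] at hg
  have h2c : g 2 ≠ 0 := by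
    intro h0
    rw [h0, map_zero, zero_mul, add_zero] at hg
    have h1c : g 1 ≠ 0 := by
      intro h1
      rw [h1, map_zero, zero_mul, add_zero, mul_one, map_eq_zero] at hg
      fin_cases i
      · exact hi hg
      · exact hi h1
      · exact hi h0
    have h1c' : algebraMap k K (g 1) ≠ 0 := by rwa [Ne, map_eq_zero]
    refine hx ⟨-(g 0) / g 1, ?_⟩
    rw [map_div₀, map_neg]
    field_simp
    linear_combination -hg
  have h2' : (2 : K) ≠ 0 := by
    rw [← map_ofNat (algebraMap k K)]
    rwa [Ne, map_eq_zero]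
  have h2c' : algebraMap k K (g 2) ≠ 0 := by rwa [Ne, map_eq_zero]
  refine ⟨x + algebraMap k K (g 1 / (2 * g 2)), (g 1 / (2 * g 2)) ^ 2 - g 0 / g 2, ?_, ?_⟩
  · rintro ⟨y, hy⟩
    exact hx ⟨y - g 1 / (2 * g 2), by rw [map_sub, hy]; ring⟩
  · rw [map_sub, map_pow, map_div₀, map_div₀, map_mul, map_ofNat]
    field_simp
    linear_combination 4 * (algebraMap k K (g 2)) * hg

variable {k K} in
theorem Algebra.IsQuadraticExtension.exists_algEquiv (h2 : (2 : k) ≠ 0) {s : K} {d : k}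
    (hs : s ∉ (algebraMap k K).range) (hd : s ^ 2 = algebraMap k K d) :
    Algebra.IsSeparable k K ∧ ∃ σ : K ≃ₐ[k] K, σ s = -s ∧ (∀ x, σ (σ x) = x) ∧
      ∀ x, σ x = x → ∃ y, algebraMap k K y = x := by
  have h2' : (2 : K) ≠ 0 := by
    rw [← map_ofNat (algebraMap k K)]
    rwa [Ne, map_eq_zero]
  have hs0 : s ≠ 0 := by
    rintro rfl
    exact hs ⟨0, map_zero _⟩
  have hli : LinearIndependent k ![1, s] := by
    rw [LinearIndependent.pair_iff]
    intro a b hab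
    have hb : b = 0 := by
      by_contra hb
      refine hs ⟨-a / b, ?_⟩
      have hb' : algebraMap k K b ≠ 0 := by rwa [Ne, map_eq_zero]
      rw [Algebra.smul_def, Algebra.smul_def] at hab
      rw [map_div₀, map_neg]
      field_simp
      linear_combination -hab
    refine ⟨?_, hb⟩
    rwa [hb, zero_smul, add_zero, Algebra.smul_def, mul_one, map_eq_zero] at hab
  have hspan : Submodule.span k (Set.range ![1, s]) = ⊤ :=
    hli.span_eq_top_of_card_eq_finrank
      (by simp [Algebra.IsQuadraticExtension.finrank_eq_two k K])
  have hrep (x : K) : ∃ a b : k, x = algebraMap k K a + algebraMap k K b * s := by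
    have : x ∈ Submodule.span k (Set.range ![1, s]) := hspan ▸ trivial
    rw [Matrix.range_cons, Matrix.range_cons, Matrix.range_empty, Set.union_empty,
      Set.singleton_union, Submodule.mem_span_pair] at this
    obtain ⟨a, b, rfl⟩ := this
    exact ⟨a, b, by rw [Algebra.smul_def, Algebra.smul_def, mul_one]⟩
  have hsep : Algebra.IsSeparable k K := by
    have hmin : IsSeparable k s := by
      have hd0 : d ≠ 0 := by
        rintro rfl
        rw [map_zero] at hd
        exact hs0 (pow_eq_zero_iff two_ne_zero |>.mp hd)
      refine Polynomial.Separable.of_dvd (Polynomial.separable_X_pow_sub_C (n := 2) d ?_ hd0) (minpoly.dvd k s ?_)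
      · exact_mod_cast h2
      · simp [hd]
    have htop : IntermediateField.adjoin k {s} = ⊤ := by
      rw [_root_.eq_top_iff]
      intro x _
      obtain ⟨a, b, rfl⟩ := hrep x
      exact add_mem (algebraMap_mem _ a) (mul_mem (algebraMap_mem _ b)
        (IntermediateField.mem_adjoin_simple_self k s))
    have h1 : Algebra.IsSeparable k (IntermediateField.adjoin k {s}) :=
      (IntermediateField.isSeparable_adjoin_simple_iff_isSeparable k K).mpr hmin
    rw [htop] at h1
    exact Algebra.IsSeparable.of_algHom k _ IntermediateField.topEquiv.symm.toAlgHom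
  refine ⟨hsep, ?_⟩
  have : ∃ σ : K ≃ₐ[k] K, σ s ≠ s := by
    by_contra! h
    exact hs (IntermediateField.mem_bot.mp ((IsGalois.mem_bot_iff_fixed s).mpr h))
  obtain ⟨σ, hσ⟩ := this
  have hσs : σ s = -s := by
    have : (σ s) ^ 2 = s ^ 2 := by rw [← map_pow, hd, AlgEquiv.commutes]
    exact (sq_eq_sq_iff_eq_or_eq_neg.mp this).resolve_left hσ
  refine ⟨σ, hσs, fun x ↦ ?_, fun x hx ↦ ?_⟩
  · obtain ⟨a, b, rfl⟩ := hrep x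
    simp [hσs]
  · obtain ⟨a, b, rfl⟩ := hrep x
    refine ⟨a, ?_⟩
    rw [map_add, map_mul, AlgEquiv.commutes, AlgEquiv.commutes, hσs] at hx
    have : 2 * (algebraMap k K b * s) = 0 := by linear_combination -hx
    rw [(mul_eq_zero.mp this).resolve_left h2', add_zero]

end Quadratic

theorem ValuationSubring.valuation_lt_one_iff_inv_notMem {K : Type*} [Field K]
    (V : ValuationSubring K) {x : K} (hx : x ≠ 0) : V.valuation x < 1 ↔ x⁻¹ ∉ V := by
  rw [← V.valuation_le_one_iff, not_le, map_inv₀, one_lt_inv₀ ((Valuation.pos_iff _).mpr hx)]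

namespace RingClassTower

/-- If `t` is a square up to a principal unit at a place, the place splits in the extension
by `√t`. -/
theorem ne_one_add_of_isNonsplit {k K : Type*} [Field k] [Field K] [Algebra k K]
    {Vinf : ValuationSubring k} (hK : IsNonsplit K Vinf) (h2 : Vinf.valuation 2 = 1) {t : k}
    {s : K} (hs : s ^ 2 = algebraMap k K t) (σ : K ≃ₐ[k] K) (hσs : σ s = -s) {y z : k}
    (hz : Vinf.valuation z < 1) : t * y ^ 2 ≠ 1 + z := by
  intro h
  obtain ⟨W, hW, huniq⟩ := hK
  -- Here w² = 1 + z, so w is close to 1 or to -1 at W. The unique place W is stable under σ, which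
  -- maps w to -w; so w would be close to both, and 2 would be small.
  let w := s * algebraMap k K y
  have hw : (w - 1) * (w + 1) = algebraMap k K z := by
    have : s ^ 2 * algebraMap k K y ^ 2 = 1 + algebraMap k K z := by
      rw [hs, ← map_pow, ← map_mul, h, map_add, map_one]
    linear_combination this
  have hσw : σ w = -w := by
    rw [map_mul, hσs, AlgEquiv.commutes, neg_mul]
  have hσW : W.comap (σ : K →+* K) = W := by
    refine huniq _ ?_
    change (W.comap (σ : K →+* K)).comap (algebraMap k K) = Vinf
    rw [ValuationSubring.comap_comap, ← hW]
    congr 1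
    ext x
    exact σ.commutes x
  have hlt (x : k) : W.valuation (algebraMap k K x) < 1 ↔ Vinf.valuation x < 1 := by
    subst hW
    by_cases hx : x = 0
    · simp [hx]
    have hx' : algebraMap k K x ≠ 0 := by rwa [Ne, map_eq_zero]
    rw [ValuationSubring.valuation_lt_one_iff_inv_notMem _ hx,
      ValuationSubring.valuation_lt_one_iff_inv_notMem _ hx', ValuationSubring.mem_comap, map_inv₀]
  have hσlt (x : K) : W.valuation (σ x) < 1 ↔ W.valuation x < 1 := by
    by_cases hx : x = 0
    · simp [hx]
    have hx' : σ x ≠ 0 := by rwa [Ne, map_eq_zero_iff _ σ.injective]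
    rw [ValuationSubring.valuation_lt_one_iff_inv_notMem _ hx,
      ValuationSubring.valuation_lt_one_iff_inv_notMem _ hx', ← map_inv₀]
    conv_rhs => rw [← hσW]
    rfl
  have h2W : ¬W.valuation 2 < 1 := by
    rw [← map_ofNat (algebraMap k K), hlt, h2]
    exact lt_irrefl _
  have hone (u : K) (hu : W.valuation (u - 1) < 1) (hu' : W.valuation (-u - 1) < 1) : False := by
    refine h2W ?_
    rw [← Valuation.map_neg]
    have : (-2 : K) = (u - 1) + (-u - 1) := by ring
    rw [this]
    exact Valuation.map_add_lt _ hu hu'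
  have hprod : W.valuation (w - 1) * W.valuation (w + 1) < 1 := by
    rw [← map_mul, hw, hlt]
    exact hz
  have hcase : W.valuation (w - 1) < 1 ∨ W.valuation (w + 1) < 1 := by
    by_contra! hc
    exact absurd hprod (not_lt.mpr (one_le_mul hc.1 hc.2))
  rcases hcase with hc | hc
  · refine hone w hc ?_
    rwa [← hσw, ← map_one σ, ← map_sub, hσlt]
  · have hc' : W.valuation (-w - 1) < 1 := by
      rwa [← Valuation.map_neg, neg_sub, sub_neg_eq_add, add_comm]
    refine hone w ?_ hc'
    rw [← hσlt, map_sub, map_one, hσw]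
    exact hc'

end RingClassTower

/-! ### Choice of the prime and conclusion -/

namespace RingClassTower

open Polynomial nonZeroDivisors

theorem two_ne_zero_of_charP (F : Type*) [Field F] (p : ℕ) (hp : p ≠ 2) [CharP F p] :
    (2 : F) ≠ 0 :=
  Ring.two_ne_zero (by rwa [ringChar.eq F p])

theorem valuation_two_eq_one {F k : Type*} [Field F] [Finite F] [Field k] [Algebra F k]
    (h2 : (2 : F) ≠ 0) (V : ValuationSubring k) : V.valuation 2 = 1 := by
  have hle (a : F) : V.valuation (algebraMap F k a) ≤ 1 :=
    (V.valuation_le_one_iff _).mpr (V.algebraMap_mem_of_finite F a)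
  have h2k : algebraMap F k 2 ≠ 0 := by rwa [Ne, map_eq_zero]
  rw [← map_ofNat (algebraMap F k)]
  refine le_antisymm (hle 2) ?_
  have := hle 2⁻¹
  rwa [map_inv₀, map_inv₀, inv_le_one₀ ((Valuation.pos_iff _).mpr h2k)] at this

theorem exists_pow_eq_span_notMem {A : Type*} [CommRing A] [IsDedekindDomain A]
    [Finite (ClassGroup A)] {M 𝔭 : Ideal A} [hM : M.IsMaximal] (hM0 : M ≠ ⊥) (h𝔭 : 𝔭.IsPrime) (hM𝔭 : ¬𝔭 ≤ M) :
    ∃ (h : ℕ) (a : A), h ≠ 0 ∧ a ∉ 𝔭 ∧ M ^ h = Ideal.span {a} := by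
  have := Fintype.ofFinite (ClassGroup A)
  let h := Fintype.card (ClassGroup A)
  have hp : (M ^ h).IsPrincipal := by
    rw [← ClassGroup.mk0_eq_one_iff (mem_nonZeroDivisors_of_ne_zero (pow_ne_zero h hM0))]
    have : ClassGroup.mk0 (⟨M, mem_nonZeroDivisors_of_ne_zero hM0⟩ : (Ideal A)⁰) ^ h = 1 :=
      pow_card_eq_one
    rw [← map_pow] at this
    exact this
  obtain ⟨a, ha⟩ := hp
  refine ⟨h, a, Fintype.card_ne_zero, fun hap ↦ ?_, ha⟩
  have hle : M ^ h ≤ 𝔭 := by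
    rw [ha]
    exact (Ideal.span_singleton_le_iff_mem _).mpr hap
  have hMle := h𝔭.le_of_pow_le hle
  exact hM𝔭 (hM.eq_of_le h𝔭.ne_top hMle).ge

open scoped Classical in
-- Reciprocity gives M, away from a nonzero element of `𝔭`, modulo which t is not a square; so M
-- does not split in `K`. From M𝓞_K = Q^i and M^h = (a) one gets Q^(ih) = (a).
theorem finite_torsion_of_sq_eq {F F' k K : Type*} [Field F] [Finite F] (p : ℕ)
    [Fact p.Prime] (hp : p ≠ 2) [CharP F p] [Field k] [Algebra F k] [Algebra F[X] k]
    [IsScalarTower F F[X] k] [Field F'] [Algebra F[X] F'] [IsFractionRing F[X] F'] [Algebra F' k]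
    [IsScalarTower F[X] F' k] [FiniteDimensional F' k] [Algebra.IsSeparable F' k]
    {Vinf : ValuationSubring k} [Algebra F[X] (regularOutside Vinf)]
    [IsScalarTower F[X] (regularOutside Vinf) k]
    [Field K] [Algebra k K] [Algebra.IsQuadraticExtension k K] (hK : IsNonsplit K Vinf)
    {s : K} (hs : s ∉ (algebraMap k K).range) (hsX : s ^ 2 = algebraMap k K (algebraMap F[X] k X))
    {𝔭 : Ideal (regularOutside Vinf)} (h𝔭 : 𝔭.IsPrime) (h𝔭0 : 𝔭 ≠ ⊥)
    (E : WeierstrassCurve (ringClassTower K 𝔭)) [E.IsElliptic] :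
    Finite (AddCommGroup.torsion (WeierstrassCurve.Affine.Point E)) := by
  have hcharF := two_ne_zero_of_charP F p hp
  have : CharP k p := charP_of_injective_algebraMap (algebraMap F k).injective p
  obtain ⟨hsep, σ, hσs, hσσ, hσ⟩ := Algebra.IsQuadraticExtension.exists_algEquiv
    (two_ne_zero_of_charP k p hp) hs hsX
  let A : Subring k := regularOutside Vinf
  have hA : IsIntegralClosure A F[X] k := by
    have : FaithfulSMul F[X] k := by
      rw [faithfulSMul_iff_algebraMap_injective, IsScalarTower.algebraMap_eq F[X] F' k]
      exact (algebraMap F' k).injective.comp (IsFractionRing.injective F[X] F')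
    exact isIntegralClosure_regularOutside
  have hDed : IsDedekindDomain A := IsIntegralClosure.isDedekindDomain F[X] F' k A
  have hfrac : IsFractionRing A k :=
    IsIntegralClosure.isFractionRing_of_finite_extension F[X] F' k A
  have hfin : Module.Finite F[X] A := IsIntegralClosure.finite F[X] F' k A
  have hcl : Finite (ClassGroup A) := by
    have := Fintype.ofFinite F
    have := ClassGroup.fintypeOfAdmissibleOfFinite (S := A) F' k
      (Polynomial.cardPowDegreeIsAdmissible (Fq := F))
    infer_instance
  have hDedB : IsDedekindDomain (maxOrder A K) := integralClosure_isDedekindDomain A k K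
  have hfracB : IsFractionRing (maxOrder A K) K :=
    IsIntegralClosure.isFractionRing_of_finite_extension A k K _
  have hfinB : Module.Finite A (maxOrder A K) := IsIntegralClosure.finite A k K _
  have hfaithB : FaithfulSMul A (maxOrder A K) := by
    rw [faithfulSMul_iff_algebraMap_injective]
    refine .of_comp (f := algebraMap (maxOrder A K) K) ?_
    rw [← RingHom.coe_comp, ← IsScalarTower.algebraMap_eq, IsScalarTower.algebraMap_eq A k K]
    exact (algebraMap k K).injective.comp (IsFractionRing.injective A k)
  have h𝔭max : 𝔭.IsMaximal := h𝔭.isMaximal h𝔭0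
  obtain ⟨π, hπ, hπ0⟩ := Submodule.exists_mem_ne_zero_of_ne_bot h𝔭0
  have hπu : ¬IsUnit π := fun h ↦ h𝔭.ne_top (Ideal.eq_top_of_isUnit_mem _ hπ h)
  obtain ⟨M, hM, hπM, hXM, hMsq⟩ := exists_isMaximal_not_isSquare (F := F) (F' := F') p hp
    (fun y z hz ↦ ne_one_add_of_isNonsplit hK (valuation_two_eq_one hcharF Vinf) hsX σ hσs hz)
    hπ0 hπu
  have hM0 : M ≠ ⊥ := by
    rintro rfl
    exact h𝔭0 (hM.eq_of_le h𝔭.ne_top bot_le).symm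
  have hsX' : s ^ 2 = algebraMap A K (algebraMap F[X] A X) := by
    rw [hsX, IsScalarTower.algebraMap_apply F[X] A k]
    rfl
  obtain ⟨Q, i, hQ, hQM, hQ0, hi, hQi⟩ := Ideal.exists_pow_eq_map (B := maxOrder A K) hM0
    fun P Q _ _ hP hQ ↦ Ideal.eq_of_under_eq_of_not_isSquare σ hσ hσσ hsX' hσs hMsq hP hQ
  obtain ⟨h, a, hh, ha, hMh⟩ := exists_pow_eq_span_notMem hM0 h𝔭 fun h ↦ hπM (h hπ)
  have hQfin : Finite (maxOrder A K ⧸ Q) := by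
    have hMfin : Finite (A ⧸ M) := by
      obtain ⟨m, hm, hm0⟩ := Submodule.exists_mem_ne_zero_of_ne_bot hM0
      let _ : Algebra F A := ((algebraMap F[X] A).comp (algebraMap F F[X])).toAlgebra
      have : IsScalarTower F F[X] A := IsScalarTower.of_algebraMap_eq fun _ ↦ rfl
      have : FaithfulSMul F[X] A := by
        rw [faithfulSMul_iff_algebraMap_injective]
        refine .of_comp (f := algebraMap A k) ?_
        rw [← RingHom.coe_comp, ← IsScalarTower.algebraMap_eq, IsScalarTower.algebraMap_eq F[X] F' k]
        exact (algebraMap F' k).injective.comp (IsFractionRing.injective F[X] F')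
      have := finite_quotient_span (Module.Free.chooseBasis F[X] A) hm0
      have : Finite (A ⧸ Ideal.span {m}) := Module.finite_of_finite F
      exact Finite.of_surjective _
        (Ideal.Quotient.factor_surjective ((Ideal.span_singleton_le_iff_mem _).mpr hm))
    have : Q.LiesOver M := ⟨hQM.symm⟩
    exact Module.finite_of_finite (A ⧸ M)
  refine finite_torsion_of_principal_power (Q := Q) (H := i * h) (a := a) p hp hQ hQ0 (fun hle ↦ hπM ?_) ha
    (mul_ne_zero hi hh) ?_ E
  · rw [← hQM]
    exact hle (Ideal.mem_map_of_mem _ hπ)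
  · rw [pow_mul, ← hQi, ← Ideal.map_pow, hMh, Ideal.map_span, Set.image_singleton]

open scoped Classical in
-- What is needed is t in `A` with K = k(√t) and k separable over F(t); the latter holds as soon as
-- some derivation of k does not kill t. Multiplying t by the square of an element of `A` achieves
-- this.
theorem finite_torsion_of_trdeg_eq_one {F k K : Type*} [Field F] [Finite F] (p : ℕ)
    [Fact p.Prime] (hp : p ≠ 2) [CharP F p] [Field k] [Algebra F k] [Algebra.EssFiniteType F k]
    (htr : Algebra.trdeg F k = 1) {Vinf : ValuationSubring k}
    [Field K] [Algebra k K] [Algebra.IsQuadraticExtension k K] (hK : IsNonsplit K Vinf)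
    {𝔭 : Ideal (regularOutside Vinf)} (h𝔭 : 𝔭.IsPrime) (h𝔭0 : 𝔭 ≠ ⊥)
    (E : WeierstrassCurve (ringClassTower K 𝔭)) [E.IsElliptic] :
    Finite (AddCommGroup.torsion (WeierstrassCurve.Affine.Point E)) := by
  have : CharP k p := charP_of_injective_algebraMap (algebraMap F k).injective p
  have h2 := two_ne_zero_of_charP k p hp
  let A : Subring k := regularOutside Vinf
  let _ : Algebra F A := ((algebraMap F k).codRestrict A fun a ↦
    mem_regularOutside_of_isIntegral (isIntegral_algebraMap (R := F))).toAlgebra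
  have : IsScalarTower F A k := IsScalarTower.of_algebraMap_eq fun _ ↦ rfl
  -- a nonconstant element of `A`, hence `Frac A = k`
  have hfrac : IsFractionRing A k := by
    -- A nonzero element of `𝔭` is not a unit, hence not constant, so `A` is the integral closure of
    -- F[π] and has fraction field k.
    obtain ⟨π, hπ, hπ0⟩ := Submodule.exists_mem_ne_zero_of_ne_bot h𝔭0
    have hπu : ¬IsUnit π := fun h ↦ h𝔭.ne_top (Ideal.eq_top_of_isUnit_mem _ hπ h)
    have hπt : Transcendental F (π : k) := fun h ↦ hπu <| isUnit_of_mem F hπ0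
      ((ValuationSubring.isIntegral_finite_iff F).mp h.isIntegral Vinf)
    let _ : Algebra F[X] A := (aeval (R := F) π).toAlgebra
    let _ : Algebra F[X] k := (aeval (R := F) (π : k)).toAlgebra
    have : IsScalarTower F[X] A k := IsScalarTower.of_algebraMap_eq fun P ↦
      aeval_algebraMap_apply k π P
    have : IsScalarTower F F[X] k := IsScalarTower.of_algebraMap_eq fun a ↦ (aeval_C (π : k) a).symm
    have : FaithfulSMul F[X] k := by
      rw [faithfulSMul_iff_algebraMap_injective]
      exact transcendental_iff_injective.mp hπt
    have : Algebra.IsAlgebraic F[X] k := trdeg_eq_one_iff_isAlgebraic.mp htr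
    have : IsIntegralClosure A F[X] k := isIntegralClosure_regularOutside
    exact IsIntegralClosure.isFractionRing_of_algebraic F[X] A fun x hx ↦
      (map_eq_zero_iff _ (FaithfulSMul.algebraMap_injective F[X] k)).mp hx
  have htrans : Algebra.Transcendental F k := by
    rw [← trdeg_ne_zero_iff, htr]
    exact one_ne_zero
  obtain ⟨D, hD⟩ := exists_derivation_ne_zero (F := F) (k := k)
  obtain ⟨h, hDh⟩ : ∃ h : A, D h ≠ 0 := by
    by_contra! h0
    refine hD (Derivation.ext fun x ↦ ?_)
    obtain ⟨a, b, -, rfl⟩ := IsFractionRing.div_surjective (A := A) x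
    rw [D.leibniz_div, show D (algebraMap A k a) = 0 from h0 a,
      show D (algebraMap A k b) = 0 from h0 b]
    simp
  obtain ⟨s, d, hs, hd⟩ := Algebra.IsQuadraticExtension.exists_sq_eq k K h2
  obtain ⟨a, b, hb, rfl⟩ := IsFractionRing.div_surjective (A := A) d
  have hb0 : (b : k) ≠ 0 := fun h0 ↦ nonZeroDivisors.ne_zero hb (Subtype.ext h0)
  have hscale {c : k} (hc : c ≠ 0) {s : K} (hs : s ∉ (algebraMap k K).range) :
      algebraMap k K c * s ∉ (algebraMap k K).range := by
    rintro ⟨y, hy⟩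
    refine hs ⟨c⁻¹ * y, ?_⟩
    rw [map_mul, hy, map_inv₀, inv_mul_cancel_left₀]
    rwa [Ne, map_eq_zero]
  obtain ⟨s, d, hs, hd, hDd⟩ : ∃ (s : K) (d : A), s ∉ (algebraMap k K).range ∧
      s ^ 2 = algebraMap k K d ∧ D d ≠ 0 := by
    have hs1 := hscale hb0 hs
    have hd1 : (algebraMap k K b * s) ^ 2 = algebraMap k K (a * b : A) := by
      rw [mul_pow, hd, ← map_pow, ← map_mul]
      congr 1
      change (b : k) ^ 2 * ((a : k) / b) = a * b
      field_simp
    -- If D kills ab, then D(abh²) = 2ab·h·D(h), which is nonzero in odd characteristic.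
    by_cases hDd : D (a * b : A) = 0
    · have hh0 : (h : k) ≠ 0 := by
        intro h0
        rw [h0, map_zero] at hDh
        exact hDh rfl
      have hab0 : ((a * b : A) : k) ≠ 0 := by
        intro h0
        rw [h0, map_zero, pow_eq_zero_iff two_ne_zero] at hd1
        exact hs1 (hd1 ▸ ⟨0, map_zero _⟩)
      refine ⟨_, a * b * h ^ 2, hscale hh0 hs1, ?_, ?_⟩
      · rw [mul_pow, hd1, ← map_pow, ← map_mul]
        congr 1
        change _ = ((a * b : A) : k) * (h : k) ^ 2
        ring
      · change D (((a * b : A) : k) * (h : k) ^ 2) ≠ 0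
        rw [D.leibniz, hDd, smul_zero, add_zero, D.leibniz_pow]
        refine smul_ne_zero hab0 ?_
        simp [hh0, hDh, h2]
    · exact ⟨_, a * b, hs1, hd1, hDd⟩
  have hdt : Transcendental F (d : k) := transcendental_of_derivation_ne_zero D hDd
  have hinj : Function.Injective (aeval (R := F) (d : k)) := transcendental_iff_injective.mp hdt
  let _ : Algebra F[X] A := (aeval (R := F) d).toAlgebra
  let _ : Algebra F[X] k := (aeval (R := F) (d : k)).toAlgebra
  let _ : Algebra (FractionRing F[X]) k :=
    (IsFractionRing.lift (A := F[X]) (K := FractionRing F[X]) (g := algebraMap F[X] k) hinj).toAlgebra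
  have : IsScalarTower F[X] A k := IsScalarTower.of_algebraMap_eq fun P ↦
    aeval_algebraMap_apply k d P
  have : IsScalarTower F F[X] k := IsScalarTower.of_algebraMap_eq fun a ↦ (aeval_C (d : k) a).symm
  have : IsScalarTower F[X] (FractionRing F[X]) k := IsScalarTower.of_algebraMap_eq fun P ↦
    (IsFractionRing.lift_algebraMap hinj P).symm
  have : IsScalarTower F (FractionRing F[X]) k := IsScalarTower.of_algebraMap_eq fun a ↦ by
    rw [IsScalarTower.algebraMap_apply F F[X] (FractionRing F[X]),
      ← IsScalarTower.algebraMap_apply F[X] (FractionRing F[X]) k,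
      ← IsScalarTower.algebraMap_apply F F[X] k]
  have hXd : algebraMap F[X] k X = d := aeval_X (d : k)
  obtain ⟨hsep, hfin⟩ := isSeparable_finite_of_derivation_ne_zero htr (E := FractionRing F[X]) D
    (t := algebraMap F[X] _ X) (by
      rwa [← IsScalarTower.algebraMap_apply F[X] (FractionRing F[X]) k, hXd])
  exact finite_torsion_of_sq_eq (F := F) (F' := FractionRing F[X]) p hp hK hs (by rw [hd, hXd])
    h𝔭 h𝔭0 E

end RingClassTower

open RingClassTower in
open scoped Classical WeierstrassCurve.Affine in
theorem lemma2p2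
    (p : ℕ) [Fact p.Prime] (hp : p ≠ 2)
    (Fq : Type*) [Field Fq] [Finite Fq] [CharP Fq p]
    (k : Type*) [Field k] [Algebra Fq k] [Algebra Fq⟮X⟯ k] [IsScalarTower Fq Fq⟮X⟯ k]
    [FunctionField Fq k]
    (Vinf : ValuationSubring k) (hVinf : Vinf ≠ ⊤)
    (E : WeierstrassCurve k) [E.IsElliptic] (hE : Transcendental Fq E.j)
    (K : Type*) [Field K] [Algebra k K] [Algebra.IsQuadraticExtension k K]
    (hK : IsNonsplit K Vinf)
    (𝔭 : Ideal (regularOutside Vinf)) (h𝔭 : 𝔭.IsPrime) (h𝔭0 : 𝔭 ≠ ⊥) :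
    Finite (AddCommGroup.torsion (E⁄(ringClassTower K 𝔭)).Point) := by
  let _ : Algebra (Polynomial Fq) k := ((algebraMap Fq⟮X⟯ k).comp (algebraMap (Polynomial Fq) Fq⟮X⟯)).toAlgebra
  have : IsScalarTower (Polynomial Fq) Fq⟮X⟯ k := IsScalarTower.of_algebraMap_eq fun _ ↦ rfl
  have : IsScalarTower Fq (Polynomial Fq) k := IsScalarTower.of_algebraMap_eq fun a ↦ by
    rw [IsScalarTower.algebraMap_apply Fq Fq⟮X⟯ k,
      IsScalarTower.algebraMap_apply Fq (Polynomial Fq) Fq⟮X⟯,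
      ← IsScalarTower.algebraMap_apply (Polynomial Fq) Fq⟮X⟯ k]
  have : FaithfulSMul (Polynomial Fq) k := by
    rw [faithfulSMul_iff_algebraMap_injective]
    exact (algebraMap Fq⟮X⟯ k).injective.comp (IsFractionRing.injective (Polynomial Fq) Fq⟮X⟯)
  have : Algebra.IsAlgebraic (Polynomial Fq) k :=
    (IsFractionRing.comap_isAlgebraic_iff (A := Polynomial Fq) (K := Fq⟮X⟯) (C := k)).mpr inferInstance
  have htr : Algebra.trdeg Fq k = 1 := trdeg_eq_one_iff_isAlgebraic.mpr this
  have : Algebra.EssFiniteType (Polynomial Fq) Fq⟮X⟯ :=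
    Algebra.EssFiniteType.of_isLocalization _ (Polynomial Fq)⁰
  have : Algebra.EssFiniteType Fq Fq⟮X⟯ := Algebra.EssFiniteType.comp Fq (Polynomial Fq) Fq⟮X⟯
  have : Algebra.EssFiniteType Fq k := Algebra.EssFiniteType.comp Fq Fq⟮X⟯ k
  have : (E⁄(ringClassTower K 𝔭)).IsElliptic :=
    inferInstanceAs (E.map (algebraMap k (ringClassTower K 𝔭))).IsElliptic
  exact finite_torsion_of_trdeg_eq_one p hp htr hK h𝔭 h𝔭0 _
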